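/- Let $R$ be a commutative ring. All chain complexes are $\mathbb Z$-graded complexes of $R$-modules with differential of degree $-1$; tensor products of complexes, of coalgebras and of comodules carry the Koszul signs. Definitions. A coaugmented chain coalgebra $C$ is a coassociative counital coalgebra in chain complexes, with comultiplication $\Delta$ and counit $\varepsilon$, together with a coaugmentation $R\to C$, $1\mapsto 1_C$, that is a morphism of chain coalgebras; $\overline C$ is its coaugmentation coideal, identified with $\ker\varepsilon$, and for $c\in C$ we write $s^{-1}c$ for the desuspension (of degree $|c|-1$) of $c-\varepsilon(c)1_C\in\overline C$. Let $\mathbf{BiComod}$ be the category of pairs $(N,C)$, where $C$ is a coaugmented chain coalgebra and $N$ is a (counital, coassociative) chain $C$-bicomodule with a coaugmentation $R\to N$, $1\mapsto 1_N$, that is a morphism of chain $C$-bicomodules. A morphism $(N,C)\to(N',C')$ is a pair $(g,f)$, with $f:C\to C'$ a morphism of coaugmented chain coalgebras and $g:N\to N'$ a morphism of chain $C'$-bicomodules, where $C'$ coacts on $N$ along $f$. Put $(N,C)\otimes(N',C')=(N\otimes N',C\otimes C')$. The cobar construction $\Omega C$ is the chain algebra $T(s^{-1}\overline C)$ (words are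 written with bars) whose differential is the derivation with $$d_\Omega(s^{-1}c)=-s^{-1}(dc)+\sum_i(-1)^{|c_i|}\,s^{-1}c_i|s^{-1}c^i,\qquad c\in\overline C,\quad \Delta(c)=\sum_i c_i\otimes c^i .$$ The coHochschild complex is $\widehat{\mathscr H}(N,C)=(N\otimes T(s^{-1}\overline C),d)$, where for homogeneous $x\in N$ and a homogeneous $w\in T(s^{-1}\overline C)$, if the left and right coactions are $\lambda(x)=\sum_i e_i\otimes x^i$ and $\rho(x)=\sum_j x_j\otimes e^j$, $$d(x\otimes w)=dx\otimes w+(-1)^{|x|}x\otimes d_\Omega w-\sum_j(-1)^{|x_j|}x_j\otimes s^{-1}e^j|w+\sum_i(-1)^{(|e_i|-1)(|x^i|+|w|)}x^i\otimes w|s^{-1}e_i .$$ It is a functor on $\mathbf{BiComod}$, by $x\otimes s^{-1}c_1|\cdots|s^{-1}c_n\mapsto g(x)\otimes s^{-1}f(c_1)|\cdots|s^{-1}f(c_n)$. There are an inclusion $\iota:\Omega C\to\widehat{\mathscr H}(N,C)$, $w\mapsto 1_N\otimes w$, and a projection $\pi:\widehat{\mathscr H}(N,C)\to N$, $x\otimes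 1\mapsto x$, $x\otimes w\mapsto 0$ for words $w$ of positive length. Both are chain maps. Milgram's map $q:\Omega(C\otimes C')\to\Omega C\otimes\Omega C'$ is the morphism of chain algebras with $s^{-1}(c\otimes 1)\mapsto s^{-1}c\otimes 1$, $s^{-1}(1\otimes c')\mapsto 1\otimes s^{-1}c'$ and $s^{-1}(c\otimes c')\mapsto 0$ for $c\in\overline C$, $c'\in\overline{C'}$. Theorem. For all objects $(N,C)$ and $(N',C')$ of $\mathbf{BiComod}$ there is a chain homotopy equivalence $$\hat q:\widehat{\mathscr H}(N\otimes N',C\otimes C')\longrightarrow\widehat{\mathscr H}(N,C)\otimes\widehat{\mathscr H}(N',C'),$$ natural in both pairs, with a homotopy inverse $\hat s$ and chain homotopies $\hat s\hat q\simeq\mathrm{id}$ and $\hat q\hat s\simeq\mathrm{id}$ that are natural in both pairs as well, such that $$\hat q\circ\iota=(\iota\otimes\iota)\circ q:\Omega(C\otimes C')\to\widehat{\mathscr H}(N,C)\otimes\widehat{\mathscr H}(N',C')$$ and $$(\pi\otimes\pi)\circ\hat q=\pi:\widehat{\mathscr H}(N\otimes N',C\otimes C')\to N\otimes N'.$$ 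-/

import Mathlib

open scoped TensorProduct

universe u v w

noncomputable section

set_option linter.unusedSectionVars false

namespace CoHoch

/-! ### Graded modules and chain complexes -/

/-- A `ℤ`-grading on the `R`-module `M`: `M = ⨁ n, gr R M n`. -/
class GrMod (R : Type u) [CommRing R] (M : Type v) [AddCommGroup M] [Module R M] where
  gr (R M) : ℤ → Submodule R M
  internal (R M) : DirectSum.IsInternal gr

/-- A chain complex of `R`-modules (indexed by `ℤ`, differential of degree `-1`),
written as a graded module with a square-zero endomorphism of degree `-1`. -/
class DGMod (R : Type u) [CommRing R] (M : Type v) [AddCommGroup M] [Module R M]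
    extends GrMod R M where
  d (R) : M →ₗ[R] M
  d_mem : ∀ n x, x ∈ gr n → d x ∈ gr (n - 1)
  d_d : ∀ x, d (d x) = 0

open GrMod DGMod

/-- The sign `(-1)^n` as an element of `R`. -/
def ksign (R : Type u) [CommRing R] (n : ℤ) : R := ((n.negOnePow : ℤ) : R)

section Basics

variable {R : Type u} [CommRing R]
variable {M : Type*} [AddCommGroup M] [Module R M] [GrMod R M]
variable {N : Type*} [AddCommGroup N] [Module R N] [GrMod R N]
variable {P : Type*} [AddCommGroup P] [Module R P]

@[simp] theorem ksign_zero : ksign R 0 = 1 := by simp [ksign]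
@[simp] theorem ksign_one : ksign R 1 = -1 := by simp [ksign]
theorem ksign_add (a b : ℤ) : ksign R (a + b) = ksign R a * ksign R b := by
  simp [ksign, Int.negOnePow_add]
theorem ksign_sub (a b : ℤ) : ksign R (a - b) = ksign R a * ksign R b := by
  simp [ksign, Int.negOnePow_sub]
theorem ksign_neg (a : ℤ) : ksign R (-a) = ksign R a := by simp [ksign]
theorem ksign_even {a : ℤ} (h : Even a) : ksign R a = 1 := by simp [ksign, Int.negOnePow_even a h]
theorem ksign_odd {a : ℤ} (h : Odd a) : ksign R a = -1 := by simp [ksign, Int.negOnePow_odd a h]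
theorem ksign_mul_self (a : ℤ) : ksign R a * ksign R a = 1 := by
  rw [← ksign_add, ksign_even ⟨a, rfl⟩]
theorem ksign_smul_self (a : ℤ) (x : P) : ksign R a • ksign R a • x = x := by
  rw [smul_smul, ksign_mul_self, one_smul]
theorem ksign_congr {a b : ℤ} (h : Even (a - b)) : ksign R a = ksign R b := by
  have := ksign_even (R := R) h
  rw [ksign_sub] at this
  calc ksign R a = ksign R a * (ksign R b * ksign R b) := by rw [ksign_mul_self, mul_one]
    _ = ksign R b := by rw [← mul_assoc, this, one_mul]

theorem gr_induction {p : M → Prop} (hadd : ∀ x y, p x → p y → p (x + y))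
    (hhom : ∀ n, ∀ x ∈ gr R M n, p x) (x : M) : p x := by
  have hx : x ∈ ⨆ n, gr R M n := by
    rw [(internal R M).submodule_iSup_eq_top]; trivial
  exact Submodule.iSup_induction (gr R M) (motive := p) hx hhom (hhom 0 0 (zero_mem _)) hadd

theorem gr_hom_ext {f g : M →ₗ[R] P} (h : ∀ n, ∀ x ∈ gr R M n, f x = g x) : f = g := by
  ext x
  exact gr_induction (R := R) (p := fun x => f x = g x)
    (fun x y hx hy => by rw [map_add, map_add, hx, hy]) h x

theorem tensor_hom_ext {f g : M ⊗[R] N →ₗ[R] P}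
    (h : ∀ i, ∀ x ∈ gr R M i, ∀ j, ∀ y ∈ gr R N j, f (x ⊗ₜ y) = g (x ⊗ₜ y)) : f = g :=
  TensorProduct.ext (gr_hom_ext fun i x hx => gr_hom_ext fun j y hy => h i x hx j y hy)

theorem coe_bijective : Function.Bijective (DirectSum.coeLinearMap (gr R M)) := internal R M

/-- The linear map with prescribed restrictions to the homogeneous components. -/
def ofComponents {P : Type*} [AddCommMonoid P] [Module R P] (f : ∀ n, gr R M n →ₗ[R] P) :
    M →ₗ[R] P :=
  DirectSum.toModule R ℤ P f ∘ₗ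
    (LinearEquiv.ofBijective (DirectSum.coeLinearMap (gr R M)) coe_bijective).symm.toLinearMap

theorem ofComponents_apply {P : Type*} [AddCommMonoid P] [Module R P]
    (f : ∀ n, gr R M n →ₗ[R] P) {n : ℤ} {x : M} (hx : x ∈ gr R M n) :
    ofComponents f x = f n ⟨x, hx⟩ := by
  have : (LinearEquiv.ofBijective (DirectSum.coeLinearMap (gr R M)) coe_bijective).symm x
      = DirectSum.lof R ℤ (fun n => gr R M n) n ⟨x, hx⟩ := by
    rw [LinearEquiv.symm_apply_eq]; simp
  simp [ofComponents, this]

theorem internal_of_proj {A : ℤ → Submodule R P} (π : ℤ → P →ₗ[R] P)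
    (h1 : ∀ n, ∀ x ∈ A n, π n x = x) (h2 : ∀ m n, m ≠ n → ∀ x ∈ A n, π m x = 0)
    (h3 : ∀ x, x ∈ ⨆ n, A n) : DirectSum.IsInternal A := by
  apply DirectSum.isInternal_submodule_of_iSupIndep_of_iSup_eq_top
  · apply iSupIndep_of_dfinsupp_lsum_injective
    rw [← LinearMap.ker_eq_bot, LinearMap.ker_eq_bot']
    intro f hf
    ext m
    have key : ∀ f : (Π₀ i, A i), π m (DFinsupp.lsum ℕ (fun i => (A i).subtype) f) = (f m : P) := by
      intro f
      induction f using DFinsupp.induction with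
      | h0 => simp
      | ha i b f _ _ ih =>
        rw [map_add, map_add, ih]
        by_cases him : i = m
        · subst him; simp [h1 i b b.2]
        · simp [DFinsupp.single_eq_of_ne (Ne.symm him), h2 m i (Ne.symm him) b b.2]
    have := key f
    rw [hf, map_zero] at this
    simpa using this.symm
  · exact eq_top_iff.2 fun x _ => h3 x

/-- Multiplication by `(-1)^(k * degree)`. -/
def sgn (R : Type u) [CommRing R] {M : Type*} [AddCommGroup M] [Module R M] [GrMod R M]
    (k : ℤ) : M →ₗ[R] M :=
  ofComponents fun n => ksign R (k * n) • (gr R M n).subtype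

theorem sgn_apply (k : ℤ) {n : ℤ} {x : M} (hx : x ∈ gr R M n) :
    sgn R k x = ksign R (k * n) • x := by
  rw [sgn, ofComponents_apply _ hx]; rfl

/-- A linear map between graded modules is homogeneous of degree `k`. -/
def HasDegree (R : Type u) [CommRing R] {M N : Type*} [AddCommGroup M] [Module R M] [GrMod R M]
    [AddCommGroup N] [Module R N] [GrMod R N] (k : ℤ) (f : M → N) : Prop :=
  ∀ n, ∀ x ∈ gr R M n, f x ∈ gr R N (n + k)

theorem sgn_mem (k : ℤ) {n : ℤ} {x : M} (hx : x ∈ gr R M n) : sgn R k x ∈ gr R M n := by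
  rw [sgn_apply k hx]; exact Submodule.smul_mem _ _ hx

theorem sgn_sgn (k : ℤ) (x : M) : sgn R k (sgn R k x) = x := by
  refine gr_induction (R := R) (p := fun x => sgn R k (sgn R k x) = x) ?_ ?_ x
  · intro x y hx hy; rw [map_add, map_add, hx, hy]
  · intro n x hx; rw [sgn_apply k (sgn_mem k hx), sgn_apply k hx, ksign_smul_self]

theorem HasDegree.sgn_comm {k : ℤ} {f : M →ₗ[R] N} (hf : HasDegree R k f) (l : ℤ) (x : M) :
    sgn R l (f x) = ksign R (l * k) • f (sgn R l x) := by
  refine gr_induction (R := R) (p := fun x => sgn R l (f x) = ksign R (l * k) • f (sgn R l x))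
    ?_ ?_ x
  · intro x y hx hy; simp only [map_add, hx, hy, smul_add]
  · intro n x hx
    rw [sgn_apply l (hf n x hx), sgn_apply l hx, map_smul, smul_smul, mul_add, ksign_add, mul_comm]

/-- The graded module `M ⊗ N`, with `(M ⊗ N)_n = ⨁ i + j = n, M_i ⊗ N_j`. -/
instance instGrModTensor : GrMod R (M ⊗[R] N) where
  gr n := Submodule.span R {z | ∃ i j, i + j = n ∧ ∃ x ∈ gr R M i, ∃ y ∈ gr R N j, x ⊗ₜ[R] y = z}
  internal := by
    let δ : M ⊗[R] N →ₗ[R] (ℤ →₀ M ⊗[R] N) :=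
      TensorProduct.lift (ofComponents fun i =>
        (LinearMap.flip (ofComponents fun j =>
          ((TensorProduct.mk R M N).compr₂ (Finsupp.lsingle (i + j))).flip ∘ₗ
            (gr R N j).subtype)) ∘ₗ (gr R M i).subtype)
    have hδ : ∀ n, ∀ z ∈ Submodule.span R {z | ∃ i j, i + j = n ∧ ∃ x ∈ gr R M i,
        ∃ y ∈ gr R N j, x ⊗ₜ[R] y = z}, δ z = Finsupp.single n z := by
      intro n z hz
      induction hz using Submodule.span_induction with
      | mem z hz =>
        obtain ⟨i, j, rfl, x, hx, y, hy, rfl⟩ := hz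
        simp [δ, ofComponents_apply _ hx, ofComponents_apply _ hy]
      | zero => simp
      | add x y _ _ hx hy => simp [hx, hy]
      | smul a x _ hx => simp [hx]
    refine internal_of_proj (fun n => Finsupp.lapply n ∘ₗ δ) ?_ ?_ ?_
    · intro n x hx; simp [hδ n x hx]
    · intro m n hmn x hx; simp [hδ n x hx, Finsupp.single_eq_of_ne hmn]
    · intro z
      induction z with
      | zero => exact zero_mem _
      | add x y hx hy => exact add_mem hx hy
      | tmul x y =>
        refine gr_induction (R := R) (p := fun x => x ⊗ₜ[R] y ∈ _) ?_ ?_ x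
        · intro x x' hx hx'; rw [TensorProduct.add_tmul]; exact add_mem hx hx'
        · intro i x hx
          refine gr_induction (R := R) (p := fun y => x ⊗ₜ[R] y ∈ _) ?_ ?_ y
          · intro y y' hy hy'; rw [TensorProduct.tmul_add]; exact add_mem hy hy'
          · intro j y hy
            exact Submodule.mem_iSup_of_mem (i + j)
              (Submodule.subset_span ⟨i, j, rfl, x, hx, y, hy, rfl⟩)

theorem tmul_mem {i j : ℤ} {x : M} {y : N} (hx : x ∈ gr R M i) (hy : y ∈ gr R N j) :
    x ⊗ₜ[R] y ∈ gr R (M ⊗[R] N) (i + j) :=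
  Submodule.subset_span ⟨i, j, rfl, x, hx, y, hy, rfl⟩

theorem tmul_mem' {i j n : ℤ} {x : M} {y : N} (hx : x ∈ gr R M i) (hy : y ∈ gr R N j)
    (h : i + j = n) : x ⊗ₜ[R] y ∈ gr R (M ⊗[R] N) n := h ▸ tmul_mem hx hy

theorem hasDegree_tensor {Q : Type*} [AddCommGroup Q] [Module R Q] [GrMod R Q]
    {k : ℤ} {f : M ⊗[R] N →ₗ[R] Q}
    (h : ∀ i, ∀ x ∈ gr R M i, ∀ j, ∀ y ∈ gr R N j, f (x ⊗ₜ y) ∈ gr R Q (i + j + k)) :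
    HasDegree R k f := by
  intro n z hz
  induction hz using Submodule.span_induction with
  | mem z hz =>
    obtain ⟨i, j, rfl, x, hx, y, hy, rfl⟩ := hz
    exact h i x hx j y hy
  | zero => simp
  | add x y _ _ hx hy => rw [map_add]; exact add_mem hx hy
  | smul a x _ hx => rw [map_smul]; exact Submodule.smul_mem _ _ hx

theorem sgn_tmul (k : ℤ) (x : M) (y : N) :
    sgn R k (x ⊗ₜ[R] y) = sgn R k x ⊗ₜ[R] sgn R k y := by
  have : sgn R k = TensorProduct.map (sgn R k : M →ₗ[R] M) (sgn R k : N →ₗ[R] N) := by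
    apply tensor_hom_ext
    intro i x hx j y hy
    rw [sgn_apply k (tmul_mem hx hy), TensorProduct.map_tmul, sgn_apply k hx, sgn_apply k hy,
      TensorProduct.smul_tmul_smul, mul_add, ksign_add]
  rw [this, TensorProduct.map_tmul]

/-- The symmetry of the graded tensor product, `x ⊗ y ↦ (-1)^(|x||y|) y ⊗ x`. -/
def gswap (R : Type u) [CommRing R] (M N : Type*) [AddCommGroup M] [Module R M] [GrMod R M]
    [AddCommGroup N] [Module R N] [GrMod R N] : M ⊗[R] N →ₗ[R] N ⊗[R] M :=
  TensorProduct.lift (ofComponents fun i =>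
    ((TensorProduct.mk R N M).flip.compl₂ (sgn R i)) ∘ₗ (gr R M i).subtype)

theorem gswap_tmul {i : ℤ} {x : M} (hx : x ∈ gr R M i) (y : N) :
    gswap R M N (x ⊗ₜ y) = sgn R i y ⊗ₜ x := by
  simp [gswap, ofComponents_apply _ hx]

theorem gswap_tmul_tmul {i j : ℤ} {x : M} {y : N} (hx : x ∈ gr R M i) (hy : y ∈ gr R N j) :
    gswap R M N (x ⊗ₜ y) = ksign R (i * j) • y ⊗ₜ x := by
  rw [gswap_tmul hx, sgn_apply i hy, TensorProduct.smul_tmul']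

end Basics

section Complexes

variable {R : Type u} [CommRing R]
variable {M : Type*} [AddCommGroup M] [Module R M] [DGMod R M]
variable {N : Type*} [AddCommGroup N] [Module R N] [DGMod R N]

theorem hasDegree_d : HasDegree R (-1) (d R : M →ₗ[R] M) := fun n x hx => d_mem n x hx

theorem sgn_d (k : ℤ) (x : M) : sgn R k (d R x) = ksign R k • d R (sgn R k x) := by
  rw [hasDegree_d.sgn_comm, mul_neg_one, ksign_neg]

/-- The tensor product of chain complexes, `d (x ⊗ y) = dx ⊗ y + (-1)^|x| x ⊗ dy`. -/
instance instDGModTensor : DGMod R (M ⊗[R] N) where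
  d := TensorProduct.map (d R) LinearMap.id + TensorProduct.map (sgn R 1) (d R)
  d_mem := hasDegree_tensor (k := -1) fun i x hx j y hy => by
    simp only [LinearMap.add_apply, TensorProduct.map_tmul, LinearMap.id_apply]
    exact add_mem (tmul_mem' (d_mem _ _ hx) hy (by ring))
      (tmul_mem' (sgn_mem 1 hx) (d_mem _ _ hy) (by ring))
  d_d z := by
    induction z with
    | zero => simp
    | add x y hx hy => rw [map_add, map_add, hx, hy, add_zero]
    | tmul x y =>
      simp only [LinearMap.add_apply, TensorProduct.map_tmul, LinearMap.id_apply, map_add, d_d,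
        TensorProduct.zero_tmul, TensorProduct.tmul_zero, sgn_d, ksign_one]
      simp [TensorProduct.neg_tmul]

theorem d_tmul (x : M) (y : N) :
    d R (x ⊗ₜ[R] y) = d R x ⊗ₜ y + sgn R 1 x ⊗ₜ d R y := rfl

end Complexes

/-! ### The tensor algebra on a graded module -/

section TensorAlg

variable {R : Type u} [CommRing R]
variable {W : Type*} [AddCommGroup W] [Module R W] [GrMod R W]

open TensorAlgebra (ι)

/-- Words `w₁ | ⋯ | wₖ` in homogeneous elements, with their total degree. -/
inductive HomogWord (R : Type u) [CommRing R] {W : Type v} [AddCommGroup W] [Module R W]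
    [GrMod R W] : ℤ → TensorAlgebra R W → Prop
  | one : HomogWord R 0 1
  | cons {i n : ℤ} {w : W} {a : TensorAlgebra R W} (hw : w ∈ gr R W i) (ha : HomogWord R n a) :
      HomogWord R (i + n) (ι R w * a)

theorem talg_induction {p : TensorAlgebra R W → Prop} (h1 : p 1)
    (hadd : ∀ a b, p a → p b → p (a + b)) (hsmul : ∀ (r : R) a, p a → p (r • a))
    (hmul : ∀ i, ∀ w ∈ gr R W i, ∀ a, p a → p (ι R w * a)) (a : TensorAlgebra R W) : p a := by
  have h0 : p 0 := by simpa using hsmul 0 _ h1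
  suffices h : ∀ a b : TensorAlgebra R W, p b → p (a * b) by simpa using h a 1 h1
  intro a
  induction a using TensorAlgebra.induction with
  | algebraMap r => intro b hb; rw [← Algebra.smul_def]; exact hsmul r b hb
  | ι w =>
    intro b hb
    refine gr_induction (R := R) (p := fun w => p (ι R w * b)) ?_ ?_ w
    · intro x y hx hy; rw [map_add, add_mul]; exact hadd _ _ hx hy
    · intro i w hw; exact hmul i w hw b hb
  | mul a a' ha ha' => intro b hb; rw [mul_assoc]; exact ha _ (ha' _ hb)
  | add a a' ha ha' => intro b hb; rw [add_mul]; exact hadd _ _ (ha _ hb) (ha' _ hb)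

/-- The grading of the tensor algebra for which `w₁ | ⋯ | wₖ` has degree `|w₁| + ⋯ + |wₖ|`. -/
instance instGrModTensorAlgebra : GrMod R (TensorAlgebra R W) where
  gr n := Submodule.span R {a | HomogWord R n a}
  internal := by
    let δ : TensorAlgebra R W →ₐ[R] AddMonoidAlgebra (TensorAlgebra R W) ℤ :=
      TensorAlgebra.lift R (ofComponents fun i =>
        AddMonoidAlgebra.lsingle i ∘ₗ ι R ∘ₗ (gr R W i).subtype)
    let π : ℤ → TensorAlgebra R W →ₗ[R] TensorAlgebra R W := fun n =>
      Finsupp.lapply n ∘ₗ (AddMonoidAlgebra.coeffLinearEquiv R).toLinearMap ∘ₗ δ.toLinearMap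
    have hw : ∀ n a, HomogWord R n a → δ a = AddMonoidAlgebra.single n a := by
      intro n a ha
      induction ha with
      | one => rw [map_one]; rfl
      | cons hw ha ih =>
        rw [map_mul, ih, TensorAlgebra.lift_ι_apply, ofComponents_apply _ hw]
        exact AddMonoidAlgebra.single_mul_single _ _ _ _
    have hπ : ∀ m n, ∀ a ∈ Submodule.span R {a : TensorAlgebra R W | HomogWord R n a},
        π m a = if m = n then a else 0 := by
      intro m n a ha
      induction ha using Submodule.span_induction with
      | mem a ha =>
        have : π m a = (δ a).coeff m := rfl
        rw [this, hw n a ha, AddMonoidAlgebra.coeff_single, Finsupp.single_apply]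
        simp only [eq_comm]
      | zero => simp
      | add x y _ _ hx hy => rw [map_add, hx, hy]; split_ifs <;> simp
      | smul r x _ hx => rw [map_smul, hx]; split_ifs <;> simp
    refine internal_of_proj π ?_ ?_ ?_
    · intro n x hx; rw [hπ n n x hx, if_pos rfl]
    · intro m n hmn x hx; rw [hπ m n x hx, if_neg hmn]
    · intro a
      refine talg_induction (p := fun a => a ∈ ⨆ n,
        Submodule.span R {a : TensorAlgebra R W | HomogWord R n a}) ?_ ?_ ?_ ?_ a
      · exact Submodule.mem_iSup_of_mem 0 (Submodule.subset_span .one)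
      · exact fun a b => add_mem
      · exact fun r a => Submodule.smul_mem _ r
      · intro i w hw a ha
        refine Submodule.iSup_induction _ (motive := fun a => ι R w * a ∈ _) ha ?_ ?_ ?_
        · intro n a ha
          refine Submodule.mem_iSup_of_mem (i + n) ?_
          induction ha using Submodule.span_induction with
          | mem a ha => exact Submodule.subset_span (.cons hw ha)
          | zero => simp
          | add x y _ _ hx hy => rw [mul_add]; exact add_mem hx hy
          | smul r x _ hx => rw [mul_smul_comm]; exact Submodule.smul_mem _ _ hx
        · simp
        · intro a b ha hb; rw [mul_add]; exact add_mem ha hb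

theorem talg_gr_induction {p : ℤ → TensorAlgebra R W → Prop} (h1 : p 0 1)
    (h0 : ∀ n, p n 0) (hadd : ∀ n a b, p n a → p n b → p n (a + b))
    (hsmul : ∀ n (r : R) a, p n a → p n (r • a))
    (hmul : ∀ i, ∀ w ∈ gr R W i, ∀ n, ∀ a ∈ gr R (TensorAlgebra R W) n,
      p n a → p (i + n) (ι R w * a))
    {n : ℤ} {a : TensorAlgebra R W} (ha : a ∈ gr R (TensorAlgebra R W) n) : p n a := by
  induction ha using Submodule.span_induction with
  | mem a ha =>
    induction ha with
    | one => exact h1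
    | cons hw ha ih => exact hmul _ _ hw _ _ (Submodule.subset_span ha) ih
  | zero => exact h0 n
  | add x y _ _ hx hy => exact hadd n _ _ hx hy
  | smul r x _ hx => exact hsmul n _ _ hx

theorem talg_one_mem : (1 : TensorAlgebra R W) ∈ gr R (TensorAlgebra R W) 0 :=
  Submodule.subset_span .one

theorem talg_mul_mem {i j : ℤ} {a b : TensorAlgebra R W} (ha : a ∈ gr R (TensorAlgebra R W) i)
    (hb : b ∈ gr R (TensorAlgebra R W) j) : a * b ∈ gr R (TensorAlgebra R W) (i + j) := by
  refine talg_gr_induction (p := fun i a => a * b ∈ gr R (TensorAlgebra R W) (i + j))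
    ?_ ?_ ?_ ?_ ?_ ha
  · simpa using hb
  · simp
  · intro n a a' h h'; rw [add_mul]; exact add_mem h h'
  · intro n r a h; rw [smul_mul_assoc]; exact Submodule.smul_mem _ _ h
  · intro i w hw n a _ ih
    rw [mul_assoc, add_assoc]
    refine talg_gr_induction (p := fun m c => ι R w * c ∈ gr R (TensorAlgebra R W) (i + m))
      ?_ ?_ ?_ ?_ ?_ ih
    · exact Submodule.subset_span (.cons hw .one)
    · simp
    · intro n a a' h h'; rw [mul_add]; exact add_mem h h'
    · intro n r a h; rw [mul_smul_comm]; exact Submodule.smul_mem _ _ h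
    · intro k v hv m c hc _
      have : ∀ e ∈ gr R (TensorAlgebra R W) (k + m),
          ι R w * e ∈ gr R (TensorAlgebra R W) (i + (k + m)) := by
        intro e he
        induction he using Submodule.span_induction with
        | mem a ha => exact Submodule.subset_span (.cons hw ha)
        | zero => simp
        | add x y _ _ hx hy => rw [mul_add]; exact add_mem hx hy
        | smul r x _ hx => rw [mul_smul_comm]; exact Submodule.smul_mem _ _ hx
      refine this _ ?_
      clear * - hc hv
      induction hc using Submodule.span_induction with
      | mem a ha => exact Submodule.subset_span (.cons hv ha)
      | zero => simp
      | add x y _ _ hx hy => rw [mul_add]; exact add_mem hx hy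
      | smul r x _ hx => rw [mul_smul_comm]; exact Submodule.smul_mem _ _ hx

theorem talg_ι_mem {i : ℤ} {w : W} (hw : w ∈ gr R W i) :
    ι R w ∈ gr R (TensorAlgebra R W) i := by
  have : ι R w * 1 ∈ gr R (TensorAlgebra R W) (i + 0) := Submodule.subset_span (.cons hw .one)
  rwa [mul_one, add_zero] at this

theorem hasDegree_ι : HasDegree R 0 (ι R : W →ₗ[R] TensorAlgebra R W) := fun n x hx => by
  rw [add_zero]; exact talg_ι_mem hx

theorem sgn_talg_one (k : ℤ) : sgn R k (1 : TensorAlgebra R W) = 1 := by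
  rw [sgn_apply k talg_one_mem]; simp

theorem sgn_ι (k : ℤ) (w : W) : sgn R k (ι R w) = ι R (sgn R k w) := by
  rw [hasDegree_ι.sgn_comm]; simp

theorem sgn_talg_mul (k : ℤ) (a b : TensorAlgebra R W) :
    sgn R k (a * b) = sgn R k a * sgn R k b := by
  have : (LinearMap.mul R (TensorAlgebra R W)).compr₂ (sgn R k) =
      (LinearMap.mul R (TensorAlgebra R W)).compl₁₂ (sgn R k) (sgn R k) := by
    refine gr_hom_ext fun i a ha => gr_hom_ext fun j b hb => ?_
    simp only [LinearMap.compr₂_apply, LinearMap.mul_apply', LinearMap.compl₁₂_apply]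
    rw [sgn_apply k (talg_mul_mem ha hb), sgn_apply k ha, sgn_apply k hb, smul_mul_smul_comm,
      mul_add, ksign_add]
  exact LinearMap.congr_fun₂ this a b

/-- Auxiliary algebra map `a ↦ !![(-1)^|a| a, D a; 0, a]` encoding the derivation `derivExt δ`. -/
def derivMat (δ : W →ₗ[R] TensorAlgebra R W) :
    TensorAlgebra R W →ₐ[R] Matrix (Fin 2) (Fin 2) (TensorAlgebra R W) :=
  TensorAlgebra.lift R
    { toFun := fun w => !![sgn R 1 (ι R w), δ w; 0, ι R w]
      map_add' := fun x y => by ext i j; fin_cases i <;> fin_cases j <;> simp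
      map_smul' := fun r x => by ext i j; fin_cases i <;> fin_cases j <;> simp }

/-- The derivation `D` of the tensor algebra extending `δ : W → T(W)`: `D 1 = 0`, `D w = δ w`, and
`D (a b) = (D a) b + (-1)^|a| a (D b)`. -/
def derivExt (δ : W →ₗ[R] TensorAlgebra R W) : TensorAlgebra R W →ₗ[R] TensorAlgebra R W :=
  Matrix.entryLinearMap R (TensorAlgebra R W) 0 1 ∘ₗ (derivMat δ).toLinearMap

variable (δ : W →ₗ[R] TensorAlgebra R W)

theorem derivMat_apply (a : TensorAlgebra R W) :
    derivMat δ a 0 0 = sgn R 1 a ∧ derivMat δ a 1 0 = 0 ∧ derivMat δ a 1 1 = a := by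
  refine talg_induction (p := fun a => derivMat δ a 0 0 = sgn R 1 a ∧ derivMat δ a 1 0 = 0 ∧
    derivMat δ a 1 1 = a) ?_ ?_ ?_ ?_ a
  · simp [sgn_talg_one]
  · rintro a b ⟨h1, h2, h3⟩ ⟨h1', h2', h3'⟩
    simp [h1, h2, h3, h1', h2', h3']
  · rintro r a ⟨h1, h2, h3⟩
    simp [h1, h2, h3]
  · rintro i w hw a ⟨h1, h2, h3⟩
    simp only [map_mul, Matrix.mul_apply, Fin.sum_univ_two, h1, h2, h3]
    simp [derivMat, sgn_talg_mul]

theorem derivExt_ι (w : W) : derivExt δ (ι R w) = δ w := by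
  simp [derivExt, derivMat]

theorem derivExt_one : derivExt δ 1 = 0 := by
  simp [derivExt]

theorem derivExt_mul (a b : TensorAlgebra R W) :
    derivExt δ (a * b) = derivExt δ a * b + sgn R 1 a * derivExt δ b := by
  simp only [derivExt, LinearMap.comp_apply, AlgHom.toLinearMap_apply, map_mul,
    Matrix.entryLinearMap_apply, Matrix.mul_apply, Fin.sum_univ_two, (derivMat_apply δ a).1,
    (derivMat_apply δ b).2.2]
  rw [add_comm]

theorem hasDegree_derivExt {k : ℤ} (h : HasDegree R k δ) : HasDegree R k (derivExt δ) := by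
  intro n a ha
  refine talg_gr_induction (p := fun n a => derivExt δ a ∈ gr R (TensorAlgebra R W) (n + k))
    ?_ ?_ ?_ ?_ ?_ ha
  · rw [derivExt_one]; exact zero_mem _
  · intro n; rw [map_zero]; exact zero_mem _
  · intro n a b ha hb; rw [map_add]; exact add_mem ha hb
  · intro n r a ha; rw [map_smul]; exact Submodule.smul_mem _ _ ha
  · intro i w hw n a ha ih
    rw [derivExt_mul, derivExt_ι]
    refine add_mem ?_ ?_
    · have := talg_mul_mem (h i w hw) ha
      rwa [add_right_comm] at this
    · have := talg_mul_mem (sgn_mem 1 (talg_ι_mem hw)) ih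
      rwa [← add_assoc] at this

end TensorAlg

/-! ### Coaugmented chain coalgebras and bicomodules -/

/-- A coaugmented chain coalgebra `C`: a coassociative counital coalgebra in chain complexes,
with a coaugmentation `R → C`, `1 ↦ one`, that is a morphism of chain coalgebras. -/
class DGCoalg (R : Type u) [CommRing R] (C : Type v) [AddCommGroup C] [Module R C]
    extends DGMod R C where
  comul (R) : C →ₗ[R] C ⊗[R] C
  counit (R) : C →ₗ[R] R
  one (R C) : C
  comul_mem : ∀ n, ∀ x ∈ gr n, comul x ∈ GrMod.gr R (C ⊗[R] C) n
  counit_of_ne : ∀ n, n ≠ 0 → ∀ x ∈ gr n, counit x = 0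
  one_mem : one ∈ gr 0
  d_comul : ∀ x, DGMod.d R (comul x) = comul (d x)
  counit_d : ∀ x, counit (d x) = 0
  d_one : d one = 0
  coassoc : ∀ x, TensorProduct.assoc R C C C (comul.rTensor C (comul x)) =
    comul.lTensor C (comul x)
  counit_left : ∀ x, TensorProduct.lid R C (counit.rTensor C (comul x)) = x
  counit_right : ∀ x, TensorProduct.rid R C (counit.lTensor C (comul x)) = x
  comul_one : comul one = one ⊗ₜ one
  counit_one : counit one = 1

open DGCoalg

/-- A coaugmented chain `C`-bicomodule structure on the chain complex `N`: commuting coassociative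
counital coactions `N → C ⊗ N` and `N → N ⊗ C` by chain maps, and a coaugmentation `R → N`,
`1 ↦ coaug`, that is a morphism of chain `C`-bicomodules. -/
class DGBicomod (R : Type u) [CommRing R] (C : Type v) [AddCommGroup C] [Module R C]
    [DGCoalg R C] (N : Type w) [AddCommGroup N] [Module R N] [DGMod R N] where
  coactL (R C) : N →ₗ[R] C ⊗[R] N
  coactR (R C) : N →ₗ[R] N ⊗[R] C
  coaug (R C N) : N
  coactL_mem : ∀ n, ∀ x ∈ gr R N n, coactL x ∈ gr R (C ⊗[R] N) n
  coactR_mem : ∀ n, ∀ x ∈ gr R N n, coactR x ∈ gr R (N ⊗[R] C) n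
  coaug_mem : coaug ∈ gr R N 0
  d_coactL : ∀ x, d R (coactL x) = coactL (d R x)
  d_coactR : ∀ x, d R (coactR x) = coactR (d R x)
  d_coaug : d R coaug = 0
  coassocL : ∀ x, TensorProduct.assoc R C C N ((comul R).rTensor N (coactL x)) =
    coactL.lTensor C (coactL x)
  coassocR : ∀ x, TensorProduct.assoc R N C C (coactR.rTensor C (coactR x)) =
    (comul R).lTensor N (coactR x)
  coassocLR : ∀ x, TensorProduct.assoc R C N C (coactL.rTensor C (coactR x)) =
    coactR.lTensor C (coactL x)
  counitL : ∀ x, TensorProduct.lid R N ((counit R).rTensor N (coactL x)) = x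
  counitR : ∀ x, TensorProduct.rid R N ((counit R).lTensor N (coactR x)) = x
  coactL_coaug : coactL coaug = one R C ⊗ₜ coaug
  coactR_coaug : coactR coaug = coaug ⊗ₜ one R C

open DGBicomod

/-! ### The cobar construction -/

section Cobar

variable (R : Type u) [CommRing R] (C : Type*) [AddCommGroup C] [Module R C] [DGCoalg R C]

/-- The graded module `s⁻¹ C̄`, where the coaugmentation coideal `C̄` is identified with the kernel
of the counit: the element `s⁻¹ c` is given by `c` and has degree `|c| - 1`. -/
def DesuspCoideal : Type _ := LinearMap.ker (counit R : C →ₗ[R] R)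

instance : AddCommGroup (DesuspCoideal R C) :=
  inferInstanceAs (AddCommGroup (LinearMap.ker (counit R : C →ₗ[R] R)))
instance : Module R (DesuspCoideal R C) :=
  inferInstanceAs (Module R (LinearMap.ker (counit R : C →ₗ[R] R)))

/-- The map `s⁻¹ c ↦ c`. -/
def desuspIncl : DesuspCoideal R C →ₗ[R] C := (LinearMap.ker (counit R : C →ₗ[R] R)).subtype

theorem desuspIncl_injective : Function.Injective (desuspIncl R C) := Subtype.val_injective

variable {C}

/-- The map `c ↦ s⁻¹ c̄`, where `c̄ = c - ε(c) 1` is the image of `c` in the coaugmentation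
coideal. -/
def desusp : C →ₗ[R] DesuspCoideal R C :=
  LinearMap.codRestrict (LinearMap.ker (counit R : C →ₗ[R] R))
    (LinearMap.id - (counit R).smulRight (one R C)) fun c => by
      simp [DGCoalg.counit_one]

theorem desuspIncl_desusp (c : C) : desuspIncl R C (desusp R c) = c - counit R c • one R C := rfl

theorem counit_desuspIncl (w : DesuspCoideal R C) : counit R (desuspIncl R C w) = 0 := w.2

theorem desusp_desuspIncl (w : DesuspCoideal R C) : desusp R (desuspIncl R C w) = w := by
  apply desuspIncl_injective
  rw [desuspIncl_desusp, counit_desuspIncl, zero_smul, sub_zero]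

theorem desusp_one : desusp R (one R C) = 0 := by
  apply desuspIncl_injective
  rw [desuspIncl_desusp, DGCoalg.counit_one, one_smul, sub_self, map_zero]

theorem counit_smul_one_mem {n : ℤ} {c : C} (hc : c ∈ gr R C n) :
    counit R c • one R C ∈ gr R C n := by
  by_cases hn : n = 0
  · subst hn; exact Submodule.smul_mem _ _ DGCoalg.one_mem
  · rw [counit_of_ne n hn c hc, zero_smul]; exact zero_mem _

instance : GrMod R (DesuspCoideal R C) where
  gr n := (gr R C (n + 1)).comap (desuspIncl R C)
  internal := by
    have hinj := desuspIncl_injective R C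
    refine internal_of_proj (fun n => desusp R ∘ₗ
      ofComponents (fun m => if m = n + 1 then (gr R C m).subtype else 0) ∘ₗ desuspIncl R C)
      ?_ ?_ ?_
    · intro n x hx
      simp only [LinearMap.comp_apply]
      rw [ofComponents_apply _ (show desuspIncl R C x ∈ gr R C (n + 1) from hx), if_pos rfl]
      exact desusp_desuspIncl R x
    · intro m n hmn x hx
      simp only [LinearMap.comp_apply]
      rw [ofComponents_apply _ (show desuspIncl R C x ∈ gr R C (n + 1) from hx),
        if_neg (by omega)]
      simp
    · intro x
      rw [← desusp_desuspIncl R x]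
      refine gr_induction (R := R) (p := fun c : C => desusp R c ∈ ⨆ n,
        (gr R C (n + 1)).comap (desuspIncl R C)) ?_ ?_ _
      · intro a b ha hb; rw [map_add]; exact add_mem ha hb
      · intro n c hc
        refine Submodule.mem_iSup_of_mem (n - 1) ?_
        rw [Submodule.mem_comap, sub_add_cancel, desuspIncl_desusp]
        exact sub_mem hc (counit_smul_one_mem R hc)

variable (C)

/-- The graded algebra `T(s⁻¹ C̄)` underlying the cobar construction `Ω C`. -/
abbrev Cobar : Type _ := TensorAlgebra R (DesuspCoideal R C)

variable {C}

/-- The map `C → Ω C`, `c ↦ s⁻¹ c̄`, of degree `-1`. -/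
def univTw : C →ₗ[R] Cobar R C := TensorAlgebra.ι R ∘ₗ desusp R

theorem univTw_one : univTw R (one R C) = 0 := by simp [univTw, desusp_one]

theorem ι_eq_univTw (w : DesuspCoideal R C) :
    TensorAlgebra.ι R w = univTw R (desuspIncl R C w) := by
  rw [univTw, LinearMap.comp_apply, desusp_desuspIncl]

theorem hasDegree_univTw : HasDegree R (-1) (univTw R : C →ₗ[R] Cobar R C) := by
  intro n c hc
  refine talg_ι_mem ?_
  show desuspIncl R C (desusp R c) ∈ gr R C (n + -1 + 1)
  rw [neg_add_cancel_right, desuspIncl_desusp]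
  exact sub_mem hc (counit_smul_one_mem R hc)

theorem sgn_univTw (k : ℤ) (c : C) : sgn R k (univTw R c) = ksign R k • univTw R (sgn R k c) := by
  rw [(hasDegree_univTw R).sgn_comm, mul_neg_one, ksign_neg]

/-- The map `C ⊗ C → Ω C`, `c ⊗ c' ↦ (-1)^|c| s⁻¹c̄ | s⁻¹c̄'`. -/
def univTwSq : C ⊗[R] C →ₗ[R] Cobar R C :=
  LinearMap.mul' R (Cobar R C) ∘ₗ TensorProduct.map (univTw R ∘ₗ sgn R 1) (univTw R)

theorem univTwSq_tmul (a b : C) :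
    univTwSq R (a ⊗ₜ[R] b) = univTw R (sgn R 1 a) * univTw R b := rfl

variable (C)

/-- The differential of the cobar construction: the derivation with
`d (s⁻¹ c) = - s⁻¹ (d c) + ∑ (-1)^|cᵢ| s⁻¹ cᵢ | s⁻¹ cⁱ`,
where `∑ cᵢ ⊗ cⁱ` is the reduced comultiplication of `c`. -/
def cobarD : Cobar R C →ₗ[R] Cobar R C :=
  derivExt ((- (univTw R ∘ₗ d R) + univTwSq R ∘ₗ comul R) ∘ₗ desuspIncl R C)

variable {C}

theorem cobarD_univTw (c : C) :
    cobarD R C (univTw R c) = - univTw R (d R c) + univTwSq R (comul R c) := by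
  have : cobarD R C (univTw R c) = - univTw R (d R (c - counit R c • one R C)) +
      univTwSq R (comul R (c - counit R c • one R C)) := by
    rw [cobarD, univTw, LinearMap.comp_apply, derivExt_ι]
    rfl
  rw [this]
  simp [map_sub, DGCoalg.d_one, comul_one, univTwSq_tmul, univTw_one]

theorem cobarD_mul (a b : Cobar R C) :
    cobarD R C (a * b) = cobarD R C a * b + sgn R 1 a * cobarD R C b := derivExt_mul _ a b

theorem cobarD_one : cobarD R C 1 = 0 := derivExt_one _

theorem hasDegree_univTwSq : HasDegree R (-2) (univTwSq R : C ⊗[R] C →ₗ[R] Cobar R C) := by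
  refine hasDegree_tensor fun i x hx j y hy => ?_
  rw [univTwSq_tmul]
  have := talg_mul_mem (hasDegree_univTw R i _ (sgn_mem 1 hx)) (hasDegree_univTw R j y hy)
  rwa [show i + -1 + (j + -1) = i + j + -2 by ring] at this

theorem hasDegree_cobarD : HasDegree R (-1) (cobarD R C) := by
  refine hasDegree_derivExt _ fun n w hw => ?_
  have hw' : desuspIncl R C w ∈ gr R C (n + 1) := hw
  refine add_mem (neg_mem ?_) ?_
  · have := hasDegree_univTw R _ _ (d_mem _ _ hw')
    rwa [show n + 1 - 1 + -1 = n + -1 by ring] at this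
  · have := hasDegree_univTwSq R _ _ (comul_mem _ _ hw')
    rwa [show n + 1 + -2 = n + -1 by ring] at this

theorem sgn_cobarD (k : ℤ) (a : Cobar R C) :
    sgn R k (cobarD R C a) = ksign R k • cobarD R C (sgn R k a) := by
  rw [(hasDegree_cobarD R).sgn_comm, mul_neg_one, ksign_neg]

theorem hasDegree_comul : HasDegree R 0 (comul R : C →ₗ[R] C ⊗[R] C) := fun n x hx => by
  rw [add_zero]; exact comul_mem n x hx

theorem sgn_comul (k : ℤ) (c : C) : sgn R k (comul R c) = comul R (sgn R k c) := by
  rw [(hasDegree_comul R).sgn_comm, mul_zero, ksign_zero, one_smul]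

theorem cobarD_univTwSq (z : C ⊗[R] C) :
    cobarD R C (univTwSq R z) = univTwSq R (d R z) +
      LinearMap.mul' R _ (TensorProduct.map (univTw R) (univTwSq R)
        (TensorProduct.assoc R C C C ((comul R).rTensor C z))) -
      LinearMap.mul' R _ (TensorProduct.map (univTw R) (univTwSq R) ((comul R).lTensor C z)) := by
  have aux : ∀ (y : C ⊗[R] C) (b : C), univTwSq R (sgn R 1 y) * univTw R b =
      LinearMap.mul' R _ (TensorProduct.map (univTw R) (univTwSq R)
        (TensorProduct.assoc R C C C (y ⊗ₜ b))) := by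
    intro y b
    induction y with
    | zero => simp
    | add x y hx hy => simp only [map_add, add_mul, hx, hy, TensorProduct.add_tmul]
    | tmul a a' =>
      rw [sgn_tmul, univTwSq_tmul, sgn_sgn, TensorProduct.assoc_tmul, TensorProduct.map_tmul,
        univTwSq_tmul, LinearMap.mul'_apply, mul_assoc]
  induction z with
  | zero => simp
  | add x y hx hy => simp only [map_add, hx, hy]; abel
  | tmul a b =>
    rw [LinearMap.rTensor_tmul, ← aux]
    simp only [univTwSq_tmul, cobarD_mul, cobarD_univTw, d_tmul, map_add, TensorProduct.map_tmul,
      LinearMap.lTensor_tmul, LinearMap.mul'_apply,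
      sgn_univTw, sgn_sgn, sgn_d, ksign_one, sgn_comul]
    simp only [map_neg, neg_smul, one_smul]
    noncomm_ring

theorem cobarD_cobarD_univTw (c : C) : cobarD R C (cobarD R C (univTw R c)) = 0 := by
  rw [cobarD_univTw, map_add, map_neg, cobarD_univTw, cobarD_univTwSq, d_d, d_comul,
    DGCoalg.coassoc, map_zero]
  abel

theorem cobarD_cobarD (a : Cobar R C) : cobarD R C (cobarD R C a) = 0 := by
  refine talg_induction (p := fun a => cobarD R C (cobarD R C a) = 0) ?_ ?_ ?_ ?_ a
  · rw [cobarD_one, map_zero]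
  · intro a b ha hb; rw [map_add, map_add, ha, hb, add_zero]
  · intro r a ha; rw [map_smul, map_smul, ha, smul_zero]
  · intro i w hw a ha
    rw [ι_eq_univTw, cobarD_mul, map_add, cobarD_mul, cobarD_mul, cobarD_cobarD_univTw, ha,
      sgn_cobarD, sgn_univTw, map_smul]
    simp

/-- The cobar construction `Ω C`, as a chain complex. -/
instance instDGModCobar : DGMod R (Cobar R C) where
  d := cobarD R C
  d_mem := hasDegree_cobarD R
  d_d := cobarD_cobarD R

end Cobar

/-! ### The coHochschild complex -/

section CoHochschild

theorem sgn_add {R : Type u} [CommRing R] {M : Type*} [AddCommGroup M] [Module R M] [GrMod R M]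
    (k l : ℤ) (x : M) : sgn R (k + l) x = sgn R k (sgn R l x) := by
  refine gr_induction (R := R) (p := fun x => sgn R (k + l) x = sgn R k (sgn R l x)) ?_ ?_ x
  · intro x y hx hy; simp only [map_add, hx, hy]
  · intro n x hx
    rw [sgn_apply _ hx, sgn_apply _ hx, map_smul, sgn_apply _ hx, smul_smul, add_mul, ksign_add,
      mul_comm]

theorem sgn_congr {R : Type u} [CommRing R] {M : Type*} [AddCommGroup M] [Module R M] [GrMod R M]
    {k l : ℤ} (h : Even (k - l)) (x : M) : sgn R k x = sgn R l x := by
  refine gr_induction (R := R) (p := fun x => sgn R k x = sgn R l x) ?_ ?_ x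
  · intro x y hx hy; simp only [map_add, hx, hy]
  · intro n x hx
    rw [sgn_apply _ hx, sgn_apply _ hx, ksign_congr (a := k * n) (b := l * n)]
    rw [← sub_mul]; exact h.mul_right n

variable (R : Type u) [CommRing R] (C : Type*) [AddCommGroup C] [Module R C] [DGCoalg R C]
variable (N : Type*) [AddCommGroup N] [Module R N]

/-- `x ⊗ v ⊗ w ↦ x ⊗ v | w` -/
def appendWord : (N ⊗[R] Cobar R C) ⊗[R] Cobar R C →ₗ[R] N ⊗[R] Cobar R C :=
  (LinearMap.mul' R (Cobar R C)).lTensor N ∘ₗ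
    (TensorProduct.assoc R N (Cobar R C) (Cobar R C)).toLinearMap

variable [DGMod R N]

/-- `x ⊗ c ⊗ w ↦ (-1)^|x| x ⊗ s⁻¹c̄ | w` -/
def insertR : (N ⊗[R] C) ⊗[R] Cobar R C →ₗ[R] N ⊗[R] Cobar R C :=
  appendWord R C N ∘ₗ (TensorProduct.map (sgn R 1) (univTw R)).rTensor (Cobar R C)

/-- `c ⊗ x ⊗ w ↦ (-1)^((|c| - 1) (|x| + |w|)) x ⊗ w | s⁻¹c̄` -/
def insertL : (C ⊗[R] N) ⊗[R] Cobar R C →ₗ[R] N ⊗[R] Cobar R C :=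
  appendWord R C N ∘ₗ gswap R (Cobar R C) (N ⊗[R] Cobar R C) ∘ₗ
    (univTw R).rTensor (N ⊗[R] Cobar R C) ∘ₗ
    (TensorProduct.assoc R C N (Cobar R C)).toLinearMap

variable {R C N}

theorem appendWord_tmul (x : N) (v w : Cobar R C) :
    appendWord R C N ((x ⊗ₜ v) ⊗ₜ w) = x ⊗ₜ (v * w) := rfl

theorem insertR_tmul (x : N) (c : C) (w : Cobar R C) :
    insertR R C N ((x ⊗ₜ c) ⊗ₜ w) = sgn R 1 x ⊗ₜ (univTw R c * w) := rfl

theorem insertL_tmul {p : ℤ} {c : C} (hc : c ∈ gr R C p) (x : N) (w : Cobar R C) :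
    insertL R C N ((c ⊗ₜ x) ⊗ₜ w) = sgn R (p - 1) x ⊗ₜ (sgn R (p - 1) w * univTw R c) := by
  simp only [insertL, LinearMap.comp_apply, LinearEquiv.coe_coe, TensorProduct.assoc_tmul,
    LinearMap.rTensor_tmul]
  rw [gswap_tmul (hasDegree_univTw R p c hc), sgn_tmul, appendWord_tmul, ← sub_eq_add_neg]

variable (R C N)
variable [DGBicomod R C N]

/-- The differential of the coHochschild complex. With `λ x = ∑ eᵢ ⊗ xⁱ` and `ρ x = ∑ xⱼ ⊗ eʲ`,
`d (x ⊗ w) = dx ⊗ w + (-1)^|x| x ⊗ dw - ∑ (-1)^|xⱼ| xⱼ ⊗ s⁻¹eʲ | w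
  + ∑ (-1)^((|eᵢ| - 1) (|xⁱ| + |w|)) xⁱ ⊗ w | s⁻¹eᵢ`. -/
def cohochD : N ⊗[R] Cobar R C →ₗ[R] N ⊗[R] Cobar R C :=
  d R - insertR R C N ∘ₗ (coactR R C).rTensor (Cobar R C)
    + insertL R C N ∘ₗ (coactL R C).rTensor (Cobar R C)

variable {R C N}

theorem cohochD_tmul (x : N) (w : Cobar R C) :
    cohochD R C N (x ⊗ₜ w) = d R (x ⊗ₜ[R] w) - insertR R C N (coactR R C x ⊗ₜ w) +
      insertL R C N (coactL R C x ⊗ₜ w) := rfl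

theorem hasDegree_coactL : HasDegree R 0 (coactL R C : N →ₗ[R] C ⊗[R] N) := fun n x hx => by
  rw [add_zero]; exact coactL_mem n x hx
theorem hasDegree_coactR : HasDegree R 0 (coactR R C : N →ₗ[R] N ⊗[R] C) := fun n x hx => by
  rw [add_zero]; exact coactR_mem n x hx
theorem sgn_coactL (k : ℤ) (x : N) : sgn R k (coactL R C x) = coactL R C (sgn R k x) := by
  rw [hasDegree_coactL.sgn_comm, mul_zero, ksign_zero, one_smul]
theorem sgn_coactR (k : ℤ) (x : N) : sgn R k (coactR R C x) = coactR R C (sgn R k x) := by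
  rw [hasDegree_coactR.sgn_comm, mul_zero, ksign_zero, one_smul]

theorem d_cobar (w : Cobar R C) : d R w = cobarD R C w := rfl

theorem tmul_induction_left {A B : Type*} [AddCommGroup A] [Module R A] [GrMod R A]
    [AddCommGroup B] [Module R B] {p : A ⊗[R] B → Prop} (h0 : p 0)
    (hadd : ∀ x y, p x → p y → p (x + y))
    (h : ∀ i, ∀ a ∈ gr R A i, ∀ b : B, p (a ⊗ₜ b)) (z : A ⊗[R] B) : p z := by
  induction z with
  | zero => exact h0
  | add x y hx hy => exact hadd x y hx hy
  | tmul a b =>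
    refine gr_induction (R := R) (p := fun a => p (a ⊗ₜ[R] b)) ?_ ?_ a
    · intro x y hx hy; rw [TensorProduct.add_tmul]; exact hadd _ _ hx hy
    · intro i a ha; exact h i a ha b

theorem insertR_mem {m n : ℤ} {y : N ⊗[R] C} (hy : y ∈ gr R (N ⊗[R] C) m) {w : Cobar R C}
    (hw : w ∈ gr R (Cobar R C) n) :
    insertR R C N (y ⊗ₜ w) ∈ gr R (N ⊗[R] Cobar R C) (m + n - 1) := by
  have h : HasDegree R (n - 1) ((insertR R C N) ∘ₗ (TensorProduct.mk R _ _).flip w) := by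
    refine hasDegree_tensor fun i x hx j c hc => ?_
    rw [LinearMap.comp_apply, LinearMap.flip_apply, TensorProduct.mk_apply, insertR_tmul]
    exact tmul_mem' (sgn_mem 1 hx) (talg_mul_mem (hasDegree_univTw R j c hc) hw) (by ring)
  have := h m y hy
  rwa [show m + (n - 1) = m + n - 1 by ring] at this

theorem insertL_mem {m n : ℤ} {y : C ⊗[R] N} (hy : y ∈ gr R (C ⊗[R] N) m) {w : Cobar R C}
    (hw : w ∈ gr R (Cobar R C) n) :
    insertL R C N (y ⊗ₜ w) ∈ gr R (N ⊗[R] Cobar R C) (m + n - 1) := by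
  have h : HasDegree R (n - 1) ((insertL R C N) ∘ₗ (TensorProduct.mk R _ _).flip w) := by
    refine hasDegree_tensor fun j c hc i x hx => ?_
    rw [LinearMap.comp_apply, LinearMap.flip_apply, TensorProduct.mk_apply, insertL_tmul hc]
    exact tmul_mem' (sgn_mem _ hx) (talg_mul_mem (sgn_mem _ hw) (hasDegree_univTw R j c hc))
      (by ring)
  have := h m y hy
  rwa [show m + (n - 1) = m + n - 1 by ring] at this

theorem hasDegree_cohochD : HasDegree R (-1) (cohochD R C N) := by
  refine hasDegree_tensor fun i x hx j w hw => ?_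
  rw [cohochD_tmul, ← sub_eq_add_neg]
  exact add_mem (sub_mem (d_mem _ _ (tmul_mem hx hw)) (insertR_mem (coactR_mem _ _ hx) hw))
    (insertL_mem (coactL_mem _ _ hx) hw)

/-- Auxiliary map `x ⊗ z ⊗ w ↦ x ⊗ univTwSq z | w`. -/
def insertSqR : (N ⊗[R] (C ⊗[R] C)) ⊗[R] Cobar R C →ₗ[R] N ⊗[R] Cobar R C :=
  appendWord R C N ∘ₗ ((univTwSq R).lTensor N).rTensor (Cobar R C)

/-- Auxiliary map `z ⊗ x ⊗ w ↦ ± x ⊗ w | univTwSq z`. -/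
def insertSqL : ((C ⊗[R] C) ⊗[R] N) ⊗[R] Cobar R C →ₗ[R] N ⊗[R] Cobar R C :=
  appendWord R C N ∘ₗ gswap R (Cobar R C) (N ⊗[R] Cobar R C) ∘ₗ
    (univTwSq R).rTensor (N ⊗[R] Cobar R C) ∘ₗ
    (TensorProduct.assoc R (C ⊗[R] C) N (Cobar R C)).toLinearMap

theorem insertSqL_tmul {p : ℤ} {z : C ⊗[R] C} (hz : z ∈ gr R (C ⊗[R] C) p) (x : N)
    (w : Cobar R C) :
    insertSqL ((z ⊗ₜ x) ⊗ₜ w) = sgn R p x ⊗ₜ[R] (sgn R p w * univTwSq R z) := by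
  simp only [insertSqL, LinearMap.comp_apply, LinearEquiv.coe_coe, TensorProduct.assoc_tmul,
    LinearMap.rTensor_tmul]
  rw [gswap_tmul (hasDegree_univTwSq R p z hz), sgn_tmul, appendWord_tmul,
    sgn_congr (k := p + -2) (l := p) (by simp), sgn_congr (k := p + -2) (l := p) (by simp)]

theorem d_insertR (y : N ⊗[R] C) (w : Cobar R C) :
    d R (insertR R C N (y ⊗ₜ w)) = - insertR R C N (d R y ⊗ₜ w)
      - insertR R C N (sgn R 1 y ⊗ₜ cobarD R C w)
      + insertSqR ((comul R).lTensor N y ⊗ₜ w) := by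
  induction y with
  | zero => simp
  | add x y hx hy => simp only [map_add, TensorProduct.add_tmul, hx, hy]; abel
  | tmul x c =>
    simp only [insertR_tmul, d_tmul, d_cobar, cobarD_mul, cobarD_univTw, sgn_tmul, sgn_sgn,
      TensorProduct.add_tmul, map_add, sgn_d, sgn_univTw, ksign_one, insertSqR,
      LinearMap.comp_apply, LinearMap.lTensor_tmul, LinearMap.rTensor_tmul, appendWord_tmul,
      neg_smul, one_smul, add_mul, neg_mul, TensorProduct.tmul_add, TensorProduct.neg_tmul,
      TensorProduct.tmul_neg]
    abel

theorem twR_twR (y : N ⊗[R] C) (w : Cobar R C) :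
    insertR R C N ((coactR R C).rTensor (Cobar R C) (insertR R C N (y ⊗ₜ w))) =
      insertSqR (TensorProduct.assoc R N C C ((coactR R C).rTensor C y) ⊗ₜ w) := by
  have aux : ∀ (u : N ⊗[R] C) (c : C), insertR R C N (sgn R 1 u ⊗ₜ (univTw R c * w)) =
      insertSqR (TensorProduct.assoc R N C C (u ⊗ₜ c) ⊗ₜ w) := by
    intro u c
    induction u with
    | zero => simp
    | add x y hx hy => simp only [map_add, TensorProduct.add_tmul, hx, hy]
    | tmul x a =>
      simp only [sgn_tmul, insertR_tmul, sgn_sgn, TensorProduct.assoc_tmul, insertSqR,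
        LinearMap.comp_apply, LinearMap.lTensor_tmul, LinearMap.rTensor_tmul, appendWord_tmul,
        univTwSq_tmul, mul_assoc]
  induction y with
  | zero => simp
  | add x y hx hy => simp only [map_add, TensorProduct.add_tmul, hx, hy]
  | tmul x c =>
    rw [insertR_tmul, LinearMap.rTensor_tmul, ← sgn_coactR, aux, LinearMap.rTensor_tmul]

theorem d_insertL (y : C ⊗[R] N) (w : Cobar R C) :
    d R (insertL R C N (y ⊗ₜ w)) = - insertL R C N (d R y ⊗ₜ w)
      - insertL R C N (sgn R 1 y ⊗ₜ cobarD R C w)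
      + insertSqL ((comul R).rTensor N y ⊗ₜ w) := by
  refine tmul_induction_left (R := R) (p := fun y => d R (insertL R C N (y ⊗ₜ w)) =
      - insertL R C N (d R y ⊗ₜ w) - insertL R C N (sgn R 1 y ⊗ₜ cobarD R C w)
      + insertSqL ((comul R).rTensor N y ⊗ₜ w)) ?_ ?_ ?_ y
  · simp
  · intro x y hx hy; simp only [map_add, TensorProduct.add_tmul, hx, hy]; abel
  · intro p c hc x
    have h1 : ∀ x : N, sgn R 1 (sgn R (p - 1) x) = sgn R p x := fun x => by
      rw [← sgn_add]; congr 2; ring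
    have h2 : ∀ x : Cobar R C, sgn R 1 (sgn R (p - 1) x) = sgn R p x := fun x => by
      rw [← sgn_add]; congr 2; ring
    have h3 : ∀ x : N, sgn R (p - 1 - 1) x = sgn R p x := fun x => sgn_congr (by ring_nf; simp) x
    have h4 : ∀ x : Cobar R C, sgn R (p - 1 - 1) x = sgn R p x :=
      fun x => sgn_congr (by ring_nf; simp) x
    have h5 : ∀ x : N, sgn R (p - 1) (sgn R 1 x) = sgn R p x := fun x => by
      rw [← sgn_add]; congr 2; ring
    have h6 : ∀ x : N, d R (sgn R (p - 1) x) = - ksign R p • sgn R (p - 1) (d R x) := fun x => by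
      rw [sgn_d, smul_smul, ksign_sub, ksign_one]
      simp [ksign_mul_self]
    have h7 : cobarD R C (sgn R (p - 1) w) = - ksign R p • sgn R (p - 1) (cobarD R C w) := by
      rw [sgn_cobarD, smul_smul, ksign_sub, ksign_one]
      simp [ksign_mul_self]
    rw [insertL_tmul hc, d_tmul, d_tmul, TensorProduct.add_tmul, map_add,
      insertL_tmul (d_mem _ _ hc), sgn_apply 1 hc, sgn_tmul, sgn_apply 1 hc, d_cobar, cobarD_mul,
      cobarD_univTw, LinearMap.rTensor_tmul, insertSqL_tmul (comul_mem _ _ hc)]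
    simp only [← TensorProduct.smul_tmul', map_smul, insertL_tmul hc, one_mul, h1, h2, h3, h4, h5,
      h6, h7, neg_smul, TensorProduct.tmul_add, TensorProduct.tmul_neg, TensorProduct.neg_tmul,
      mul_add, mul_neg, neg_mul, smul_mul_assoc, TensorProduct.tmul_smul]
    abel

theorem twL_twL (y : C ⊗[R] N) (w : Cobar R C) :
    insertL R C N ((coactL R C).rTensor (Cobar R C) (insertL R C N (y ⊗ₜ w))) =
      - insertSqL ((TensorProduct.assoc R C C N).symm ((coactL R C).lTensor C y) ⊗ₜ w) := by
  have aux : ∀ (p : ℤ) (c : C) (hc : c ∈ gr R C p) (u : C ⊗[R] N),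
      insertL R C N (sgn R (p - 1) u ⊗ₜ (sgn R (p - 1) w * univTw R c)) =
      - insertSqL ((TensorProduct.assoc R C C N).symm (c ⊗ₜ u) ⊗ₜ w) := by
    intro p c hc u
    refine tmul_induction_left (R := R) (p := fun u => 
      insertL R C N (sgn R (p - 1) u ⊗ₜ (sgn R (p - 1) w * univTw R c)) =
      - insertSqL ((TensorProduct.assoc R C C N).symm (c ⊗ₜ u) ⊗ₜ w)) ?_ ?_ ?_ u
    · simp
    · intro x y hx hy
      simp only [map_add, TensorProduct.add_tmul, TensorProduct.tmul_add, hx, hy]; abel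
    · intro q a ha x
      rw [TensorProduct.assoc_symm_tmul, insertSqL_tmul (tmul_mem hc ha), sgn_tmul,
        sgn_apply _ ha, ← TensorProduct.smul_tmul', ← TensorProduct.smul_tmul', map_smul,
        insertL_tmul ha, sgn_talg_mul, sgn_univTw, sgn_apply _ hc, univTwSq_tmul, sgn_apply 1 hc,
        ← sgn_add, ← sgn_add, sgn_congr (k := q - 1 + (p - 1)) (l := p + q) (by ring_nf; simp),
        sgn_congr (k := q - 1 + (p - 1)) (l := p + q) (by ring_nf; simp)]
      simp only [map_smul, mul_smul_comm, smul_mul_assoc, smul_smul, TensorProduct.tmul_smul,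
        one_mul, mul_assoc]
      rw [← ksign_add, ← ksign_add, ← neg_smul]
      congr 1
      rw [show - ksign R p = ksign R (p - 1) by rw [ksign_sub]; simp]
      apply ksign_congr
      rcases Int.even_or_odd p with hp | hp <;> rcases Int.even_or_odd q with hq | hq <;>
        simp [Int.even_add, Int.even_sub, Int.even_mul, hp, hq, ← Int.not_even_iff_odd] <;>
        simp_all [← Int.not_even_iff_odd]
  refine tmul_induction_left (R := R) (p := fun y =>
    insertL R C N ((coactL R C).rTensor (Cobar R C) (insertL R C N (y ⊗ₜ w))) =
      - insertSqL ((TensorProduct.assoc R C C N).symm ((coactL R C).lTensor C y) ⊗ₜ w)) ?_ ?_ ?_ y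
  · simp
  · intro x y hx hy; simp only [map_add, TensorProduct.add_tmul, hx, hy]; abel
  · intro p c hc x
    rw [insertL_tmul hc, LinearMap.rTensor_tmul, ← sgn_coactL, aux p c hc, LinearMap.lTensor_tmul]

theorem twR_twL (x : N) (w : Cobar R C) :
    insertR R C N ((coactR R C).rTensor (Cobar R C) (insertL R C N (coactL R C x ⊗ₜ w))) =
      - insertL R C N ((coactL R C).rTensor (Cobar R C) (insertR R C N (coactR R C x ⊗ₜ w))) := by
  have aux1 : ∀ y : C ⊗[R] N, (coactR R C).rTensor (Cobar R C) (insertL R C N (y ⊗ₜ w)) =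
      insertL R C (N ⊗[R] C) ((coactR R C).lTensor C y ⊗ₜ w) := by
    intro y
    refine tmul_induction_left (R := R) (p := fun y =>
      (coactR R C).rTensor (Cobar R C) (insertL R C N (y ⊗ₜ w)) =
      insertL R C (N ⊗[R] C) ((coactR R C).lTensor C y ⊗ₜ w)) ?_ ?_ ?_ y
    · simp
    · intro x y hx hy; simp only [map_add, TensorProduct.add_tmul, hx, hy]
    · intro p c hc x
      rw [LinearMap.lTensor_tmul, insertL_tmul hc, insertL_tmul hc, LinearMap.rTensor_tmul,
        sgn_coactR]
  have aux2 : ∀ (u : C ⊗[R] N) (c : C),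
      insertL R C N (sgn R 1 u ⊗ₜ (univTw R c * w)) =
      - insertR R C N (insertL R C (N ⊗[R] C) (TensorProduct.assoc R C N C (u ⊗ₜ c) ⊗ₜ w)) := by
    intro u c
    refine tmul_induction_left (R := R) (p := fun u =>
      insertL R C N (sgn R 1 u ⊗ₜ (univTw R c * w)) =
      - insertR R C N (insertL R C (N ⊗[R] C) (TensorProduct.assoc R C N C (u ⊗ₜ c) ⊗ₜ w)))
      ?_ ?_ ?_ u
    · simp
    · intro x y hx hy; simp only [map_add, TensorProduct.add_tmul, hx, hy]; abel
    · intro p a ha x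
      rw [TensorProduct.assoc_tmul, insertL_tmul ha, sgn_tmul, sgn_tmul, insertR_tmul,
        sgn_apply 1 ha, ← TensorProduct.smul_tmul', ← TensorProduct.smul_tmul', map_smul,
        insertL_tmul ha, sgn_talg_mul, sgn_univTw, ← sgn_add, ← sgn_add, add_comm (p - 1) 1]
      simp only [smul_mul_assoc, TensorProduct.tmul_smul, smul_smul, one_mul, mul_assoc]
      rw [← ksign_add, ksign_odd ⟨p - 1, by ring⟩, neg_one_smul]
  rw [aux1, ← coassocLR]
  suffices h : ∀ y : N ⊗[R] C,
      insertL R C N ((coactL R C).rTensor (Cobar R C) (insertR R C N (y ⊗ₜ w))) =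
      - insertR R C N (insertL R C (N ⊗[R] C)
        (TensorProduct.assoc R C N C ((coactL R C).rTensor C y) ⊗ₜ w)) by
    rw [h, neg_neg]
  intro y
  induction y with
  | zero => simp
  | add x y hx hy => simp only [map_add, TensorProduct.add_tmul, hx, hy]; abel
  | tmul x c => rw [insertR_tmul, LinearMap.rTensor_tmul, ← sgn_coactL, aux2, LinearMap.rTensor_tmul]

theorem cohochD_cohochD (z : N ⊗[R] Cobar R C) : cohochD R C N (cohochD R C N z) = 0 := by
  induction z with
  | zero => simp
  | add x y hx hy => rw [map_add, map_add, hx, hy, add_zero]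
  | tmul x w =>
    have hA : ∀ z : N ⊗[R] Cobar R C, cohochD R C N z = d R z
        - insertR R C N ((coactR R C).rTensor (Cobar R C) z)
        + insertL R C N ((coactL R C).rTensor (Cobar R C) z) := fun z => rfl
    rw [cohochD_tmul, hA]
    simp only [map_add, map_sub, d_d]
    simp only [map_add, d_insertR, d_insertL, twR_twR, twL_twL, twR_twL, coassocR,
      d_tmul, LinearMap.rTensor_tmul, d_coactR, d_coactL, sgn_coactL, sgn_coactR, ← coassocL,
      LinearEquiv.symm_apply_apply, d_cobar]
    abel

variable (R C N)

/-- The underlying graded module `N ⊗ T(s⁻¹ C̄)` of the coHochschild complex. -/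
def CoHochschild : Type _ := N ⊗[R] Cobar R C

instance : AddCommGroup (CoHochschild R C N) := inferInstanceAs (AddCommGroup (N ⊗[R] Cobar R C))
instance : Module R (CoHochschild R C N) := inferInstanceAs (Module R (N ⊗[R] Cobar R C))

/-- The coHochschild complex of `C` with coefficients in the bicomodule `N`. -/
instance : DGMod R (CoHochschild R C N) where
  toGrMod := inferInstanceAs (GrMod R (N ⊗[R] Cobar R C))
  d := cohochD R C N
  d_mem := hasDegree_cohochD
  d_d := cohochD_cohochD

end CoHochschild

/-! ### Tensor products of coalgebras and bicomodules -/

section MidSwap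

variable (R : Type u) [CommRing R]
variable (A B A' B' : Type*)
  [AddCommGroup A] [Module R A] [AddCommGroup B] [Module R B] [GrMod R B]
  [AddCommGroup A'] [Module R A'] [GrMod R A'] [AddCommGroup B'] [Module R B']

/-- The signed interchange `(a ⊗ b) ⊗ (a' ⊗ b') ↦ (-1)^(|b||a'|) (a ⊗ a') ⊗ (b ⊗ b')`. -/
def midSwap : (A ⊗[R] B) ⊗[R] (A' ⊗[R] B') →ₗ[R] (A ⊗[R] A') ⊗[R] (B ⊗[R] B') :=
  (TensorProduct.assoc R A A' (B ⊗[R] B')).symm.toLinearMap ∘ₗ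
    LinearMap.lTensor A ((TensorProduct.assoc R A' B B').toLinearMap ∘ₗ
      (gswap R B A').rTensor B' ∘ₗ (TensorProduct.assoc R B A' B').symm.toLinearMap) ∘ₗ
    (TensorProduct.assoc R A B (A' ⊗[R] B')).toLinearMap

variable {R A B A' B'}

theorem midSwap_tmul {j : ℤ} (a : A) {b : B} (hb : b ∈ gr R B j) (a' : A') (b' : B') :
    midSwap R A B A' B' ((a ⊗ₜ b) ⊗ₜ (a' ⊗ₜ b')) = (a ⊗ₜ sgn R j a') ⊗ₜ (b ⊗ₜ b') := by
  simp [midSwap, gswap_tmul hb]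

theorem mid_induction {p : (A ⊗[R] B) ⊗[R] (A' ⊗[R] B') → Prop} (h0 : p 0)
    (hadd : ∀ x y, p x → p y → p (x + y))
    (h : ∀ (a : A) (j : ℤ), ∀ b ∈ gr R B j, ∀ (a' : A') (b' : B'), p ((a ⊗ₜ b) ⊗ₜ (a' ⊗ₜ b')))
    (z : (A ⊗[R] B) ⊗[R] (A' ⊗[R] B')) : p z := by
  induction z with
  | zero => exact h0
  | add x y hx hy => exact hadd x y hx hy
  | tmul u v =>
    induction u with
    | zero => rw [TensorProduct.zero_tmul]; exact h0
    | add x y hx hy => rw [TensorProduct.add_tmul]; exact hadd _ _ hx hy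
    | tmul a b =>
      refine gr_induction (R := R) (p := fun b => p ((a ⊗ₜ[R] b) ⊗ₜ[R] v)) ?_ ?_ b
      · intro x y hx hy
        rw [TensorProduct.tmul_add, TensorProduct.add_tmul]; exact hadd _ _ hx hy
      · intro j b hb
        induction v with
        | zero => rw [TensorProduct.tmul_zero]; exact h0
        | add x y hx hy => rw [TensorProduct.tmul_add]; exact hadd _ _ hx hy
        | tmul a' b' => exact h a j b hb a' b'

theorem midSwap_natural {E F E' F' : Type*}
    [AddCommGroup E] [Module R E] [AddCommGroup F] [Module R F] [GrMod R F]
    [AddCommGroup E'] [Module R E'] [GrMod R E'] [AddCommGroup F'] [Module R F']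
    (f : A →ₗ[R] E) {g : B →ₗ[R] F} (hg : HasDegree R 0 g)
    {f' : A' →ₗ[R] E'} (hf' : HasDegree R 0 f') (g' : B' →ₗ[R] F')
    (z : (A ⊗[R] B) ⊗[R] (A' ⊗[R] B')) :
    midSwap R E F E' F' (TensorProduct.map (TensorProduct.map f g) (TensorProduct.map f' g') z) =
      TensorProduct.map (TensorProduct.map f f') (TensorProduct.map g g')
        (midSwap R A B A' B' z) := by
  refine mid_induction (R := R) (p := fun z =>
    midSwap R E F E' F' (TensorProduct.map (TensorProduct.map f g) (TensorProduct.map f' g') z) =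
      TensorProduct.map (TensorProduct.map f f') (TensorProduct.map g g')
        (midSwap R A B A' B' z)) ?_ ?_ ?_ z
  · simp
  · intro x y hx hy; simp only [map_add, hx, hy]
  · intro a j b hb a' b'
    have hgb : g b ∈ gr R F j := by simpa using hg j b hb
    simp only [TensorProduct.map_tmul]
    rw [midSwap_tmul _ hgb, midSwap_tmul _ hb, hf'.sgn_comm]
    simp

theorem midSwap_assoc {D D' : Type*} [AddCommGroup D] [Module R D] [GrMod R D]
    [AddCommGroup D'] [Module R D'] [GrMod R B']
    (u : (A ⊗[R] B) ⊗[R] D) (u' : (A' ⊗[R] B') ⊗[R] D') :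
    TensorProduct.assoc R _ _ _ ((midSwap R A B A' B').rTensor (D ⊗[R] D')
        (midSwap R (A ⊗[R] B) D (A' ⊗[R] B') D' (u ⊗ₜ u'))) =
      (midSwap R B D B' D').lTensor (A ⊗[R] A') (midSwap R A (B ⊗[R] D) A' (B' ⊗[R] D')
        (TensorProduct.assoc R _ _ _ u ⊗ₜ TensorProduct.assoc R _ _ _ u')) := by
  induction u' with
  | zero => simp
  | add x y hx hy => simp only [TensorProduct.tmul_add, map_add, hx, hy]
  | tmul v' c' =>
  induction v' with
  | zero => simp
  | add x y hx hy => simp only [TensorProduct.add_tmul, TensorProduct.tmul_add, map_add, hx, hy]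
  | tmul a' b' =>
  induction u with
  | zero => simp
  | add x y hx hy => simp only [TensorProduct.add_tmul, map_add, hx, hy]
  | tmul v c =>
  induction v with
  | zero => simp
  | add x y hx hy => simp only [TensorProduct.add_tmul, map_add, hx, hy]
  | tmul a b =>
  refine gr_induction (R := R) (p := fun b => TensorProduct.assoc R _ _ _
      ((midSwap R A B A' B').rTensor (D ⊗[R] D') (midSwap R (A ⊗[R] B) D (A' ⊗[R] B') D'
        (((a ⊗ₜ b) ⊗ₜ c) ⊗ₜ ((a' ⊗ₜ b') ⊗ₜ c')))) =
      (midSwap R B D B' D').lTensor (A ⊗[R] A') (midSwap R A (B ⊗[R] D) A' (B' ⊗[R] D')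
        (TensorProduct.assoc R _ _ _ ((a ⊗ₜ b) ⊗ₜ c) ⊗ₜ
          TensorProduct.assoc R _ _ _ ((a' ⊗ₜ b') ⊗ₜ c')))) ?_ ?_ b
  · intro x y hx hy
    simp only [TensorProduct.add_tmul, TensorProduct.tmul_add, map_add] at hx hy ⊢
    rw [hx, hy]
  intro j b hb
  refine gr_induction (R := R) (p := fun c => TensorProduct.assoc R _ _ _
      ((midSwap R A B A' B').rTensor (D ⊗[R] D') (midSwap R (A ⊗[R] B) D (A' ⊗[R] B') D'
        (((a ⊗ₜ b) ⊗ₜ c) ⊗ₜ ((a' ⊗ₜ b') ⊗ₜ c')))) =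
      (midSwap R B D B' D').lTensor (A ⊗[R] A') (midSwap R A (B ⊗[R] D) A' (B' ⊗[R] D')
        (TensorProduct.assoc R _ _ _ ((a ⊗ₜ b) ⊗ₜ c) ⊗ₜ
          TensorProduct.assoc R _ _ _ ((a' ⊗ₜ b') ⊗ₜ c')))) ?_ ?_ c
  · intro x y hx hy
    simp only [TensorProduct.add_tmul, TensorProduct.tmul_add, map_add] at hx hy ⊢
    rw [hx, hy]
  intro k c hc
  rw [midSwap_tmul _ hc, sgn_tmul, LinearMap.rTensor_tmul, midSwap_tmul _ hb,
    TensorProduct.assoc_tmul, TensorProduct.assoc_tmul, TensorProduct.assoc_tmul,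
    midSwap_tmul _ (tmul_mem hb hc), LinearMap.lTensor_tmul, midSwap_tmul _ hc, sgn_add]

theorem hasDegree_midSwap [GrMod R A] [GrMod R B'] : HasDegree R 0 (midSwap R A B A' B') := by
  intro n z hz
  rw [add_zero]
  induction hz using Submodule.span_induction with
  | zero => simp
  | add x y _ _ hx hy => rw [map_add]; exact add_mem hx hy
  | smul a x _ hx => rw [map_smul]; exact Submodule.smul_mem _ _ hx
  | mem z hz =>
    obtain ⟨i, j, rfl, u, hu, v, hv, rfl⟩ := hz
    induction hu using Submodule.span_induction with
    | zero => simp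
    | add x y _ _ hx hy => rw [TensorProduct.add_tmul, map_add]; exact add_mem hx hy
    | smul a x _ hx =>
      rw [← TensorProduct.smul_tmul', map_smul]; exact Submodule.smul_mem _ _ hx
    | mem u hu =>
      obtain ⟨i, j', rfl, a, ha, b, hb, rfl⟩ := hu
      induction hv using Submodule.span_induction with
      | zero => simp
      | add x y _ _ hx hy => rw [TensorProduct.tmul_add, map_add]; exact add_mem hx hy
      | smul a x _ hx => rw [TensorProduct.tmul_smul, map_smul]; exact Submodule.smul_mem _ _ hx
      | mem v hv =>
        obtain ⟨k, l, rfl, a', ha', b', hb', rfl⟩ := hv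
        rw [midSwap_tmul _ hb]
        exact tmul_mem' (tmul_mem ha (sgn_mem _ ha')) (tmul_mem hb hb') (by ring)

theorem hasDegree_map {E F : Type*} [AddCommGroup E] [Module R E] [GrMod R E]
    [AddCommGroup F] [Module R F] [GrMod R F] {f : B →ₗ[R] E} {g : A' →ₗ[R] F}
    (hf : HasDegree R 0 f) (hg : HasDegree R 0 g) : HasDegree R 0 (TensorProduct.map f g) := by
  refine hasDegree_tensor fun i x hx j y hy => ?_
  rw [TensorProduct.map_tmul]
  exact tmul_mem' (hf i x hx) (hg j y hy) (by ring)

theorem HasDegree.comp {E F G : Type*} [AddCommGroup E] [Module R E] [GrMod R E]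
    [AddCommGroup F] [Module R F] [GrMod R F] [AddCommGroup G] [Module R G] [GrMod R G]
    {f : F →ₗ[R] G} {g : E →ₗ[R] F} {k l : ℤ}
    (hf : HasDegree R k f) (hg : HasDegree R l g) : HasDegree R (l + k) (f ∘ₗ g) := by
  intro n x hx
  rw [← add_assoc]
  exact hf _ _ (hg n x hx)

/-- The tensor product of coactions `X → A ⊗ B` and `X' → A' ⊗ B'`, with the signed
interchange of the middle factors. -/
def tensorCoact {X X' : Type*} [AddCommGroup X] [Module R X] [AddCommGroup X'] [Module R X']
    (f : X →ₗ[R] A ⊗[R] B) (f' : X' →ₗ[R] A' ⊗[R] B') :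
    X ⊗[R] X' →ₗ[R] (A ⊗[R] A') ⊗[R] (B ⊗[R] B') :=
  midSwap R A B A' B' ∘ₗ TensorProduct.map f f'

theorem tensorCoact_tmul {X X' : Type*} [AddCommGroup X] [Module R X] [AddCommGroup X']
    [Module R X'] (f : X →ₗ[R] A ⊗[R] B) (f' : X' →ₗ[R] A' ⊗[R] B') (x : X) (x' : X') :
    tensorCoact f f' (x ⊗ₜ x') = midSwap R A B A' B' (f x ⊗ₜ f' x') := rfl

theorem tensorCoact_mem [GrMod R A] [GrMod R B'] {X X' : Type*} [AddCommGroup X] [Module R X]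
    [GrMod R X] [AddCommGroup X'] [Module R X'] [GrMod R X']
    {f : X →ₗ[R] A ⊗[R] B} {f' : X' →ₗ[R] A' ⊗[R] B'} (hf : HasDegree R 0 f)
    (hf' : HasDegree R 0 f') (n : ℤ) (z : X ⊗[R] X') (hz : z ∈ gr R (X ⊗[R] X') n) :
    tensorCoact f f' z ∈ gr R ((A ⊗[R] A') ⊗[R] (B ⊗[R] B')) n := by
  have := (hasDegree_midSwap.comp (hasDegree_map hf hf')) n z hz
  rwa [add_zero, add_zero] at this

theorem tensorCoact_coassoc {X X' D D' P P' Q Q' : Type*}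
    [AddCommGroup X] [Module R X] [AddCommGroup X'] [Module R X']
    [AddCommGroup D] [Module R D] [GrMod R D] [AddCommGroup D'] [Module R D'] [GrMod R B']
    [AddCommGroup P] [Module R P] [AddCommGroup P'] [Module R P'] [GrMod R P']
    [AddCommGroup Q] [Module R Q] [GrMod R Q] [AddCommGroup Q'] [Module R Q']
    {φ : X →ₗ[R] P ⊗[R] D} {f : P →ₗ[R] A ⊗[R] B} {ψ : X →ₗ[R] A ⊗[R] Q} {h : Q →ₗ[R] B ⊗[R] D}
    {φ' : X' →ₗ[R] P' ⊗[R] D'} {f' : P' →ₗ[R] A' ⊗[R] B'} {ψ' : X' →ₗ[R] A' ⊗[R] Q'}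
    {h' : Q' →ₗ[R] B' ⊗[R] D'} (hf' : HasDegree R 0 f') (hh : HasDegree R 0 h)
    (H : ∀ x, TensorProduct.assoc R A B D (f.rTensor D (φ x)) = h.lTensor A (ψ x))
    (H' : ∀ x, TensorProduct.assoc R A' B' D' (f'.rTensor D' (φ' x)) = h'.lTensor A' (ψ' x))
    (z : X ⊗[R] X') :
    TensorProduct.assoc R _ _ _ ((tensorCoact f f').rTensor (D ⊗[R] D') (tensorCoact φ φ' z)) =
      (tensorCoact h h').lTensor (A ⊗[R] A') (tensorCoact ψ ψ' z) := by
  induction z with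
  | zero => simp
  | add x y hx hy => simp only [map_add, hx, hy]
  | tmul x x' =>
    have hid : ∀ {k : ℤ}, HasDegree R 0 (LinearMap.id : D →ₗ[R] D) := fun {k} n x hx => by
      simpa using hx
    have hid' : HasDegree R 0 (LinearMap.id : A' →ₗ[R] A') := fun n x hx => by
      simpa using hx
    have e1 := midSwap_natural f (hid (k := 0)) hf' (LinearMap.id : D' →ₗ[R] D') (φ x ⊗ₜ φ' x')
    have e2 := midSwap_natural (LinearMap.id : A →ₗ[R] A) hh hid' h' (ψ x ⊗ₜ ψ' x')
    rw [tensorCoact_tmul, tensorCoact_tmul]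
    have e3 : (tensorCoact f f').rTensor (D ⊗[R] D') (midSwap R _ _ _ _ (φ x ⊗ₜ φ' x')) =
        (midSwap R A B A' B').rTensor (D ⊗[R] D') (midSwap R _ _ _ _
          (f.rTensor D (φ x) ⊗ₜ f'.rTensor D' (φ' x'))) := by
      rw [tensorCoact, LinearMap.rTensor_comp, LinearMap.comp_apply]
      congr 1
      rw [TensorProduct.map_tmul, TensorProduct.map_id] at e1
      exact e1.symm
    have e4 : (tensorCoact h h').lTensor (A ⊗[R] A') (midSwap R _ _ _ _ (ψ x ⊗ₜ ψ' x')) =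
        (midSwap R B D B' D').lTensor (A ⊗[R] A') (midSwap R _ _ _ _
          (h.lTensor A (ψ x) ⊗ₜ h'.lTensor A' (ψ' x'))) := by
      rw [tensorCoact, LinearMap.lTensor_comp, LinearMap.comp_apply]
      congr 1
      rw [TensorProduct.map_tmul, TensorProduct.map_id] at e2
      exact e2.symm
    rw [e3, e4, midSwap_assoc, H, H']

end MidSwap

section TensorCoalg

variable {R : Type u} [CommRing R]

theorem d_midSwap {A B A' B' : Type*}
    [AddCommGroup A] [Module R A] [DGMod R A] [AddCommGroup B] [Module R B] [DGMod R B]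
    [AddCommGroup A'] [Module R A'] [DGMod R A'] [AddCommGroup B'] [Module R B'] [DGMod R B']
    (z : (A ⊗[R] B) ⊗[R] (A' ⊗[R] B')) :
    d R (midSwap R A B A' B' z) = midSwap R A B A' B' (d R z) := by
  refine mid_induction (R := R) (p := fun z =>
    d R (midSwap R A B A' B' z) = midSwap R A B A' B' (d R z)) ?_ ?_ ?_ z
  · simp
  · intro x y hx hy; simp only [map_add, hx, hy]
  · intro a j b hb a' b'
    have h1 : ∀ x : A', sgn R (j - 1) x = sgn R 1 (sgn R j x) := fun x => by
      rw [← sgn_add]; exact sgn_congr (by ring_nf; simp) x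
    have h2 : ∀ x : A', sgn R j (sgn R 1 x) = sgn R 1 (sgn R j x) := fun x => by
      rw [← sgn_add, ← sgn_add, add_comm]
    simp only [d_tmul, midSwap_tmul _ hb, sgn_tmul, TensorProduct.add_tmul, TensorProduct.tmul_add,
      map_add, midSwap_tmul _ (d_mem _ _ hb), midSwap_tmul _ (sgn_mem 1 hb), sgn_d, h1, h2]
    simp only [sgn_apply 1 hb, TensorProduct.tmul_smul, ← TensorProduct.smul_tmul', one_mul,
      smul_smul, ksign_mul_self, one_smul]
    abel

theorem d_tensorCoact {X X' A B A' B' : Type*}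
    [AddCommGroup A] [Module R A] [DGMod R A] [AddCommGroup B] [Module R B] [DGMod R B]
    [AddCommGroup A'] [Module R A'] [DGMod R A'] [AddCommGroup B'] [Module R B'] [DGMod R B']
    [AddCommGroup X] [Module R X] [DGMod R X] [AddCommGroup X'] [Module R X'] [DGMod R X']
    {f : X →ₗ[R] A ⊗[R] B} {f' : X' →ₗ[R] A' ⊗[R] B'}
    (hf : HasDegree R 0 f) (hd : ∀ x, d R (f x) = f (d R x)) (hd' : ∀ x, d R (f' x) = f' (d R x))
    (z : X ⊗[R] X') : d R (tensorCoact f f' z) = tensorCoact f f' (d R z) := by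
  induction z with
  | zero => simp
  | add x y hx hy => simp only [map_add, hx, hy]
  | tmul x x' =>
    rw [tensorCoact_tmul, d_midSwap, d_tmul, d_tmul, map_add, map_add, tensorCoact_tmul,
      tensorCoact_tmul, hd, hd', hf.sgn_comm]
    simp

variable {C : Type*} [AddCommGroup C] [Module R C] [DGCoalg R C]
variable {C' : Type*} [AddCommGroup C'] [Module R C'] [DGCoalg R C']

theorem counit_sgn (k : ℤ) (c : C) : counit R (sgn R k c) = counit R c := by
  refine gr_induction (R := R) (p := fun c => counit R (sgn R k c) = counit R c) ?_ ?_ c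
  · intro x y hx hy; simp only [map_add, hx, hy]
  · intro n x hx
    rw [sgn_apply k hx, map_smul]
    by_cases hn : n = 0
    · subst hn; simp
    · rw [counit_of_ne n hn x hx, smul_zero]

theorem counit_smul_sgn {X : Type*} [AddCommGroup X] [Module R X] [GrMod R X] {j : ℤ} {c : C}
    (hc : c ∈ gr R C j) (x : X) : counit R c • sgn R j x = counit R c • x := by
  by_cases hj : j = 0
  · subst hj; rw [sgn_congr (k := 0) (l := 1 + 1) (by decide), sgn_add, sgn_sgn]
  · rw [counit_of_ne j hj c hc, zero_smul, zero_smul]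

variable (R C C') in
/-- `c ⊗ c' ↦ ε(c) ε(c')` -/
def tensorCounit : C ⊗[R] C' →ₗ[R] R :=
  (TensorProduct.lid R R).toLinearMap ∘ₗ TensorProduct.map (counit R) (counit R)

theorem tensorCounit_tmul (c : C) (c' : C') :
    tensorCounit R C C' (c ⊗ₜ c') = counit R c * counit R c' := by
  simp [tensorCounit]

theorem counitL_midSwap {X X' : Type*} [AddCommGroup X] [Module R X] [GrMod R X]
    [AddCommGroup X'] [Module R X'] (u : C ⊗[R] X) (u' : C' ⊗[R] X') :
    TensorProduct.lid R _ ((tensorCounit R C C').rTensor _ (midSwap R C X C' X' (u ⊗ₜ u'))) =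
      TensorProduct.lid R X ((counit R).rTensor X u) ⊗ₜ
        TensorProduct.lid R X' ((counit R).rTensor X' u') := by
  have : ∀ z, TensorProduct.lid R _ ((tensorCounit R C C').rTensor _ (midSwap R C X C' X' z)) =
      TensorProduct.map ((TensorProduct.lid R X).toLinearMap ∘ₗ (counit R).rTensor X)
        ((TensorProduct.lid R X').toLinearMap ∘ₗ (counit R).rTensor X') z := by
    intro z
    refine mid_induction (R := R) (p := fun z =>
      TensorProduct.lid R _ ((tensorCounit R C C').rTensor _ (midSwap R C X C' X' z)) =
      TensorProduct.map ((TensorProduct.lid R X).toLinearMap ∘ₗ (counit R).rTensor X)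
        ((TensorProduct.lid R X').toLinearMap ∘ₗ (counit R).rTensor X') z) ?_ ?_ ?_ z
    · simp
    · intro x y hx hy; simp only [map_add, hx, hy]
    · intro a j b hb a' b'
      rw [midSwap_tmul _ hb]
      simp only [LinearMap.rTensor_tmul, tensorCounit_tmul, TensorProduct.lid_tmul, counit_sgn,
        TensorProduct.map_tmul, LinearMap.comp_apply, LinearEquiv.coe_coe,
        TensorProduct.smul_tmul_smul]
  exact this (u ⊗ₜ u')

theorem counitR_midSwap {X X' : Type*} [AddCommGroup X] [Module R X]
    [AddCommGroup X'] [Module R X'] [GrMod R X'] (u : X ⊗[R] C) (u' : X' ⊗[R] C') :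
    TensorProduct.rid R _ ((tensorCounit R C C').lTensor _ (midSwap R X C X' C' (u ⊗ₜ u'))) =
      TensorProduct.rid R X ((counit R).lTensor X u) ⊗ₜ
        TensorProduct.rid R X' ((counit R).lTensor X' u') := by
  have : ∀ z, TensorProduct.rid R _ ((tensorCounit R C C').lTensor _ (midSwap R X C X' C' z)) =
      TensorProduct.map ((TensorProduct.rid R X).toLinearMap ∘ₗ (counit R).lTensor X)
        ((TensorProduct.rid R X').toLinearMap ∘ₗ (counit R).lTensor X') z := by
    intro z
    refine mid_induction (R := R) (p := fun z =>
      TensorProduct.rid R _ ((tensorCounit R C C').lTensor _ (midSwap R X C X' C' z)) =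
      TensorProduct.map ((TensorProduct.rid R X).toLinearMap ∘ₗ (counit R).lTensor X)
        ((TensorProduct.rid R X').toLinearMap ∘ₗ (counit R).lTensor X') z) ?_ ?_ ?_ z
    · simp
    · intro x y hx hy; simp only [map_add, hx, hy]
    · intro a j b hb a' b'
      rw [midSwap_tmul _ hb]
      simp only [LinearMap.lTensor_tmul, tensorCounit_tmul, TensorProduct.rid_tmul,
        TensorProduct.map_tmul, LinearMap.comp_apply, LinearEquiv.coe_coe]
      rw [mul_comm, mul_smul, ← TensorProduct.tmul_smul, counit_smul_sgn hb,
        TensorProduct.smul_tmul_smul, TensorProduct.tmul_smul, smul_smul, mul_comm]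
  exact this (u ⊗ₜ u')

theorem sgn_of_mem_zero {X : Type*} [AddCommGroup X] [Module R X] [GrMod R X] {x : X}
    (k : ℤ) (hx : x ∈ gr R X 0) : sgn R k x = x := by
  rw [sgn_apply k hx]; simp

/-- The tensor product of coaugmented chain coalgebras. -/
instance instDGCoalgTensor : DGCoalg R (C ⊗[R] C') where
  comul := tensorCoact (comul R) (comul R)
  counit := tensorCounit R C C'
  one := one R C ⊗ₜ one R C'
  comul_mem := tensorCoact_mem (hasDegree_comul R) (hasDegree_comul R)
  counit_of_ne n hn z hz := by
    induction hz using Submodule.span_induction with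
    | zero => simp
    | add x y _ _ hx hy => rw [map_add, hx, hy, add_zero]
    | smul a x _ hx => rw [map_smul, hx, smul_zero]
    | mem z hz =>
      obtain ⟨i, j, rfl, x, hx, y, hy, rfl⟩ := hz
      rw [tensorCounit_tmul]
      by_cases hi : i = 0
      · rw [counit_of_ne j (by omega) y hy, mul_zero]
      · rw [counit_of_ne i hi x hx, zero_mul]
  one_mem := tmul_mem' DGCoalg.one_mem DGCoalg.one_mem (add_zero 0)
  d_comul := d_tensorCoact (hasDegree_comul R) d_comul d_comul
  counit_d z := by
    induction z with
    | zero => simp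
    | add x y hx hy => simp only [map_add, hx, hy, add_zero]
    | tmul x y => simp [d_tmul, tensorCounit_tmul, counit_d]
  d_one := by simp [d_tmul, DGCoalg.d_one]
  coassoc := tensorCoact_coassoc (hasDegree_comul R) (hasDegree_comul R)
    DGCoalg.coassoc DGCoalg.coassoc
  counit_left z := by
    induction z with
    | zero => simp
    | add x y hx hy => simp only [map_add, hx, hy]
    | tmul x y => rw [tensorCoact_tmul, counitL_midSwap, counit_left, counit_left]
  counit_right z := by
    induction z with
    | zero => simp
    | add x y hx hy => simp only [map_add, hx, hy]
    | tmul x y => rw [tensorCoact_tmul, counitR_midSwap, counit_right, counit_right]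
  comul_one := by
    rw [tensorCoact_tmul, comul_one, comul_one, midSwap_tmul _ DGCoalg.one_mem,
      sgn_of_mem_zero _ DGCoalg.one_mem]
  counit_one := by rw [tensorCounit_tmul, DGCoalg.counit_one, DGCoalg.counit_one, one_mul]

variable {N : Type*} [AddCommGroup N] [Module R N] [DGMod R N] [DGBicomod R C N]
variable {N' : Type*} [AddCommGroup N'] [Module R N'] [DGMod R N'] [DGBicomod R C' N']

/-- The tensor product of a `C`-bicomodule and a `C'`-bicomodule. -/
instance instDGBicomodTensor : DGBicomod R (C ⊗[R] C') (N ⊗[R] N') where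
  coactL := tensorCoact (coactL R C) (coactL R C')
  coactR := tensorCoact (coactR R C) (coactR R C')
  coaug := coaug R C N ⊗ₜ coaug R C' N'
  coactL_mem := tensorCoact_mem hasDegree_coactL hasDegree_coactL
  coactR_mem := tensorCoact_mem hasDegree_coactR hasDegree_coactR
  coaug_mem := tmul_mem' coaug_mem coaug_mem (add_zero 0)
  d_coactL := d_tensorCoact hasDegree_coactL d_coactL d_coactL
  d_coactR := d_tensorCoact hasDegree_coactR d_coactR d_coactR
  d_coaug := by simp [d_tmul, d_coaug]
  coassocL := tensorCoact_coassoc (hasDegree_comul R) hasDegree_coactL coassocL coassocL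
  coassocR := tensorCoact_coassoc hasDegree_coactR (hasDegree_comul R) coassocR coassocR
  coassocLR := tensorCoact_coassoc hasDegree_coactL hasDegree_coactR coassocLR coassocLR
  counitL z := by
    induction z with
    | zero => simp
    | add x y hx hy => simp only [map_add, hx, hy]
    | tmul x y => 
      rw [tensorCoact_tmul]
      exact (counitL_midSwap _ _).trans (by rw [counitL, counitL])
  counitR z := by
    induction z with
    | zero => simp
    | add x y hx hy => simp only [map_add, hx, hy]
    | tmul x y =>
      rw [tensorCoact_tmul]
      exact (counitR_midSwap _ _).trans (by rw [counitR, counitR])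
  coactL_coaug := by
    rw [tensorCoact_tmul, coactL_coaug, coactL_coaug, midSwap_tmul _ coaug_mem,
      sgn_of_mem_zero _ DGCoalg.one_mem]
    rfl
  coactR_coaug := by
    rw [tensorCoact_tmul, coactR_coaug, coactR_coaug, midSwap_tmul _ DGCoalg.one_mem,
      sgn_of_mem_zero _ coaug_mem]
    rfl

end TensorCoalg

/-! ### Chain maps and chain homotopies -/

section DGHom

variable (R : Type u) [CommRing R]

/-- A chain map between chain complexes. -/
structure DGHom (M N : Type*) [AddCommGroup M] [Module R M] [DGMod R M]
    [AddCommGroup N] [Module R N] [DGMod R N] where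
  lin : M →ₗ[R] N
  mem : ∀ n, ∀ x ∈ gr R M n, lin x ∈ gr R N n
  comm : ∀ x, d R (lin x) = lin (d R x)

variable {R}
variable {M N P Q : Type*} [AddCommGroup M] [Module R M] [DGMod R M]
  [AddCommGroup N] [Module R N] [DGMod R N] [AddCommGroup P] [Module R P] [DGMod R P]
  [AddCommGroup Q] [Module R Q] [DGMod R Q]

theorem DGHom.ext' {f g : DGHom R M N} (h : f.lin = g.lin) : f = g := by
  cases f; cases g; cases h; rfl

variable (R M) in
/-- The identity chain map. -/
def DGHom.id : DGHom R M M := ⟨LinearMap.id, fun _ _ h => h, fun _ => rfl⟩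

/-- Composition of chain maps. -/
def DGHom.comp (g : DGHom R N P) (f : DGHom R M N) : DGHom R M P where
  lin := g.lin ∘ₗ f.lin
  mem n x hx := g.mem n _ (f.mem n x hx)
  comm x := by rw [LinearMap.comp_apply, LinearMap.comp_apply, g.comm, f.comm]

theorem DGHom.hasDegree (f : DGHom R M N) : HasDegree R 0 f.lin := fun n x hx => by
  rw [add_zero]; exact f.mem n x hx

/-- The tensor product of chain maps. -/
def DGHom.tensor (f : DGHom R M N) (g : DGHom R P Q) : DGHom R (M ⊗[R] P) (N ⊗[R] Q) where
  lin := TensorProduct.map f.lin g.lin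
  mem n z hz := by simpa using hasDegree_map f.hasDegree g.hasDegree n z hz
  comm z := by
    induction z with
    | zero => simp
    | add x y hx hy => simp only [map_add, hx, hy]
    | tmul x y =>
      simp only [TensorProduct.map_tmul, d_tmul, map_add, f.comm, g.comm, f.hasDegree.sgn_comm]
      simp

/-- A chain homotopy from `f` to `g`: a map of degree `1` with `d h + h d = g - f`. -/
structure DGHomotopy (f g : DGHom R M N) where
  lin : M →ₗ[R] N
  mem : ∀ n, ∀ x ∈ gr R M n, lin x ∈ gr R N (n + 1)
  comm : ∀ x, d R (lin x) + lin (d R x) = g.lin x - f.lin x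

end DGHom

/-! ### Milgram's map -/

section Milgram

variable (R : Type u) [CommRing R]
variable (C : Type*) [AddCommGroup C] [Module R C] [DGCoalg R C]
variable (C' : Type*) [AddCommGroup C'] [Module R C'] [DGCoalg R C']

/-- The multiplication of the algebra `Ω C ⊗ Ω C'`,
`(v ⊗ v') (w ⊗ w') = (-1)^(|v'||w|) v w ⊗ v' w'`. -/
def cobarTensorMul : Cobar R C ⊗[R] Cobar R C' →ₗ[R]
    Cobar R C ⊗[R] Cobar R C' →ₗ[R] Cobar R C ⊗[R] Cobar R C' :=
  TensorProduct.curry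
    (TensorProduct.map (LinearMap.mul' R (Cobar R C)) (LinearMap.mul' R (Cobar R C')) ∘ₗ
      midSwap R (Cobar R C) (Cobar R C') (Cobar R C) (Cobar R C'))

/-- The values of Milgram's map on generators:
`s⁻¹(c ⊗ c') ↦ ε(c') (s⁻¹c̄ ⊗ 1) + ε(c) (1 ⊗ s⁻¹c̄')`; that is, `s⁻¹(c ⊗ 1) ↦ s⁻¹c ⊗ 1`,
`s⁻¹(1 ⊗ c') ↦ 1 ⊗ s⁻¹c'`, and `s⁻¹(c ⊗ c') ↦ 0` for `c`, `c'` in the coaugmentation coideals. -/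
def milgramGen : C ⊗[R] C' →ₗ[R] Cobar R C ⊗[R] Cobar R C' :=
  TensorProduct.map (univTw R) ((counit R).smulRight 1) +
    TensorProduct.map ((counit R).smulRight 1) (univTw R)

/-- Milgram's map `Ω (C ⊗ C') → Ω C ⊗ Ω C'`, the algebra map with the values `milgramGen` on
generators: it sends `w₁ | ⋯ | wₖ` to the product of the values on `w₁, …, wₖ`. -/
def milgramLin : Cobar R (C ⊗[R] C') →ₗ[R] Cobar R C ⊗[R] Cobar R C' :=
  LinearMap.applyₗ (1 ⊗ₜ 1) ∘ₗ (TensorAlgebra.lift R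
    (cobarTensorMul R C C' ∘ₗ milgramGen R C C' ∘ₗ desuspIncl R (C ⊗[R] C')) :
      Cobar R (C ⊗[R] C') →ₐ[R] Module.End R (Cobar R C ⊗[R] Cobar R C')).toLinearMap

variable {R C C'}

theorem cobarTensorMul_tmul {j : ℤ} (a : Cobar R C) {b : Cobar R C'}
    (hb : b ∈ gr R (Cobar R C') j) (a' : Cobar R C) (b' : Cobar R C') :
    cobarTensorMul R C C' (a ⊗ₜ b) (a' ⊗ₜ b') = (a * sgn R j a') ⊗ₜ (b * b') := by
  simp only [cobarTensorMul, TensorProduct.curry_apply, LinearMap.comp_apply]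
  rw [midSwap_tmul _ hb]; rfl

theorem cobarTensorMul_one_left (z : Cobar R C ⊗[R] Cobar R C') :
    cobarTensorMul R C C' (1 ⊗ₜ 1) z = z := by
  induction z with
  | zero => simp
  | add x y hx hy => rw [map_add, hx, hy]
  | tmul a b =>
    rw [cobarTensorMul_tmul _ talg_one_mem, sgn_congr (k := 0) (l := 1 + 1) (by decide), sgn_add,
      sgn_sgn, one_mul, one_mul]

theorem cobarTensorMul_one_right (z : Cobar R C ⊗[R] Cobar R C') :
    cobarTensorMul R C C' z (1 ⊗ₜ 1) = z := by
  have : (cobarTensorMul R C C').flip (1 ⊗ₜ 1) = LinearMap.id := by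
    refine tensor_hom_ext fun i a ha j b hb => ?_
    rw [LinearMap.flip_apply, cobarTensorMul_tmul _ hb, sgn_talg_one, mul_one, mul_one,
      LinearMap.id_apply]
  exact LinearMap.congr_fun this z

theorem cobarTensorMul_assoc (x y z : Cobar R C ⊗[R] Cobar R C') :
    cobarTensorMul R C C' (cobarTensorMul R C C' x y) z =
      cobarTensorMul R C C' x (cobarTensorMul R C C' y z) := by
  have hom : ∀ (j : ℤ) (a : Cobar R C) (b : Cobar R C'), b ∈ gr R (Cobar R C') j →
      ∀ (k : ℤ) (a' : Cobar R C) (b' : Cobar R C'), b' ∈ gr R (Cobar R C') k →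
      cobarTensorMul R C C' (cobarTensorMul R C C' (a ⊗ₜ b) (a' ⊗ₜ b')) z =
      cobarTensorMul R C C' (a ⊗ₜ b) (cobarTensorMul R C C' (a' ⊗ₜ b') z) := by
    intro j a b hb k a' b' hb'
    induction z with
    | zero => simp
    | add x y hx hy => simp only [map_add, hx, hy]
    | tmul a'' b'' =>
      rw [cobarTensorMul_tmul _ hb, cobarTensorMul_tmul _ hb', cobarTensorMul_tmul _ hb,
        cobarTensorMul_tmul _ (talg_mul_mem hb hb'), sgn_talg_mul, sgn_add, mul_assoc, mul_assoc]
  have h1 : ∀ y, (cobarTensorMul R C C').flip z ∘ₗ (cobarTensorMul R C C').flip y =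
      (cobarTensorMul R C C').flip (cobarTensorMul R C C' y z) := by
    intro y
    refine tensor_hom_ext fun i a ha j b hb => ?_
    have h2 : (cobarTensorMul R C C').flip z ∘ₗ (cobarTensorMul R C C' (a ⊗ₜ b)) =
        (cobarTensorMul R C C' (a ⊗ₜ b)) ∘ₗ (cobarTensorMul R C C').flip z :=
      tensor_hom_ext fun i' a' ha' k b' hb' => hom j a b hb k a' b' hb'
    exact LinearMap.congr_fun h2 y
  exact LinearMap.congr_fun (h1 y) x

theorem milgramLin_one : milgramLin R C C' 1 = 1 ⊗ₜ 1 := by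
  simp [milgramLin]

theorem milgramLin_univTw_mul (z : C ⊗[R] C') (a : Cobar R (C ⊗[R] C')) :
    milgramLin R C C' (univTw R z * a) =
      cobarTensorMul R C C' (milgramGen R C C' z) (milgramLin R C C' a) := by
  have h : milgramGen R C C' (desuspIncl R _ (desusp R z)) = milgramGen R C C' z := by
    rw [desuspIncl_desusp, map_sub, map_smul]
    have : milgramGen R C C' (one R (C ⊗[R] C')) = 0 := by
      show milgramGen R C C' (one R C ⊗ₜ one R C') = 0
      simp [milgramGen, univTw_one]
    rw [this, smul_zero, sub_zero]
  rw [milgramLin, LinearMap.comp_apply, AlgHom.toLinearMap_apply, map_mul, univTw,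
    LinearMap.comp_apply, TensorAlgebra.lift_ι_apply, LinearMap.comp_apply, LinearMap.comp_apply, h]
  rfl

theorem milgramLin_univTw (z : C ⊗[R] C') :
    milgramLin R C C' (univTw R z) = milgramGen R C C' z := by
  rw [← mul_one (univTw R z), milgramLin_univTw_mul, milgramLin_one, cobarTensorMul_one_right]

/-- Milgram's map is multiplicative. -/
theorem milgramLin_mul (a b : Cobar R (C ⊗[R] C')) :
    milgramLin R C C' (a * b) =
      cobarTensorMul R C C' (milgramLin R C C' a) (milgramLin R C C' b) := by
  refine talg_induction (p := fun a => milgramLin R C C' (a * b) =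
      cobarTensorMul R C C' (milgramLin R C C' a) (milgramLin R C C' b)) ?_ ?_ ?_ ?_ a
  · rw [one_mul, milgramLin_one, cobarTensorMul_one_left]
  · intro x y hx hy; rw [add_mul, map_add, map_add, hx, hy, map_add, LinearMap.add_apply]
  · intro r x hx; rw [smul_mul_assoc, map_smul, map_smul, hx, map_smul, LinearMap.smul_apply]
  · intro i w hw a ha
    rw [ι_eq_univTw, mul_assoc, milgramLin_univTw_mul, ha, milgramLin_univTw_mul,
      cobarTensorMul_assoc]

theorem cobarTensorMul_mem {m n : ℤ} {x y : Cobar R C ⊗[R] Cobar R C'}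
    (hx : x ∈ gr R (Cobar R C ⊗[R] Cobar R C') m) (hy : y ∈ gr R (Cobar R C ⊗[R] Cobar R C') n) :
    cobarTensorMul R C C' x y ∈ gr R (Cobar R C ⊗[R] Cobar R C') (m + n) := by
  have h1 := hasDegree_midSwap (R := R) (m + n) (x ⊗ₜ y) (tmul_mem hx hy)
  have h2 : HasDegree R 0 (TensorProduct.map (LinearMap.mul' R (Cobar R C))
      (LinearMap.mul' R (Cobar R C'))) := by
    refine hasDegree_map ?_ ?_ <;>
    · refine hasDegree_tensor fun i x hx j y hy => ?_
      rw [add_zero]; exact talg_mul_mem hx hy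
  have h3 := h2 _ _ h1
  rwa [add_zero, add_zero] at h3

theorem counit_smulRight_mem (i : ℤ) (c : C) (hc : c ∈ gr R C i) :
    ((counit R : C →ₗ[R] R).smulRight (1 : Cobar R C)) c ∈ gr R (Cobar R C) i := by
  rw [LinearMap.smulRight_apply]
  by_cases hi : i = 0
  · subst hi; exact Submodule.smul_mem _ _ talg_one_mem
  · rw [counit_of_ne i hi c hc, zero_smul]; exact zero_mem _

theorem d_mul' (z : Cobar R C ⊗[R] Cobar R C) : d R (LinearMap.mul' R (Cobar R C) z) =
    LinearMap.mul' R (Cobar R C) (d R z) := by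
  induction z with
  | zero => simp
  | add x y hx hy => simp only [map_add, hx, hy]
  | tmul a b => simp [d_tmul, d_cobar, cobarD_mul]

theorem hasDegree_milgramGen : HasDegree R (-1) (milgramGen R C C') := by
  refine hasDegree_tensor fun i c hc j c' hc' => ?_
  exact add_mem (S := Submodule R (Cobar R C ⊗[R] Cobar R C'))
    (tmul_mem' (hasDegree_univTw R i c hc) (counit_smulRight_mem j c' hc') (by ring))
    (tmul_mem' (counit_smulRight_mem i c hc) (hasDegree_univTw R j c' hc') (by ring))

theorem milgramLin_mem (n : ℤ) (a : Cobar R (C ⊗[R] C')) (ha : a ∈ gr R _ n) :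
    milgramLin R C C' a ∈ gr R (Cobar R C ⊗[R] Cobar R C') n := by
  refine talg_gr_induction (p := fun n a =>
    milgramLin R C C' a ∈ gr R (Cobar R C ⊗[R] Cobar R C') n) ?_ ?_ ?_ ?_ ?_ ha
  · rw [milgramLin_one]; exact tmul_mem' talg_one_mem talg_one_mem (add_zero 0)
  · intro n; rw [map_zero]; exact zero_mem _
  · intro n a b ha hb; rw [map_add]; exact add_mem ha hb
  · intro n r a ha; rw [map_smul]; exact Submodule.smul_mem _ _ ha
  · intro i w hw n a _ ha
    rw [ι_eq_univTw, milgramLin_univTw_mul]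
    have hw' : desuspIncl R (C ⊗[R] C') w ∈ gr R (C ⊗[R] C') (i + 1) := hw
    have := hasDegree_milgramGen _ _ hw'
    rw [add_neg_cancel_right] at this
    exact cobarTensorMul_mem this ha

theorem sgn_cobarTensorMul (k : ℤ) (x y : Cobar R C ⊗[R] Cobar R C') :
    sgn R k (cobarTensorMul R C C' x y) = cobarTensorMul R C C' (sgn R k x) (sgn R k y) := by
  have : (cobarTensorMul R C C').compr₂ (sgn R k) =
      (cobarTensorMul R C C').compl₁₂ (sgn R k) (sgn R k) := by
    refine gr_hom_ext fun i a ha => gr_hom_ext fun j b hb => ?_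
    simp only [LinearMap.compr₂_apply, LinearMap.compl₁₂_apply]
    rw [sgn_apply k (cobarTensorMul_mem ha hb), sgn_apply k ha, sgn_apply k hb, map_smul, map_smul,
      LinearMap.smul_apply, smul_smul, mul_add, ksign_add, mul_comm]
  exact LinearMap.congr_fun₂ this x y

theorem sgn_milgramLin (k : ℤ) (a : Cobar R (C ⊗[R] C')) :
    sgn R k (milgramLin R C C' a) = milgramLin R C C' (sgn R k a) := by
  have : HasDegree R 0 (milgramLin R C C') := fun n x hx => by
    rw [add_zero]; exact milgramLin_mem n x hx
  rw [this.sgn_comm]; simp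

theorem d_cobarTensorMul (x y : Cobar R C ⊗[R] Cobar R C') :
    d R (cobarTensorMul R C C' x y) = cobarTensorMul R C C' (d R x) y +
      cobarTensorMul R C C' (sgn R 1 x) (d R y) := by
  have hdeg : HasDegree R 0 (LinearMap.mul' R (Cobar R C)) :=
    hasDegree_tensor fun i x hx j y hy => by rw [add_zero]; exact talg_mul_mem hx hy
  have hmap : ∀ z, d R (TensorProduct.map (LinearMap.mul' R (Cobar R C))
      (LinearMap.mul' R (Cobar R C')) z) = TensorProduct.map (LinearMap.mul' R (Cobar R C))
      (LinearMap.mul' R (Cobar R C')) (d R z) := by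
    intro z
    induction z with
    | zero => simp
    | add x y hx hy => simp only [map_add, hx, hy]
    | tmul a b =>
      rw [TensorProduct.map_tmul, d_tmul, d_tmul, map_add, TensorProduct.map_tmul,
        TensorProduct.map_tmul, d_mul', d_mul', hdeg.sgn_comm]
      simp
  simp only [cobarTensorMul, TensorProduct.curry_apply, LinearMap.comp_apply]
  rw [hmap, d_midSwap, d_tmul, map_add, map_add]

theorem milgramGen_tmul (c : C) (c' : C') : milgramGen R C C' (c ⊗ₜ c') =
    univTw R c ⊗ₜ (counit R c' • 1) + (counit R c • 1) ⊗ₜ univTw R c' := rfl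

set_option maxHeartbeats 1000000 in
/-- The key identity: `d g(z) = - g(dz) + ∑ ± g(z₁) g(z₂)`. -/
theorem d_milgramGen (z : C ⊗[R] C') :
    d R (milgramGen R C C' z) = milgramLin R C C' (cobarD R _ (univTw R z)) := by
  have hsq : ∀ y : (C ⊗[R] C') ⊗[R] (C ⊗[R] C'), milgramLin R C C' (univTwSq R y) =
      TensorProduct.lift (cobarTensorMul R C C')
        (TensorProduct.map (milgramGen R C C' ∘ₗ sgn R 1) (milgramGen R C C') y) := by
    intro y
    induction y with
    | zero => simp
    | add x y hx hy => simp only [map_add, hx, hy]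
    | tmul a b =>
      rw [univTwSq_tmul, milgramLin_mul, milgramLin_univTw, milgramLin_univTw]; rfl
  -- the value on a product of decomposables
  have key : ∀ (u : C ⊗[R] C) (u' : C' ⊗[R] C'),
      milgramLin R C C' (univTwSq R (midSwap R C C C' C' (u ⊗ₜ u'))) =
      univTwSq R u ⊗ₜ (tensorCounit R C' C' u' • 1) + (tensorCounit R C C u • 1) ⊗ₜ univTwSq R u' +
      (univTw R (sgn R 1 (TensorProduct.rid R C ((counit R).lTensor C u))) ⊗ₜ
        univTw R (TensorProduct.lid R C' ((counit R).rTensor C' u')) -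
       univTw R (sgn R 1 (TensorProduct.lid R C ((counit R).rTensor C u))) ⊗ₜ
        univTw R (TensorProduct.rid R C' ((counit R).lTensor C' u'))) := by
    intro u u'
    rw [hsq]
    induction u' with
    | zero => simp
    | add x y hx hy =>
      simp only [TensorProduct.tmul_add, map_add, hx, hy, add_smul]; abel
    | tmul c₀' c₁' =>
    induction u with
    | zero => simp
    | add x y hx hy =>
      simp only [TensorProduct.add_tmul, map_add, hx, hy, add_smul]; abel
    | tmul c₀ c₁ =>
    refine gr_induction (R := R) (p := fun c₁ =>
      TensorProduct.lift (cobarTensorMul R C C')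
        (TensorProduct.map (milgramGen R C C' ∘ₗ sgn R 1) (milgramGen R C C')
          (midSwap R C C C' C' ((c₀ ⊗ₜ c₁) ⊗ₜ (c₀' ⊗ₜ c₁')))) =
      univTwSq R (c₀ ⊗ₜ[R] c₁) ⊗ₜ (tensorCounit R C' C' (c₀' ⊗ₜ c₁') • 1) +
        (tensorCounit R C C (c₀ ⊗ₜ c₁) • 1) ⊗ₜ univTwSq R (c₀' ⊗ₜ c₁') +
      (univTw R (sgn R 1 (TensorProduct.rid R C ((counit R).lTensor C (c₀ ⊗ₜ c₁)))) ⊗ₜ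
        univTw R (TensorProduct.lid R C' ((counit R).rTensor C' (c₀' ⊗ₜ c₁'))) -
       univTw R (sgn R 1 (TensorProduct.lid R C ((counit R).rTensor C (c₀ ⊗ₜ c₁)))) ⊗ₜ
        univTw R (TensorProduct.rid R C' ((counit R).lTensor C' (c₀' ⊗ₜ c₁'))))) ?_ ?_ c₁
    · intro x y hx hy
      simp only [TensorProduct.add_tmul, TensorProduct.tmul_add, map_add, add_smul] at hx hy ⊢
      rw [hx, hy]; abel
    intro j c₁ hc₁
    refine gr_induction (R := R) (p := fun c₀' =>
      TensorProduct.lift (cobarTensorMul R C C')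
        (TensorProduct.map (milgramGen R C C' ∘ₗ sgn R 1) (milgramGen R C C')
          (midSwap R C C C' C' ((c₀ ⊗ₜ c₁) ⊗ₜ (c₀' ⊗ₜ c₁')))) =
      univTwSq R (c₀ ⊗ₜ[R] c₁) ⊗ₜ (tensorCounit R C' C' (c₀' ⊗ₜ c₁') • 1) +
        (tensorCounit R C C (c₀ ⊗ₜ c₁) • 1) ⊗ₜ univTwSq R (c₀' ⊗ₜ c₁') +
      (univTw R (sgn R 1 (TensorProduct.rid R C ((counit R).lTensor C (c₀ ⊗ₜ c₁)))) ⊗ₜ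
        univTw R (TensorProduct.lid R C' ((counit R).rTensor C' (c₀' ⊗ₜ c₁'))) -
       univTw R (sgn R 1 (TensorProduct.lid R C ((counit R).rTensor C (c₀ ⊗ₜ c₁)))) ⊗ₜ
        univTw R (TensorProduct.rid R C' ((counit R).lTensor C' (c₀' ⊗ₜ c₁'))))) ?_ ?_ c₀'
    · intro x y hx hy
      simp only [TensorProduct.add_tmul, TensorProduct.tmul_add, map_add, add_smul] at hx hy ⊢
      rw [hx, hy]; abel
    intro k c₀' hc₀'
    have hk : univTw R (sgn R 1 (sgn R j c₀')) ∈ gr R (Cobar R C') (k - 1) :=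
      hasDegree_univTw R k _ (sgn_mem 1 (sgn_mem j hc₀'))
    have h4 : counit R c₁ • (1 : Cobar R C) ⊗ₜ[R] (univTw R (sgn R 1 (sgn R j c₀')) * univTw R c₁') =
        counit R c₁ • (1 : Cobar R C) ⊗ₜ[R] (univTw R (sgn R 1 c₀') * univTw R c₁') := by
      rw [← TensorProduct.tmul_smul, ← TensorProduct.tmul_smul, ← smul_mul_assoc, ← smul_mul_assoc,
        ← map_smul, ← map_smul, ← map_smul, ← map_smul, map_smul (sgn R j), counit_smul_sgn hc₁,
        ← map_smul]
    have h3 : sgn R (k - 1) (univTw R c₁) ⊗ₜ[R] univTw R (sgn R 1 (sgn R j c₀')) =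
        - (univTw R (sgn R 1 c₁) ⊗ₜ[R] univTw R c₀') := by
      rw [sgn_univTw, sgn_apply _ hc₁, sgn_apply _ hc₁, sgn_apply j hc₀',
        map_smul (sgn R 1), sgn_apply 1 hc₀']
      simp only [map_smul, TensorProduct.tmul_smul, ← TensorProduct.smul_tmul', smul_smul]
      suffices hs : ksign R (j * k) * ksign R (1 * k) * (ksign R (k - 1) * ksign R ((k - 1) * j)) =
          - ksign R (1 * j) by rw [hs, neg_smul]
      rw [← ksign_add, ← ksign_add, ← ksign_add,
        show - ksign R (1 * j) = ksign R (j + 1) by rw [ksign_add, one_mul]; simp]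
      apply ksign_congr
      rcases Int.even_or_odd j with hp | hp <;> rcases Int.even_or_odd k with hq | hq <;>
        simp_all [Int.even_add, Int.even_sub, Int.even_mul, ← Int.not_even_iff_odd]
    rw [midSwap_tmul _ hc₁]
    simp only [TensorProduct.map_tmul, TensorProduct.lift.tmul, LinearMap.comp_apply, sgn_tmul,
      milgramGen_tmul, map_add, LinearMap.add_apply, counit_sgn, TensorProduct.tmul_smul,
      ← TensorProduct.smul_tmul', map_smul, LinearMap.smul_apply, cobarTensorMul_tmul _ hk,
      cobarTensorMul_tmul _ talg_one_mem, sgn_of_mem_zero _ talg_one_mem, mul_one, one_mul,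
      LinearMap.lTensor_tmul, LinearMap.rTensor_tmul, TensorProduct.rid_tmul,
      TensorProduct.lid_tmul, tensorCounit_tmul, univTwSq_tmul, h3]
    have h0 : ∀ x : Cobar R C, sgn R 0 x = x := fun x => by
      rw [sgn_congr (k := 0) (l := 1 + 1) (by decide), sgn_add, sgn_sgn]
    simp only [h0, mul_smul, smul_neg, smul_add]
    rw [smul_comm (counit R c₁') (counit R c₀'), smul_comm (counit R c₁) (counit R c₀),
      smul_comm (counit R c₁) (counit R c₀'), smul_comm (counit R c₁') (counit R c₀), h4]
    abel
  have htc : ∀ c : C, tensorCounit R C C (comul R c) = counit R c := fun c => by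
    conv_rhs => rw [← counit_left (R := R) c]
    generalize comul R c = y
    induction y with
    | zero => simp
    | add x y hx hy => simp only [map_add, hx, hy]
    | tmul a b => simp [tensorCounit_tmul]
  have htc' : ∀ c : C', tensorCounit R C' C' (comul R c) = counit R c := fun c => by
    conv_rhs => rw [← counit_left (R := R) c]
    generalize comul R c = y
    induction y with
    | zero => simp
    | add x y hx hy => simp only [map_add, hx, hy]
    | tmul a b => simp [tensorCounit_tmul]
  induction z with
  | zero => simp
  | add x y hx hy => simp only [map_add, hx, hy]
  | tmul c c' =>
    have hc : comul R (c ⊗ₜ[R] c') = midSwap R C C C' C' (comul R c ⊗ₜ comul R c') := rfl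
    rw [cobarD_univTw, map_add, map_neg, milgramLin_univTw, hc, key, htc, htc', counit_left,
      counit_left, counit_right, counit_right, sub_self, add_zero, d_tmul]
    simp only [map_add, milgramGen_tmul, d_tmul, counit_d, counit_sgn, zero_smul,
      TensorProduct.tmul_zero, TensorProduct.zero_tmul, d_cobar, cobarD_univTw, cobarD_one,
      map_smul, smul_zero, sgn_of_mem_zero _ talg_one_mem, TensorProduct.add_tmul,
      TensorProduct.tmul_add, TensorProduct.neg_tmul, TensorProduct.tmul_neg]
    abel

theorem d_milgramLin (a : Cobar R (C ⊗[R] C')) :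
    d R (milgramLin R C C' a) = milgramLin R C C' (d R a) := by
  refine talg_induction (p := fun a =>
    d R (milgramLin R C C' a) = milgramLin R C C' (d R a)) ?_ ?_ ?_ ?_ a
  · rw [milgramLin_one, d_tmul, d_cobar, d_cobar, d_cobar, cobarD_one, cobarD_one, cobarD_one]
    simp
  · intro x y hx hy; simp only [map_add, hx, hy]
  · intro r x hx; simp only [map_smul, hx]
  · intro i w hw a ha
    rw [ι_eq_univTw, milgramLin_mul, d_cobarTensorMul, ha, sgn_milgramLin, milgramLin_univTw,
      d_milgramGen, d_cobar, d_cobar, cobarD_mul, map_add, milgramLin_mul, milgramLin_mul]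

variable (R C C') in
/-- Milgram's chain map `q : Ω (C ⊗ C') → Ω C ⊗ Ω C'`. -/
def milgram : DGHom R (Cobar R (C ⊗[R] C')) (Cobar R C ⊗[R] Cobar R C') where
  lin := milgramLin R C C'
  mem := milgramLin_mem
  comm := d_milgramLin

end Milgram

/-! ### The category of bicomodule pairs and the coHochschild functor -/

section Functoriality

variable {R : Type u} [CommRing R]

/-- A morphism of coaugmented chain coalgebras. -/
structure CoalgHom (R : Type u) [CommRing R] (C D : Type*)
    [AddCommGroup C] [Module R C] [DGCoalg R C] [AddCommGroup D] [Module R D] [DGCoalg R D]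
    extends DGHom R C D where
  comul_lin : ∀ c, comul R (lin c) = TensorProduct.map lin lin (comul R c)
  counit_lin : ∀ c, counit R (lin c) = counit R c
  lin_one : lin (one R C) = one R D

variable {C D : Type*} [AddCommGroup C] [Module R C] [DGCoalg R C]
  [AddCommGroup D] [Module R D] [DGCoalg R D]

/-- `f : N → N'` is a morphism of chain `D`-bicomodules along the coalgebra map `C → D`, where
the `C`-bicomodule `N` is regarded as a `D`-bicomodule with the coactions
`N → C ⊗ N → D ⊗ N` and `N → N ⊗ C → N ⊗ D`. -/
structure BicomodHom (φ : CoalgHom R C D) (N N' : Type*)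
    [AddCommGroup N] [Module R N] [DGMod R N] [DGBicomod R C N]
    [AddCommGroup N'] [Module R N'] [DGMod R N'] [DGBicomod R D N'] extends DGHom R N N' where
  coactL_lin : ∀ x, coactL R D (lin x) = TensorProduct.map φ.lin lin (coactL R C x)
  coactR_lin : ∀ x, coactR R D (lin x) = TensorProduct.map lin φ.lin (coactR R C x)

/-- The algebra map `Ω C → Ω D`, `s⁻¹ c ↦ s⁻¹ φ(c)`. -/
def cobarMapAlg (φ : CoalgHom R C D) : Cobar R C →ₐ[R] Cobar R D :=
  TensorAlgebra.lift R (univTw R ∘ₗ φ.lin ∘ₗ desuspIncl R C)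

theorem cobarMapAlg_univTw (φ : CoalgHom R C D) (c : C) :
    cobarMapAlg φ (univTw R c) = univTw R (φ.lin c) := by
  show TensorAlgebra.lift R _ (TensorAlgebra.ι R (desusp R c)) = _
  rw [TensorAlgebra.lift_ι_apply]
  simp only [LinearMap.comp_apply, desuspIncl_desusp, map_sub, map_smul, φ.lin_one]
  rw [univTw_one, smul_zero, sub_zero]

theorem cobarMapAlg_univTwSq (φ : CoalgHom R C D) (z : C ⊗[R] C) :
    cobarMapAlg φ (univTwSq R z) = univTwSq R (TensorProduct.map φ.lin φ.lin z) := by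
  induction z with
  | zero => simp
  | add x y hx hy => simp only [map_add, hx, hy]
  | tmul a b =>
    rw [univTwSq_tmul, map_mul, cobarMapAlg_univTw, cobarMapAlg_univTw, TensorProduct.map_tmul,
      univTwSq_tmul, φ.hasDegree.sgn_comm]
    simp

theorem cobarMapAlg_mem (φ : CoalgHom R C D) (n : ℤ) (a : Cobar R C)
    (ha : a ∈ gr R (Cobar R C) n) : cobarMapAlg φ a ∈ gr R (Cobar R D) n := by
  refine talg_gr_induction (p := fun n a => cobarMapAlg φ a ∈ gr R (Cobar R D) n) ?_ ?_ ?_ ?_ ?_ ha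
  · rw [map_one]; exact talg_one_mem
  · intro n; rw [map_zero]; exact zero_mem _
  · intro n a b ha hb; rw [map_add]; exact add_mem ha hb
  · intro n r a ha; rw [map_smul]; exact Submodule.smul_mem _ _ ha
  · intro i w hw n a _ ha
    have hw' : desuspIncl R C w ∈ gr R C (i + 1) := hw
    rw [ι_eq_univTw, map_mul, cobarMapAlg_univTw]
    have := talg_mul_mem (hasDegree_univTw R _ _ (φ.mem _ _ hw')) ha
    rwa [add_neg_cancel_right] at this

/-- The functoriality of the cobar construction. -/
def cobarMap (φ : CoalgHom R C D) : DGHom R (Cobar R C) (Cobar R D) where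
  lin := (cobarMapAlg φ).toLinearMap
  mem := cobarMapAlg_mem φ
  comm a := by
    have hs : ∀ a, sgn R 1 (cobarMapAlg φ a) = cobarMapAlg φ (sgn R 1 a) := fun a => by
      have : HasDegree R 0 (cobarMapAlg φ).toLinearMap := fun n x hx => by
        rw [add_zero]; exact cobarMapAlg_mem φ n x hx
      simpa using this.sgn_comm 1 a
    simp only [AlgHom.toLinearMap_apply, d_cobar]
    refine talg_induction (p := fun a =>
      cobarD R D (cobarMapAlg φ a) = cobarMapAlg φ (cobarD R C a)) ?_ ?_ ?_ ?_ a
    · rw [map_one, cobarD_one, cobarD_one, map_zero]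
    · intro x y hx hy; simp only [map_add, hx, hy]
    · intro r x hx; simp only [map_smul, hx]
    · intro i w hw a ha
      rw [ι_eq_univTw, map_mul, cobarD_mul, cobarD_mul, map_add, map_mul, map_mul, ha, hs,
        cobarMapAlg_univTw, cobarD_univTw, cobarD_univTw, map_add, map_neg, cobarMapAlg_univTw,
        cobarMapAlg_univTwSq, φ.comul_lin, φ.comm]

variable {N N' : Type*} [AddCommGroup N] [Module R N] [DGMod R N] [DGBicomod R C N]
  [AddCommGroup N'] [Module R N'] [DGMod R N'] [DGBicomod R D N']

theorem appendWord_map (φ : CoalgHom R C D) (f : N →ₗ[R] N') (z : N ⊗[R] Cobar R C)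
    (w : Cobar R C) :
    TensorProduct.map f (cobarMapAlg φ).toLinearMap (appendWord R C N (z ⊗ₜ w)) =
      appendWord R D N' (TensorProduct.map f (cobarMapAlg φ).toLinearMap z ⊗ₜ
        cobarMapAlg φ w) := by
  induction z with
  | zero => simp
  | add x y hx hy => simp only [map_add, TensorProduct.add_tmul, hx, hy]
  | tmul x v => simp [appendWord_tmul]

/-- The functoriality of the coHochschild complex: `x ⊗ w ↦ f x ⊗ Ω φ (w)`. -/
def cohochMap (φ : CoalgHom R C D) (f : BicomodHom φ N N') :
    DGHom R (CoHochschild R C N) (CoHochschild R D N') where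
  lin := TensorProduct.map f.lin (cobarMap φ).lin
  mem := (f.toDGHom.tensor (cobarMap φ)).mem
  comm z := by
    have h0 := (f.toDGHom.tensor (cobarMap φ)).comm
    have hs : ∀ k a, sgn R k ((cobarMap φ).lin a) = (cobarMap φ).lin (sgn R k a) := fun k a => by
      simpa using (cobarMap φ).hasDegree.sgn_comm k a
    have hsN : ∀ k x, sgn R k (f.lin x) = f.lin (sgn R k x) := fun k x => by
      simpa using f.hasDegree.sgn_comm k x
    have hm : ∀ a b, (cobarMap φ).lin (a * b) = (cobarMap φ).lin a * (cobarMap φ).lin b :=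
      fun a b => map_mul (cobarMapAlg φ) a b
    have ht : ∀ c, (cobarMap φ).lin (univTw R c) = univTw R (φ.lin c) := cobarMapAlg_univTw φ
    have hR : ∀ (y : N ⊗[R] C) (w : Cobar R C),
        TensorProduct.map f.lin (cobarMap φ).lin (insertR R C N (y ⊗ₜ w)) =
        insertR R D N' (TensorProduct.map f.lin φ.lin y ⊗ₜ (cobarMap φ).lin w) := by
      intro y w
      induction y with
      | zero => simp
      | add x y hx hy => simp only [map_add, TensorProduct.add_tmul, hx, hy]
      | tmul x c =>
        rw [insertR_tmul, TensorProduct.map_tmul, TensorProduct.map_tmul, insertR_tmul, hm, ht, hsN]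
    have hL : ∀ (y : C ⊗[R] N) (w : Cobar R C),
        TensorProduct.map f.lin (cobarMap φ).lin (insertL R C N (y ⊗ₜ w)) =
        insertL R D N' (TensorProduct.map φ.lin f.lin y ⊗ₜ (cobarMap φ).lin w) := by
      intro y w
      refine tmul_induction_left (R := R) (p := fun y =>
        TensorProduct.map f.lin (cobarMap φ).lin (insertL R C N (y ⊗ₜ w)) =
        insertL R D N' (TensorProduct.map φ.lin f.lin y ⊗ₜ (cobarMap φ).lin w)) ?_ ?_ ?_ y
      · simp
      · intro x y hx hy; simp only [map_add, TensorProduct.add_tmul, hx, hy]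
      · intro p c hc x
        rw [insertL_tmul hc, TensorProduct.map_tmul, TensorProduct.map_tmul,
          insertL_tmul (φ.mem _ _ hc), hm, ht, hsN, hs]
    show cohochD R D N' (TensorProduct.map f.lin (cobarMap φ).lin z) =
      TensorProduct.map f.lin (cobarMap φ).lin (cohochD R C N z)
    refine TensorProduct.induction_on z ?_ ?_ ?_
    · simp
    · intro x w
      rw [TensorProduct.map_tmul, cohochD_tmul, cohochD_tmul, map_add, map_sub, hR, hL,
        f.coactL_lin, f.coactR_lin]
      congr 2
      exact h0 (x ⊗ₜ w)
    · intro x y hx hy; simp only [map_add, hx, hy]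

variable (R C N)

/-- The natural inclusion `Ω C → Ĥ(N, C)`, `w ↦ 1 ⊗ w`, given by the coaugmentation of `N`. -/
def cohochIncl : DGHom R (Cobar R C) (CoHochschild R C N) where
  lin := TensorProduct.mk R N (Cobar R C) (coaug R C N)
  mem n w hw := tmul_mem' (R := R) (coaug_mem (C := C) (N := N)) hw (zero_add n)
  comm w := by
    show cohochD R C N (coaug R C N ⊗ₜ w) = coaug R C N ⊗ₜ cobarD R C w
    rw [cohochD_tmul, coactL_coaug, coactR_coaug, insertR_tmul, insertL_tmul DGCoalg.one_mem,
      univTw_one, d_tmul, d_coaug, sgn_of_mem_zero _ coaug_mem]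
    simp [d_cobar]

/-- The natural projection `Ĥ(N, C) → N`, `x ⊗ 1 ↦ x` and `x ⊗ w ↦ 0` for words `w` of positive
length. -/
def cohochProj : DGHom R (CoHochschild R C N) N where
  lin := (TensorProduct.rid R N).toLinearMap ∘ₗ
    (TensorAlgebra.algebraMapInv : Cobar R C →ₐ[R] R).toLinearMap.lTensor N
  mem := by
    have h : ∀ n, ∀ w ∈ gr R (Cobar R C) n,
        n = 0 ∨ (TensorAlgebra.algebraMapInv : Cobar R C →ₐ[R] R) w = 0 := by
      intro n w hw
      refine talg_gr_induction (p := fun n w => n = 0 ∨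
        (TensorAlgebra.algebraMapInv : Cobar R C →ₐ[R] R) w = 0) ?_ ?_ ?_ ?_ ?_ hw
      · exact Or.inl rfl
      · intro n; exact Or.inr (map_zero _)
      · rintro n a b (h | h) (h' | h') <;> simp_all
      · rintro n r a (h | h) <;> simp_all
      · intro i w hw n a _ _
        right
        rw [map_mul]; simp [TensorAlgebra.algebraMapInv]
    have hd : HasDegree R 0 ((TensorProduct.rid R N).toLinearMap ∘ₗ
        (TensorAlgebra.algebraMapInv : Cobar R C →ₐ[R] R).toLinearMap.lTensor N) := by
      refine hasDegree_tensor fun i x hx j w hw => ?_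
      rcases h j w hw with rfl | h
      · simpa using Submodule.smul_mem _ _ hx
      · simp [h]
    intro n x hx
    have := hd n x hx
    rwa [add_zero] at this
  comm z := by
    have hι : ∀ c : C, (TensorAlgebra.algebraMapInv : Cobar R C →ₐ[R] R) (univTw R c) = 0 := by
      intro c; simp [univTw, TensorAlgebra.algebraMapInv]
    have hsq : ∀ y : C ⊗[R] C,
        (TensorAlgebra.algebraMapInv : Cobar R C →ₐ[R] R) (univTwSq R y) = 0 := by
      intro y
      induction y with
      | zero => simp
      | add x y hx hy => simp [hx, hy]
      | tmul a b => rw [univTwSq_tmul, map_mul, hι, zero_mul]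
    have hD : ∀ w, (TensorAlgebra.algebraMapInv : Cobar R C →ₐ[R] R) (cobarD R C w) = 0 := by
      intro w
      refine talg_induction (p := fun w =>
        (TensorAlgebra.algebraMapInv : Cobar R C →ₐ[R] R) (cobarD R C w) = 0) ?_ ?_ ?_ ?_ w
      · rw [cobarD_one, map_zero]
      · intro x y hx hy; rw [map_add, map_add, hx, hy, add_zero]
      · intro r x hx; rw [map_smul, map_smul, hx, smul_zero]
      · intro i w hw a ha
        rw [ι_eq_univTw, cobarD_mul, map_add, map_mul, map_mul, ha, cobarD_univTw, map_add,
          map_neg, hι, hsq]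
        simp
    have hR : ∀ (y : N ⊗[R] C) (w : Cobar R C), TensorProduct.rid R N
        ((TensorAlgebra.algebraMapInv : Cobar R C →ₐ[R] R).toLinearMap.lTensor N
          (insertR R C N (y ⊗ₜ w))) = 0 := by
      intro y w
      induction y with
      | zero => simp
      | add x y hx hy => simp only [map_add, TensorProduct.add_tmul, hx, hy, add_zero]
      | tmul x c => rw [insertR_tmul]; simp [hι]
    have hL : ∀ (y : C ⊗[R] N) (w : Cobar R C), TensorProduct.rid R N
        ((TensorAlgebra.algebraMapInv : Cobar R C →ₐ[R] R).toLinearMap.lTensor N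
          (insertL R C N (y ⊗ₜ w))) = 0 := by
      intro y w
      refine tmul_induction_left (R := R) (p := fun y => TensorProduct.rid R N
        ((TensorAlgebra.algebraMapInv : Cobar R C →ₐ[R] R).toLinearMap.lTensor N
          (insertL R C N (y ⊗ₜ w))) = 0) ?_ ?_ ?_ y
      · simp
      · intro x y hx hy; simp only [map_add, TensorProduct.add_tmul, hx, hy, add_zero]
      · intro p c hc x; rw [insertL_tmul hc]; simp [hι]
    show d R (TensorProduct.rid R N ((TensorAlgebra.algebraMapInv :
        Cobar R C →ₐ[R] R).toLinearMap.lTensor N z)) = TensorProduct.rid R N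
        ((TensorAlgebra.algebraMapInv : Cobar R C →ₐ[R] R).toLinearMap.lTensor N
          (cohochD R C N z))
    refine TensorProduct.induction_on z ?_ ?_ ?_
    · simp
    · intro x w
      rw [cohochD_tmul, map_add, map_add, map_sub, map_sub, hR, hL, d_tmul]
      simp [hD, d_cobar]
    · intro x y hx hy; simp only [map_add, hx, hy]

end Functoriality

/-- An object `(N, C)` of the category `BiComod`: a coaugmented chain coalgebra `C` and a
coaugmented chain `C`-bicomodule `N`. -/
structure BiComod (R : Type u) [CommRing R] where
  N : Type v
  C : Type v
  [addCommGroupN : AddCommGroup N]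
  [moduleN : Module R N]
  [addCommGroupC : AddCommGroup C]
  [moduleC : Module R C]
  [dgMod : DGMod R N]
  [dgCoalg : DGCoalg R C]
  [dgBicomod : DGBicomod R C N]

namespace BiComod

variable {R : Type u} [CommRing R]

instance (X : BiComod.{u, v} R) : AddCommGroup X.N := X.addCommGroupN
instance (X : BiComod.{u, v} R) : Module R X.N := X.moduleN
instance (X : BiComod.{u, v} R) : AddCommGroup X.C := X.addCommGroupC
instance (X : BiComod.{u, v} R) : Module R X.C := X.moduleC
instance (X : BiComod.{u, v} R) : DGMod R X.N := X.dgMod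
instance (X : BiComod.{u, v} R) : DGCoalg R X.C := X.dgCoalg
instance (X : BiComod.{u, v} R) : DGBicomod R X.C X.N := X.dgBicomod

/-- A morphism `(N, C) → (N', C')` in `BiComod`. -/
structure Hom (X Y : BiComod.{u, v} R) where
  coalg : CoalgHom R X.C Y.C
  bicomod : BicomodHom coalg X.N Y.N

/-- The tensor product `(N ⊗ N', C ⊗ C')`. -/
abbrev tensor (X Y : BiComod.{u, v} R) : BiComod.{u, v} R where
  N := X.N ⊗[R] Y.N
  C := X.C ⊗[R] Y.C

theorem tensorCoact_natural {X X' A B A' B' : Type*} {Z Z' E F E' F' : Type*}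
    [AddCommGroup X] [Module R X] [AddCommGroup X'] [Module R X']
    [AddCommGroup A] [Module R A] [AddCommGroup B] [Module R B] [GrMod R B]
    [AddCommGroup A'] [Module R A'] [GrMod R A'] [AddCommGroup B'] [Module R B']
    [AddCommGroup Z] [Module R Z] [AddCommGroup Z'] [Module R Z']
    [AddCommGroup E] [Module R E] [AddCommGroup F] [Module R F] [GrMod R F]
    [AddCommGroup E'] [Module R E'] [GrMod R E'] [AddCommGroup F'] [Module R F']
    {δ : X →ₗ[R] A ⊗[R] B} {δ' : X' →ₗ[R] A' ⊗[R] B'}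
    {γ : Z →ₗ[R] E ⊗[R] F} {γ' : Z' →ₗ[R] E' ⊗[R] F'}
    {k : X →ₗ[R] Z} {f : A →ₗ[R] E} {g : B →ₗ[R] F}
    {k' : X' →ₗ[R] Z'} {f' : A' →ₗ[R] E'} {g' : B' →ₗ[R] F'}
    (hg : HasDegree R 0 g) (hf' : HasDegree R 0 f')
    (h : ∀ x, γ (k x) = TensorProduct.map f g (δ x))
    (h' : ∀ x, γ' (k' x) = TensorProduct.map f' g' (δ' x)) (z : X ⊗[R] X') :
    tensorCoact γ γ' (TensorProduct.map k k' z) =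
      TensorProduct.map (TensorProduct.map f f') (TensorProduct.map g g')
        (tensorCoact δ δ' z) := by
  induction z with
  | zero => simp
  | add x y hx hy => simp only [map_add, hx, hy]
  | tmul x x' =>
    rw [TensorProduct.map_tmul, tensorCoact_tmul, tensorCoact_tmul, h, h',
      ← midSwap_natural f hg hf' g', TensorProduct.map_tmul]

/-- The tensor product of morphisms in `BiComod`. -/
def Hom.tensor {X X' Y Y' : BiComod.{u, v} R} (F : Hom X X') (G : Hom Y Y') :
    Hom (X.tensor Y) (X'.tensor Y') where
  coalg :=
    { toDGHom := F.coalg.toDGHom.tensor G.coalg.toDGHom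
      comul_lin := tensorCoact_natural F.coalg.hasDegree G.coalg.hasDegree
        F.coalg.comul_lin G.coalg.comul_lin
      counit_lin := fun z => by
        show tensorCounit R _ _ (TensorProduct.map F.coalg.lin G.coalg.lin z) =
          tensorCounit R _ _ z
        refine TensorProduct.induction_on z (by simp) ?_ ?_
        · intro c c'
          rw [TensorProduct.map_tmul, tensorCounit_tmul, tensorCounit_tmul, F.coalg.counit_lin,
            G.coalg.counit_lin]
        · intro x y hx hy; simp only [map_add, hx, hy]
      lin_one := congrArg₂ (· ⊗ₜ ·) F.coalg.lin_one G.coalg.lin_one }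
  bicomod :=
    { toDGHom := F.bicomod.toDGHom.tensor G.bicomod.toDGHom
      coactL_lin := tensorCoact_natural F.bicomod.hasDegree G.coalg.hasDegree
        F.bicomod.coactL_lin G.bicomod.coactL_lin
      coactR_lin := tensorCoact_natural F.coalg.hasDegree G.bicomod.hasDegree
        F.bicomod.coactR_lin G.bicomod.coactR_lin }

/-- The underlying module of the coHochschild complex `Ĥ(N, C)`. -/
abbrev Hhat (X : BiComod.{u, v} R) : Type (max u v) := CoHochschild R X.C X.N

/-- The map `Ĥ(N, C) → Ĥ(N', C')` induced by a morphism `(N, C) → (N', C')`. -/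
def Hom.hhat {X Y : BiComod.{u, v} R} (F : Hom X Y) : DGHom R X.Hhat Y.Hhat :=
  cohochMap F.coalg F.bicomod

end BiComod

end CoHoch

end

noncomputable section

set_option linter.unusedSectionVars false

namespace CoHoch

open GrMod DGMod DGCoalg DGBicomod

/-! ### Contractions from locally nilpotent perturbations -/

section Contraction

variable {R : Type u} [CommRing R]
variable {K L K' L' : Type*} [AddCommGroup K] [Module R K] [DGMod R K]
  [AddCommGroup L] [Module R L] [DGMod R L] [AddCommGroup K'] [Module R K'] [DGMod R K']
  [AddCommGroup L'] [Module R L'] [DGMod R L']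

/-! The map `q̂` sends `(x ⊗ x') ⊗ a` to `±(x ⊗ w) ⊗ (x' ⊗ w')`, where Milgram's map `q` sends `a`
to a sum of tensors `w ⊗ w'`. It respects the coaction terms of the differential because `q` maps
the letter `s⁻¹(c ⊗ c')` to `ε(c') (s⁻¹c ⊗ 1) + ε(c) (1 ⊗ s⁻¹c')`: in each summand one of the two
coactions is collapsed by a counit, and the other one survives (`cohochMilgram_comm`). Compatibility
with the inclusions and projections is then read off the formula. What remains is to invert `q̂` up
to natural homotopy over an arbitrary ring, without connectivity or flatness.

Every letter of `Ω (C ⊗ C')` splits into a left part `s⁻¹(c ⊗ 1)`, a right part `s⁻¹(1 ⊗ c')` and a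
mixed part `s⁻¹(c̄ ⊗ c̄')`. Give a word as weight its number of unmixed letters. The differential
raises the weight by at most two, and its part of weight two is the derivation `commD`, which sends
a mixed letter to the graded commutator, up to sign, of the corresponding left and right letters
(`cobarD_sub_commD_weight`). With `commD` alone as differential, the mixed letters resolve the
relation that left and right letters commute, and the quotient by that relation is `Ω C ⊗ Ω C'`. Its
elements have the normal form "left letters first", which is the linear section `milgramSection` of
`q`.

This resolution is contracted explicitly. The map `cobarHomotopy` reads a word from the left. When
it meets a right letter, it moves that letter past the left letters of the normal form of the rest
of the word, and records each exchange by a mixed letter. The result is `commD h + h commD = 1 - s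
q` (`cobarHomotopy_comm`), and `h` lowers the weight by two.

For the full coHochschild differential the terms other than `commD` raise the weight by at most one.
Hence `1 - d h - h d - s q̂` lowers the weight (`cohochHomotopy_defect`). Weights are nonnegative
and every element has finite weight, so `1 - d h - h d` is locally nilpotent on the kernel of `q̂`.
The series `H = ∑ (1 - d h - h d)^i h` is therefore a finite sum on each element. The chain map `1 -
d H - H d` kills the kernel of `q̂`, so it factors through `q̂`, and composing it with `s` yields a
chain map `ŝ` with `q̂ ŝ = 1` strictly and with `H` as homotopy from `ŝ q̂` to the identity. All
ingredients are given by formulas in the units, counits and signs, hence commute with morphisms, and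
so do the finite sums. -/

/-- A chain map `q : K → L` with a linear section `s` and a map `h` of degree `1` into the kernel
of `q`, such that `1 - d h - h d` is locally nilpotent on the kernel of `q`. -/
structure PreContraction (R : Type u) [CommRing R] (K L : Type*) [AddCommGroup K] [Module R K]
    [DGMod R K] [AddCommGroup L] [Module R L] [DGMod R L] where
  q : DGHom R K L
  s : L →ₗ[R] K
  h : K →ₗ[R] K
  s_mem : ∀ n, ∀ y ∈ gr R L n, s y ∈ gr R K n
  h_mem : ∀ n, ∀ z ∈ gr R K n, h z ∈ gr R K (n + 1)
  q_s : ∀ y, q.lin (s y) = y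
  q_h : ∀ z, q.lin (h z) = 0
  nil : ∀ z, q.lin z = 0 →
    ∃ n : ℕ, ((LinearMap.id - d R ∘ₗ h - h ∘ₗ d R : Module.End R K) ^ n) z = 0

/-! ### Summing the perturbation series. -/

namespace PreContraction

variable (P : PreContraction R K L)

/-- The chain endomorphism `1 - d h - h d`. -/
def defect : Module.End R K := LinearMap.id - d R ∘ₗ P.h - P.h ∘ₗ d R

theorem defect_apply (z : K) : P.defect z = z - d R (P.h z) - P.h (d R z) := rfl

theorem d_defect (z : K) : d R (P.defect z) = P.defect (d R z) := by
  simp [defect_apply, d_d]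

theorem d_defect_pow (n : ℕ) (z : K) : d R ((P.defect ^ n) z) = (P.defect ^ n) (d R z) := by
  induction n with
  | zero => rfl
  | succ n ih => rw [pow_succ', Module.End.mul_apply, Module.End.mul_apply, d_defect, ih]

theorem q_defect (z : K) : P.q.lin (P.defect z) = P.q.lin z := by
  simp [defect_apply, P.q_h, ← P.q.comm]

theorem q_defect_pow (n : ℕ) (z : K) : P.q.lin ((P.defect ^ n) z) = P.q.lin z := by
  induction n with
  | zero => rfl
  | succ n ih => rw [pow_succ', Module.End.mul_apply, q_defect, ih]

theorem defect_pow_mem (i : ℕ) (n : ℤ) (z : K) (hz : z ∈ gr R K n) :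
    (P.defect ^ i) z ∈ gr R K n := by
  induction i with
  | zero => exact hz
  | succ i ih =>
    rw [pow_succ', Module.End.mul_apply, defect_apply]
    refine sub_mem (sub_mem ih ?_) ?_
    · have := d_mem _ _ (P.h_mem n _ ih)
      rwa [add_sub_cancel_right] at this
    · have := P.h_mem _ _ (d_mem _ _ ih)
      rwa [sub_add_cancel] at this

theorem defect_pow_eq_zero_of_le {m n : ℕ} (hmn : m ≤ n) {z : K} (h : (P.defect ^ m) z = 0) :
    (P.defect ^ n) z = 0 := by
  obtain ⟨k, rfl⟩ := Nat.exists_eq_add_of_le' hmn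
  rw [pow_add, Module.End.mul_apply, h, map_zero]

theorem exists_defect_pow (z : K) (hz : P.q.lin z = 0) : ∃ n, (P.defect ^ n) z = 0 := P.nil z hz

/-- The map `h` takes values in the kernel of `q`, where the defect is locally nilpotent, so only
finitely many terms of the series survive. -/
theorem support_finite (z : K) : (Function.support fun i : ℕ => (P.defect ^ i) (P.h z)).Finite := by
  obtain ⟨n, hn⟩ := P.exists_defect_pow (P.h z) (P.q_h z)
  refine (Set.finite_lt_nat n).subset fun i hi => ?_
  by_contra hin
  exact hi (P.defect_pow_eq_zero_of_le (not_lt.1 hin) hn)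

/-- The homotopy `∑ i, (1 - d h - h d) ^ i h`. -/
def homotopy : K →ₗ[R] K where
  toFun z := ∑ᶠ i : ℕ, (P.defect ^ i) (P.h z)
  map_add' x y := by
    simp only [map_add]
    exact finsum_add_distrib (P.support_finite x) (P.support_finite y)
  map_smul' r x := by
    simp only [map_smul, RingHom.id_apply]
    rw [smul_finsum' r (P.support_finite x)]

/-- Any exponent that kills `h z` serves as a cut-off, so several values of the homotopy can be
truncated at one common bound. -/
theorem homotopy_eq_sum {z : K} {n : ℕ} (hn : (P.defect ^ n) (P.h z) = 0) :
    P.homotopy z = ∑ i ∈ Finset.range n, (P.defect ^ i) (P.h z) := by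
  refine finsum_eq_sum_of_support_subset _ fun i hi => ?_
  rw [Finset.coe_range, Set.mem_Iio]
  by_contra hin
  exact hi (P.defect_pow_eq_zero_of_le (not_lt.1 hin) hn)

theorem homotopy_mem (n : ℤ) (z : K) (hz : z ∈ gr R K n) : P.homotopy z ∈ gr R K (n + 1) := by
  obtain ⟨m, hm⟩ := P.exists_defect_pow (P.h z) (P.q_h z)
  rw [P.homotopy_eq_sum hm]
  exact sum_mem fun i _ => P.defect_pow_mem i _ _ (P.h_mem n z hz)

theorem q_homotopy (z : K) : P.q.lin (P.homotopy z) = 0 := by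
  obtain ⟨m, hm⟩ := P.exists_defect_pow (P.h z) (P.q_h z)
  rw [P.homotopy_eq_sum hm, map_sum]
  exact Finset.sum_eq_zero fun i _ => by rw [q_defect_pow, P.q_h]

/-- The limit of the powers of `1 - d h - h d`. -/
def limit : Module.End R K := LinearMap.id - d R ∘ₗ P.homotopy - P.homotopy ∘ₗ d R

theorem limit_apply (z : K) : P.limit z = z - d R (P.homotopy z) - P.homotopy (d R z) := rfl

theorem d_limit (z : K) : d R (P.limit z) = P.limit (d R z) := by
  simp [limit_apply, d_d]

theorem q_limit (z : K) : P.q.lin (P.limit z) = P.q.lin z := by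
  simp [limit_apply, P.q_homotopy, ← P.q.comm]

theorem limit_mem (n : ℤ) (z : K) (hz : z ∈ gr R K n) : P.limit z ∈ gr R K n := by
  refine sub_mem (sub_mem hz ?_) ?_
  · have := d_mem _ _ (P.homotopy_mem n _ hz)
    rwa [add_sub_cancel_right] at this
  · have := P.homotopy_mem _ _ (d_mem _ _ hz)
    rwa [sub_add_cancel] at this

/-- Telescoping: the defect `D` commutes with `d`, and `d h + h d = 1 - D`. Truncating the series at
`m` therefore leaves `1 - ∑_{i<m} D^i (1 - D) = D^m`. One bound has to serve both `h z` and `h (d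
z)`. -/
theorem limit_eq_pow (z : K) : ∃ n, ∀ m, n ≤ m → P.limit z = (P.defect ^ m) z := by
  obtain ⟨n₁, h₁⟩ := P.exists_defect_pow (P.h z) (P.q_h z)
  obtain ⟨n₂, h₂⟩ := P.exists_defect_pow (P.h (d R z)) (P.q_h _)
  refine ⟨max n₁ n₂, fun m hm => ?_⟩
  rw [limit_apply,
    P.homotopy_eq_sum (P.defect_pow_eq_zero_of_le ((le_max_left _ _).trans hm) h₁),
    P.homotopy_eq_sum (P.defect_pow_eq_zero_of_le ((le_max_right _ _).trans hm) h₂)]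
  -- For truncated sums the identity holds at every `m`; the bound was needed only to truncate.
  clear hm
  induction m with
  | zero => simp
  | succ m ih =>
    rw [Finset.sum_range_succ, Finset.sum_range_succ, map_add, d_defect_pow, pow_succ,
      Module.End.mul_apply, defect_apply, map_sub, map_sub, ← ih]
    abel

theorem limit_eq_zero {z : K} (hz : P.q.lin z = 0) : P.limit z = 0 := by
  obtain ⟨n, hn⟩ := P.limit_eq_pow z
  obtain ⟨m, hm⟩ := P.exists_defect_pow z hz
  rw [hn _ (le_max_left n m), P.defect_pow_eq_zero_of_le (le_max_right n m) hm]

/-- Although `s` is merely linear, `s (q z)` and `z` differ by an element of the kernel of `q`,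
which the limit kills. So the limit factors through `q`. -/
theorem limit_s_q (z : K) : P.limit (P.s (P.q.lin z)) = P.limit z := by
  rw [← sub_eq_zero, ← map_sub]
  exact P.limit_eq_zero (by rw [map_sub, P.q_s, sub_self])

/-- The homotopy inverse of `q`. -/
def inv : DGHom R L K where
  lin := P.limit ∘ₗ P.s
  mem n y hy := P.limit_mem n _ (P.s_mem n y hy)
  comm y := by
    simp only [LinearMap.comp_apply]
    -- Inserting `s q` after the limit repairs the failure of `s` to commute with `d`: `q (d (s y))
    -- = d (q (s y)) = d y`.
    rw [d_limit, ← P.limit_s_q (d R (P.s y)), ← P.q.comm, P.q_s]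

theorem inv_lin : P.inv.lin = P.limit ∘ₗ P.s := rfl

/-- The homotopy from `inv ∘ q` to the identity. -/
def invCompHomotopy : DGHomotopy (P.inv.comp P.q) (DGHom.id R K) where
  lin := P.homotopy
  mem := P.homotopy_mem
  comm z := by
    show _ = z - P.limit (P.s (P.q.lin z))
    rw [limit_s_q, limit_apply]; abel

theorem q_inv (y : L) : P.q.lin (P.inv.lin y) = y := by
  rw [inv_lin, LinearMap.comp_apply, q_limit, P.q_s]

/-- The zero homotopy from `q ∘ inv` to the identity. -/
def compInvHomotopy : DGHomotopy (P.q.comp P.inv) (DGHom.id R L) where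
  lin := 0
  mem n x _ := zero_mem _
  comm y := by
    show (d R ((0 : L →ₗ[R] L) y) + (0 : L →ₗ[R] L) (d R y)) = y - P.q.lin (P.inv.lin y)
    rw [q_inv]; simp

/-! ### Naturality of the perturbed data. -/

section Naturality

variable {P} {P' : PreContraction R K' L'} {f : DGHom R K K'} {g : DGHom R L L'}

theorem defect_natural (hh : ∀ z, P'.h (f.lin z) = f.lin (P.h z)) (z : K) :
    P'.defect (f.lin z) = f.lin (P.defect z) := by
  simp only [defect_apply, map_sub, hh, f.comm]

theorem defect_pow_natural (hh : ∀ z, P'.h (f.lin z) = f.lin (P.h z)) (n : ℕ) (z : K) :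
    (P'.defect ^ n) (f.lin z) = f.lin ((P.defect ^ n) z) := by
  induction n with
  | zero => rfl
  | succ n ih =>
    rw [pow_succ', pow_succ', Module.End.mul_apply, Module.End.mul_apply, ih, defect_natural hh]

/-- A morphism that intertwines the maps `h` intertwines the defects, so a cut-off for `z` is also
one for its image, and the finite sums agree term by term. -/
theorem homotopy_natural (hh : ∀ z, P'.h (f.lin z) = f.lin (P.h z)) (z : K) :
    P'.homotopy (f.lin z) = f.lin (P.homotopy z) := by
  obtain ⟨m, hm⟩ := P.exists_defect_pow (P.h z) (P.q_h z)
  rw [P.homotopy_eq_sum hm, map_sum, P'.homotopy_eq_sum (n := m)]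
  · exact Finset.sum_congr rfl fun i _ => by rw [hh, defect_pow_natural hh]
  · rw [hh, defect_pow_natural hh, hm, map_zero]

theorem inv_natural (hh : ∀ z, P'.h (f.lin z) = f.lin (P.h z))
    (hs : ∀ y, P'.s (g.lin y) = f.lin (P.s y)) (y : L) :
    P'.inv.lin (g.lin y) = f.lin (P.inv.lin y) := by
  simp only [inv_lin, LinearMap.comp_apply, hs, limit_apply, homotopy_natural hh, f.comm, map_sub]

end Naturality

/-- Local nilpotency from an exhaustive filtration on which `1 - d h - h d` differs from `s q` by
a map lowering the filtration. -/
theorem nil_of_filtration {q : DGHom R K L} {s : L →ₗ[R] K} {h : K →ₗ[R] K}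
    (G : ℤ → Submodule R K) (hG : ∀ z, ∃ r, z ∈ G r) (hneg : ∀ r < 0, ∀ z ∈ G r, z = 0)
    (hq : ∀ z, q.lin (h z) = 0)
    (hu : ∀ r, ∀ z ∈ G r, z - d R (h z) - h (d R z) - s (q.lin z) ∈ G (r - 1)) (z : K)
    (hz : q.lin z = 0) :
    ∃ n : ℕ, ((LinearMap.id - d R ∘ₗ h - h ∘ₗ d R : Module.End R K) ^ n) z = 0 := by
  -- On the kernel of `q` the term `s q` drops out, so each application of the operator lowers the
  -- filtration by one. The kernel is preserved because `q h = 0` and `q` commutes with `d`.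
  have key : ∀ n : ℕ, ∀ r, ∀ z ∈ G r, q.lin z = 0 →
      ((LinearMap.id - d R ∘ₗ h - h ∘ₗ d R : Module.End R K) ^ n) z ∈ G (r - n) := by
    intro n
    induction n with
    | zero => intro r z h _; simpa using h
    | succ n ih =>
      intro r z h1 h0
      have h2 := hu r z h1
      rw [h0, map_zero, sub_zero] at h2
      have h3 := ih _ _ h2 (by simp [hq, h0, ← q.comm])
      rw [pow_succ, Module.End.mul_apply]
      rwa [show r - ((n + 1 : ℕ) : ℤ) = r - 1 - n by push_cast; ring]
  obtain ⟨r, hr⟩ := hG z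
  -- After `(r + 1).toNat` steps the index is at most `r - (r + 1) = -1`, where the filtration
  -- vanishes; `toNat` also covers a negative `r`.
  exact ⟨(r + 1).toNat, hneg _ (by have := Int.self_le_toNat (r + 1); omega) _
    (key (r + 1).toNat r z hr hz)⟩

end PreContraction

end Contraction

/-! ### The filtration of a tensor algebra by the number of letters outside a submodule -/

section Weight

variable {R : Type u} [CommRing R]
variable {W : Type*} [AddCommGroup W] [Module R W]

open TensorAlgebra (ι)

/-- `HasWeight U r a`: `a` is a linear combination of words having at most `r` letters
outside `U`. -/
inductive HasWeight (U : Submodule R W) : ℤ → TensorAlgebra R W → Prop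
  | zero (r : ℤ) : HasWeight U r 0
  | one {r : ℤ} (hr : 0 ≤ r) : HasWeight U r 1
  | add {r : ℤ} {a b : TensorAlgebra R W} : HasWeight U r a → HasWeight U r b →
      HasWeight U r (a + b)
  | smul {r : ℤ} (x : R) {a : TensorAlgebra R W} : HasWeight U r a → HasWeight U r (x • a)
  | letter {r : ℤ} (w : W) {a : TensorAlgebra R W} : HasWeight U r a →
      HasWeight U (r + 1) (ι R w * a)
  | light {r : ℤ} {w : W} (hw : w ∈ U) {a : TensorAlgebra R W} : HasWeight U r a →
      HasWeight U r (ι R w * a)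

/-- The submodule of combinations of words having at most `r` letters outside `U`. -/
def weightLE (U : Submodule R W) (r : ℤ) : Submodule R (TensorAlgebra R W) where
  carrier := {a | HasWeight U r a}
  add_mem' := .add
  zero_mem' := .zero r
  smul_mem' x _ := .smul x

variable {U : Submodule R W}

theorem weightLE_one {r : ℤ} (hr : 0 ≤ r) : (1 : TensorAlgebra R W) ∈ weightLE U r := .one hr

theorem weightLE_mono {r s : ℤ} (hrs : r ≤ s) {a : TensorAlgebra R W} (ha : a ∈ weightLE U r) :
    a ∈ weightLE U s := by
  have ha' : HasWeight U r a := ha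
  show HasWeight U s a
  clear ha
  induction ha' generalizing s with
  | zero => exact .zero s
  | one hr => exact .one (hr.trans hrs)
  | add _ _ ha hb => exact .add (ha hrs) (hb hrs)
  | smul x _ ha => exact .smul x (ha hrs)
  | letter w _ ha => simpa using HasWeight.letter w (ha (s := s - 1) (by omega))
  | light hw _ ha => exact .light hw (ha hrs)

/-- Apart from `zero`, words start from `one`, which requires `0 ≤ r`, and adding letters never
lowers the bound. -/
theorem weightLE_neg {r : ℤ} (hr : r < 0) {a : TensorAlgebra R W} (ha : a ∈ weightLE U r) :
    a = 0 := by
  have ha' : HasWeight U r a := ha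
  clear ha
  induction ha' with
  | zero => rfl
  | one h => omega
  | add _ _ ha hb => rw [ha hr, hb hr, add_zero]
  | smul x _ ha => rw [ha hr, smul_zero]
  | letter w _ ha => rw [ha (by omega), mul_zero]
  | light hw _ ha => rw [ha hr, mul_zero]

theorem weightLE_mul {r s : ℤ} {a b : TensorAlgebra R W} (ha : a ∈ weightLE U r)
    (hb : b ∈ weightLE U s) : a * b ∈ weightLE U (r + s) := by
  have ha' : HasWeight U r a := ha
  clear ha
  induction ha' with
  | zero => rw [zero_mul]; exact zero_mem _
  | one h => rw [one_mul]; exact weightLE_mono (by omega) hb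
  | add _ _ ha ha' => rw [add_mul]; exact add_mem ha ha'
  | smul x _ ha => rw [smul_mul_assoc]; exact Submodule.smul_mem _ x ha
  | letter w _ ha =>
    rw [mul_assoc, add_right_comm]; exact HasWeight.letter w ha
  | light hw _ ha => rw [mul_assoc]; exact HasWeight.light hw ha

theorem weightLE_ι (w : W) : ι R w ∈ weightLE U 1 := by
  have : HasWeight U (0 + 1) (ι R w * 1) := .letter w (.one le_rfl)
  rwa [mul_one, zero_add] at this

theorem exists_weightLE (U : Submodule R W) (a : TensorAlgebra R W) : ∃ r, a ∈ weightLE U r := by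
  induction a using TensorAlgebra.induction with
  | algebraMap r =>
    exact ⟨0, by rw [Algebra.algebraMap_eq_smul_one]; exact Submodule.smul_mem _ _ (.one le_rfl)⟩
  | ι w => exact ⟨1, weightLE_ι w⟩
  | mul a b ha hb =>
    obtain ⟨r, hr⟩ := ha
    obtain ⟨s, hs⟩ := hb
    exact ⟨r + s, weightLE_mul hr hs⟩
  | add a b ha hb =>
    obtain ⟨r, hr⟩ := ha
    obtain ⟨s, hs⟩ := hb
    exact ⟨max r s, add_mem (weightLE_mono (le_max_left _ _) hr)
      (weightLE_mono (le_max_right _ _) hs)⟩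

theorem weightLE_induction {p : ℤ → TensorAlgebra R W → Prop} (h0 : ∀ r, p r 0)
    (h1 : ∀ r, 0 ≤ r → p r 1) (hadd : ∀ r a b, p r a → p r b → p r (a + b))
    (hsmul : ∀ r (x : R) a, p r a → p r (x • a))
    (hletter : ∀ r w, ∀ a ∈ weightLE U r, p r a → p (r + 1) (ι R w * a))
    (hlight : ∀ r, ∀ w ∈ U, ∀ a ∈ weightLE U r, p r a → p r (ι R w * a))
    {r : ℤ} {a : TensorAlgebra R W} (ha : a ∈ weightLE U r) : p r a := by
  have ha' : HasWeight U r a := ha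
  clear ha
  induction ha' with
  | zero => exact h0 _
  | one h => exact h1 _ h
  | add _ _ ha hb => exact hadd _ _ _ ha hb
  | smul x _ ha => exact hsmul _ x _ ha
  | letter w h ha => exact hletter _ w _ h ha
  | light hw h ha => exact hlight _ _ hw _ h ha

theorem weightLE_sgn [GrMod R W] (k : ℤ) (hU : ∀ w ∈ U, sgn R k w ∈ U) {r : ℤ}
    {a : TensorAlgebra R W} (ha : a ∈ weightLE U r) : sgn R k a ∈ weightLE U r := by
  refine weightLE_induction (p := fun r a => sgn R k a ∈ weightLE U r) ?_ ?_ ?_ ?_ ?_ ?_ ha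
  · intro r; rw [map_zero]; exact zero_mem _
  · intro r hr; rw [sgn_talg_one]; exact weightLE_one hr
  · intro r a b ha hb; rw [map_add]; exact add_mem ha hb
  · intro r x a ha; rw [map_smul]; exact Submodule.smul_mem _ _ ha
  · intro r w a _ ha; rw [sgn_talg_mul, sgn_ι]; exact HasWeight.letter _ ha
  · intro r w hw a _ ha; rw [sgn_talg_mul, sgn_ι]; exact HasWeight.light (hU w hw) ha

end Weight

/-! ### Letters of the cobar construction of a tensor product -/

section Letters

variable (R : Type u) [CommRing R]
variable (C : Type*) [AddCommGroup C] [Module R C] [DGCoalg R C]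
variable (C' : Type*) [AddCommGroup C'] [Module R C'] [DGCoalg R C']

/-- `c ⊗ c' ↦ ε(c') c` -/
def projL : C ⊗[R] C' →ₗ[R] C := (TensorProduct.rid R C).toLinearMap ∘ₗ (counit R).lTensor C

/-- `c ⊗ c' ↦ ε(c) c'` -/
def projR : C ⊗[R] C' →ₗ[R] C' := (TensorProduct.lid R C').toLinearMap ∘ₗ (counit R).rTensor C'

/-- `c ↦ s⁻¹(c ⊗ 1)` -/
def letterL : C →ₗ[R] Cobar R (C ⊗[R] C') :=
  univTw R ∘ₗ (TensorProduct.mk R C C').flip (one R C')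

/-- `c' ↦ s⁻¹(1 ⊗ c')` -/
def letterR : C' →ₗ[R] Cobar R (C ⊗[R] C') := univTw R ∘ₗ TensorProduct.mk R C C' (one R C)

/-- `c ⊗ c' ↦ s⁻¹(c̄ ⊗ c̄')`, where `c̄ = c - ε(c) 1`. -/
def letterM : C ⊗[R] C' →ₗ[R] Cobar R (C ⊗[R] C') :=
  univTw R - letterL R C C' ∘ₗ projL R C C' - letterR R C C' ∘ₗ projR R C C'

/-- The submodule of mixed letters `s⁻¹(c̄ ⊗ c̄')`. -/
def mixed : Submodule R (DesuspCoideal R (C ⊗[R] C')) :=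
  LinearMap.ker (projL R C C' ∘ₗ desuspIncl R _) ⊓ LinearMap.ker (projR R C C' ∘ₗ desuspIncl R _)

variable {R C C'}

@[simp] theorem projL_tmul (c : C) (c' : C') : projL R C C' (c ⊗ₜ c') = counit R c' • c := by
  simp [projL]

@[simp] theorem projR_tmul (c : C) (c' : C') : projR R C C' (c ⊗ₜ c') = counit R c • c' := by
  simp [projR]

theorem letterL_apply (c : C) : letterL R C C' c = univTw R (c ⊗ₜ one R C') := rfl

theorem letterR_apply (c' : C') : letterR R C C' c' = univTw R (one R C ⊗ₜ c') := rfl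

theorem letterL_one : letterL R C C' (one R C) = 0 := univTw_one R

theorem letterR_one : letterR R C C' (one R C') = 0 := univTw_one R

theorem letterM_apply (z : C ⊗[R] C') : letterM R C C' z =
    univTw R z - letterL R C C' (projL R C C' z) - letterR R C C' (projR R C C' z) := rfl

/-- This splitting into mixed, left and right letters is what allows arguments about `Ω (C ⊗ C')` to
proceed by the type of the first letter. -/
theorem univTw_eq_letters (z : C ⊗[R] C') : univTw R z =
    letterM R C C' z + letterL R C C' (projL R C C' z) + letterR R C C' (projR R C C' z) := by
  rw [letterM_apply]; abel

theorem letterM_tmul_one (c : C) : letterM R C C' (c ⊗ₜ one R C') = 0 := by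
  rw [letterM_apply, projL_tmul, projR_tmul, DGCoalg.counit_one, one_smul, map_smul, letterR_one,
    letterL_apply]; simp

theorem hasDegree_projL : HasDegree R 0 (projL R C C') :=
  hasDegree_tensor fun i c hc j c' hc' => by
    rw [projL_tmul]
    by_cases hj : j = 0
    · subst hj; simpa using Submodule.smul_mem _ _ hc
    · rw [counit_of_ne j hj c' hc', zero_smul]; exact zero_mem _

theorem hasDegree_projR : HasDegree R 0 (projR R C C') :=
  hasDegree_tensor fun i c hc j c' hc' => by
    rw [projR_tmul]
    by_cases hi : i = 0
    · subst hi; simpa using Submodule.smul_mem _ _ hc'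
    · rw [counit_of_ne i hi c hc, zero_smul]; exact zero_mem _

theorem hasDegree_letterL : HasDegree R (-1) (letterL R C C') := fun n _ hc =>
  hasDegree_univTw R n _ (tmul_mem' hc DGCoalg.one_mem (add_zero n))

theorem hasDegree_letterR : HasDegree R (-1) (letterR R C C') := fun n _ hc =>
  hasDegree_univTw R n _ (tmul_mem' DGCoalg.one_mem hc (zero_add n))

theorem hasDegree_letterM : HasDegree R (-1) (letterM R C C') := fun n z hz => by
  refine sub_mem (sub_mem (hasDegree_univTw R n _ hz) ?_) ?_
  · have := hasDegree_letterL (C' := C') _ _ (hasDegree_projL n z hz)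
    rwa [add_zero] at this
  · have := hasDegree_letterR (C := C) _ _ (hasDegree_projR n z hz)
    rwa [add_zero] at this

theorem projL_sgn (k : ℤ) (z : C ⊗[R] C') :
    projL R C C' (sgn R k z) = sgn R k (projL R C C' z) := by
  rw [hasDegree_projL.sgn_comm]; simp

theorem projR_sgn (k : ℤ) (z : C ⊗[R] C') :
    projR R C C' (sgn R k z) = sgn R k (projR R C C' z) := by
  rw [hasDegree_projR.sgn_comm]; simp

theorem counit_projR (z : C ⊗[R] C') : counit R (projR R C C' z) = counit R z := by
  induction z with
  | zero => simp
  | add x y hx hy => simp only [map_add, hx, hy]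
  | tmul c c' => rw [projR_tmul, map_smul, smul_eq_mul]; exact (tensorCounit_tmul c c').symm

theorem counit_projL (z : C ⊗[R] C') : counit R (projL R C C' z) = counit R z := by
  induction z with
  | zero => simp
  | add x y hx hy => simp only [map_add, hx, hy]
  | tmul c c' =>
    rw [projL_tmul, map_smul, smul_eq_mul, mul_comm]; exact (tensorCounit_tmul c c').symm

/-- `letterM` is defined as a difference of letters; it has to be recognised as a single letter
lying in `mixed`, so that prepending it does not change the weight. -/
theorem letterM_eq_ι (z : C ⊗[R] C') :
    ∃ w ∈ mixed R C C', letterM R C C' z = TensorAlgebra.ι R w := by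
  have hLL : ∀ c : C, projL R C C' (c ⊗ₜ one R C') = c := fun c => by
    rw [projL_tmul, DGCoalg.counit_one, one_smul]
  have hRR : ∀ c : C', projR R C C' (one R C ⊗ₜ c) = c := fun c => by
    rw [projR_tmul, DGCoalg.counit_one, one_smul]
  -- The representative is `(1 - ηε) ⊗ (1 - ηε)` applied to `z`, with `η` the coaugmentation. The
  -- last summand makes both projections vanish, and `univTw` does not see it because it is a
  -- multiple of the unit.
  refine ⟨desusp R (z - projL R C C' z ⊗ₜ one R C' - one R C ⊗ₜ projR R C C' z +
    counit R z • one R C ⊗ₜ one R C'), ?_, ?_⟩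
  · have h0 : counit R (z - projL R C C' z ⊗ₜ one R C' - one R C ⊗ₜ projR R C C' z +
        counit R z • one R C ⊗ₜ one R C') = 0 := by
      have h1 : ∀ (c : C) (c' : C'), counit R (c ⊗ₜ[R] c') = counit R c * counit R c' :=
        tensorCounit_tmul
      rw [map_add, map_sub, map_sub, map_smul, h1, h1, h1, counit_projL, counit_projR,
        DGCoalg.counit_one, DGCoalg.counit_one]
      simp
    rw [mixed, Submodule.mem_inf, LinearMap.mem_ker, LinearMap.mem_ker, LinearMap.comp_apply,
      LinearMap.comp_apply, desuspIncl_desusp, h0, zero_smul, sub_zero]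
    constructor
    · simp only [map_add, map_sub, map_smul, projL_tmul, DGCoalg.counit_one, counit_projR]
      simp
    · simp only [map_add, map_sub, map_smul, projR_tmul, DGCoalg.counit_one, counit_projL]
      simp
  · show _ = univTw R _
    rw [map_add, map_smul]
    show _ = _ + counit R z • univTw R (one R (C ⊗[R] C'))
    rw [univTw_one, smul_zero, add_zero, map_sub, map_sub]; rfl

theorem letterM_mul_mem {r : ℤ} (z : C ⊗[R] C') {a : Cobar R (C ⊗[R] C')}
    (ha : a ∈ weightLE (mixed R C C') r) : letterM R C C' z * a ∈ weightLE (mixed R C C') r := by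
  obtain ⟨w, hw, h⟩ := letterM_eq_ι z
  rw [h]; exact HasWeight.light hw ha

theorem univTw_mem_weightLE {D : Type*} [AddCommGroup D] [Module R D] [DGCoalg R D]
    {U : Submodule R (DesuspCoideal R D)} (z : D) : univTw R z ∈ weightLE U 1 := weightLE_ι _

theorem univTw_mul_mem {D : Type*} [AddCommGroup D] [Module R D] [DGCoalg R D]
    {U : Submodule R (DesuspCoideal R D)} {r : ℤ} (z : D) {a : Cobar R D}
    (ha : a ∈ weightLE U r) : univTw R z * a ∈ weightLE U (r + 1) := HasWeight.letter _ ha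

/-- Induction over the three types of first letter. The entries are homogeneous, so that the sign
operators can be evaluated. -/
theorem cobar_tensor_induction {p : Cobar R (C ⊗[R] C') → Prop} (h1 : p 1)
    (hadd : ∀ a b, p a → p b → p (a + b)) (hsmul : ∀ (r : R) a, p a → p (r • a))
    (hL : ∀ i, ∀ c ∈ gr R C i, ∀ a, p a → p (letterL R C C' c * a))
    (hR : ∀ j, ∀ c ∈ gr R C' j, ∀ a, p a → p (letterR R C C' c * a))
    (hM : ∀ i, ∀ c ∈ gr R C i, ∀ j, ∀ c' ∈ gr R C' j, ∀ a, p a →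
      p (letterM R C C' (c ⊗ₜ c') * a)) (a : Cobar R (C ⊗[R] C')) : p a := by
  have h0 : p 0 := by simpa using hsmul 0 1 h1
  refine talg_induction h1 hadd hsmul (fun i w _ a ha => ?_) a
  rw [ι_eq_univTw, univTw_eq_letters, add_mul, add_mul]
  refine hadd _ _ (hadd _ _ ?_ ?_) ?_
  · generalize desuspIncl R _ w = z
    induction z with
    | zero => rw [map_zero, zero_mul]; exact h0
    | add x y hx hy => rw [map_add, add_mul]; exact hadd _ _ hx hy
    | tmul c c' =>
      refine gr_induction (R := R) (p := fun c => p (letterM R C C' (c ⊗ₜ c') * a)) ?_ ?_ c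
      · intro x y hx hy; rw [TensorProduct.add_tmul, map_add, add_mul]; exact hadd _ _ hx hy
      · intro i c hc
        refine gr_induction (R := R) (p := fun c' => p (letterM R C C' (c ⊗ₜ c') * a)) ?_ ?_ c'
        · intro x y hx hy; rw [TensorProduct.tmul_add, map_add, add_mul]; exact hadd _ _ hx hy
        · intro j c' hc'; exact hM i c hc j c' hc' a ha
  · refine gr_induction (R := R) (p := fun c => p (letterL R C C' c * a)) ?_
      (fun i c hc => hL i c hc a ha) _
    intro x y hx hy; rw [map_add, add_mul]; exact hadd _ _ hx hy
  · refine gr_induction (R := R) (p := fun c => p (letterR R C C' c * a)) ?_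
      (fun i c hc => hR i c hc a ha) _
    intro x y hx hy; rw [map_add, add_mul]; exact hadd _ _ hx hy

theorem cobar_induction {D : Type*} [AddCommGroup D] [Module R D] [DGCoalg R D]
    {p : Cobar R D → Prop} (h1 : p 1)
    (hadd : ∀ a b, p a → p b → p (a + b)) (hsmul : ∀ (r : R) a, p a → p (r • a))
    (hmul : ∀ i, ∀ c ∈ gr R D i, ∀ a, p a → p (univTw R c * a)) (a : Cobar R D) : p a :=
  talg_induction h1 hadd hsmul (fun i w hw a ha => by
    rw [ι_eq_univTw]; exact hmul (i + 1) _ hw a ha) a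

/-! ### Milgram's map and its section -/

variable (R C C')

/-- The algebra map `Ω C → Ω (C ⊗ C')`, `s⁻¹c ↦ s⁻¹(c ⊗ 1)`. -/
def cobarInl : Cobar R C →ₐ[R] Cobar R (C ⊗[R] C') :=
  TensorAlgebra.lift R (letterL R C C' ∘ₗ desuspIncl R C)

/-- The algebra map `Ω C' → Ω (C ⊗ C')`, `s⁻¹c' ↦ s⁻¹(1 ⊗ c')`. -/
def cobarInr : Cobar R C' →ₐ[R] Cobar R (C ⊗[R] C') :=
  TensorAlgebra.lift R (letterR R C C' ∘ₗ desuspIncl R C')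

/-- The section `Ω C ⊗ Ω C' → Ω (C ⊗ C')` of Milgram's map. -/
def milgramSection : Cobar R C ⊗[R] Cobar R C' →ₗ[R] Cobar R (C ⊗[R] C') :=
  LinearMap.mul' R _ ∘ₗ
    TensorProduct.map (cobarInl R C C').toLinearMap (cobarInr R C C').toLinearMap

variable {R C C'}

/-- `univTw` replaces `c` by `c - ε(c) 1`, and a linear map that vanishes on the unit does not
notice the correction. -/
theorem lift_desuspIncl_univTw {D : Type*} [AddCommGroup D] [Module R D] [DGCoalg R D]
    {B : Type*} [Semiring B] [Algebra R B] (f : D →ₗ[R] B) (hf : f (one R D) = 0) (c : D) :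
    TensorAlgebra.lift R (f ∘ₗ desuspIncl R D) (univTw R c) = f c := by
  rw [univTw, LinearMap.comp_apply, TensorAlgebra.lift_ι_apply, LinearMap.comp_apply,
    desuspIncl_desusp, sub_eq_add_neg, map_add, ← neg_smul, map_smul, hf, smul_zero, add_zero]

theorem cobarInl_univTw (c : C) : cobarInl R C C' (univTw R c) = letterL R C C' c :=
  lift_desuspIncl_univTw _ letterL_one c

theorem cobarInr_univTw (c : C') : cobarInr R C C' (univTw R c) = letterR R C C' c :=
  lift_desuspIncl_univTw _ letterR_one c

theorem milgramSection_tmul (a : Cobar R C) (b : Cobar R C') :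
    milgramSection R C C' (a ⊗ₜ b) = cobarInl R C C' a * cobarInr R C C' b := rfl

theorem milgramGen_one_right (c : C) :
    milgramGen R C C' (c ⊗ₜ one R C') = univTw R c ⊗ₜ 1 := by
  rw [milgramGen_tmul, DGCoalg.counit_one, one_smul, univTw_one, TensorProduct.tmul_zero, add_zero]

theorem milgramGen_one_left (c : C') :
    milgramGen R C C' (one R C ⊗ₜ c) = 1 ⊗ₜ univTw R c := by
  rw [milgramGen_tmul, DGCoalg.counit_one, one_smul, univTw_one, TensorProduct.zero_tmul, zero_add]

theorem milgramLin_letterL (c : C) : milgramLin R C C' (letterL R C C' c) = univTw R c ⊗ₜ 1 := by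
  rw [letterL_apply, milgramLin_univTw, milgramGen_one_right]

theorem milgramLin_letterR (c : C') : milgramLin R C C' (letterR R C C' c) = 1 ⊗ₜ univTw R c := by
  rw [letterR_apply, milgramLin_univTw, milgramGen_one_left]

/-- The value of `q` on a letter is already the sum of its values on the left and right parts, so
nothing is left for the mixed part. -/
theorem milgramLin_letterM (z : C ⊗[R] C') : milgramLin R C C' (letterM R C C' z) = 0 := by
  rw [letterM_apply, map_sub, map_sub, milgramLin_letterL, milgramLin_letterR, milgramLin_univTw]
  induction z with
  | zero => simp
  | add x y hx hy =>
    simp only [map_add, TensorProduct.add_tmul, TensorProduct.tmul_add] at hx hy ⊢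
    -- The zero on the right is written as `0 + 0`, and the two summands are replaced by the left
    -- sides of `hx` and `hy`.
    rw [← add_zero (0 : Cobar R C ⊗[R] Cobar R C'), ← hx]
    nth_rewrite 2 [hx]
    rw [← hy]; abel
  | tmul c c' =>
    rw [milgramGen_tmul, projL_tmul, projR_tmul]
    simp only [map_smul, TensorProduct.tmul_smul, ← TensorProduct.smul_tmul']
    abel

theorem milgramLin_letterL_mul (c : C) (a : Cobar R (C ⊗[R] C')) :
    milgramLin R C C' (letterL R C C' c * a) =
      (LinearMap.mulLeft R (univTw R c)).rTensor _ (milgramLin R C C' a) := by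
  rw [milgramLin_mul, milgramLin_letterL]
  generalize milgramLin R C C' a = y
  induction y with
  | zero => simp
  | add x y hx hy => simp only [map_add, hx, hy]
  | tmul w w' =>
    rw [cobarTensorMul_tmul _ talg_one_mem, LinearMap.rTensor_tmul, one_mul,
      LinearMap.mulLeft_apply, sgn_congr (k := 0) (l := 1 + 1) (by decide), sgn_add, sgn_sgn]

/-- A left letter multiplies the first tensor factor and meets nothing. A right letter, of degree `j
- 1`, has to pass the factor in `Ω C`, whence the sign operator. -/
theorem milgramLin_letterR_mul {j : ℤ} {c : C'} (hc : c ∈ gr R C' j) (a : Cobar R (C ⊗[R] C')) :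
    milgramLin R C C' (letterR R C C' c * a) =
      TensorProduct.map (sgn R (j - 1)) (LinearMap.mulLeft R (univTw R c))
        (milgramLin R C C' a) := by
  rw [milgramLin_mul, milgramLin_letterR]
  generalize milgramLin R C C' a = y
  induction y with
  | zero => simp
  | add x y hx hy => simp only [map_add, hx, hy]
  | tmul w w' =>
    rw [cobarTensorMul_tmul _ (hasDegree_univTw R j c hc), TensorProduct.map_tmul, one_mul,
      LinearMap.mulLeft_apply, sub_eq_add_neg]

theorem milgramLin_letterM_mul (z : C ⊗[R] C') (a : Cobar R (C ⊗[R] C')) :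
    milgramLin R C C' (letterM R C C' z * a) = 0 := by
  rw [milgramLin_mul, milgramLin_letterM, map_zero, LinearMap.zero_apply]

theorem milgramLin_cobarInr (b : Cobar R C') : milgramLin R C C' (cobarInr R C C' b) = 1 ⊗ₜ b := by
  refine cobar_induction (p := fun b => milgramLin R C C' (cobarInr R C C' b) = 1 ⊗ₜ b)
    ?_ ?_ ?_ ?_ b
  · rw [map_one, milgramLin_one]
  · intro a b ha hb; rw [map_add, map_add, ha, hb, TensorProduct.tmul_add]
  · intro r a ha; rw [map_smul, map_smul, ha, TensorProduct.tmul_smul]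
  · intro j c hc a ha
    rw [map_mul, cobarInr_univTw, milgramLin_letterR_mul hc, ha, TensorProduct.map_tmul,
      sgn_talg_one, LinearMap.mulLeft_apply]

/-- In the image of the section all left letters precede the right ones, so `q` reads them off
without any sign. -/
theorem milgramLin_milgramSection (y : Cobar R C ⊗[R] Cobar R C') :
    milgramLin R C C' (milgramSection R C C' y) = y := by
  induction y with
  | zero => simp
  | add x y hx hy => rw [map_add, map_add, hx, hy]
  | tmul a b =>
    rw [milgramSection_tmul]
    refine cobar_induction (p := fun a =>
      milgramLin R C C' (cobarInl R C C' a * cobarInr R C C' b) = a ⊗ₜ b) ?_ ?_ ?_ ?_ a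
    · rw [map_one, one_mul, milgramLin_cobarInr]
    · intro a b ha hb; rw [map_add, add_mul, map_add, ha, hb, TensorProduct.add_tmul]
    · intro r a ha; rw [map_smul, smul_mul_assoc, map_smul, ha, TensorProduct.smul_tmul']
    · intro i c _ a ha
      rw [map_mul (cobarInl R C C'), mul_assoc, cobarInl_univTw, milgramLin_letterL_mul, ha,
        LinearMap.rTensor_tmul, LinearMap.mulLeft_apply]

theorem cobarInl_mem (n : ℤ) (a : Cobar R C) (ha : a ∈ gr R (Cobar R C) n) :
    cobarInl R C C' a ∈ gr R (Cobar R (C ⊗[R] C')) n := by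
  refine talg_gr_induction (p := fun n a => cobarInl R C C' a ∈ gr R (Cobar R (C ⊗[R] C')) n)
    ?_ ?_ ?_ ?_ ?_ ha
  · rw [map_one]; exact talg_one_mem
  · intro n; rw [map_zero]; exact zero_mem _
  · intro n a b ha hb; rw [map_add]; exact add_mem ha hb
  · intro n r a ha; rw [map_smul]; exact Submodule.smul_mem _ _ ha
  · intro i w hw n a _ ha
    have hw' : desuspIncl R C w ∈ gr R C (i + 1) := hw
    rw [ι_eq_univTw, map_mul, cobarInl_univTw]
    have := talg_mul_mem (hasDegree_letterL _ _ hw') ha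
    rwa [add_neg_cancel_right] at this

theorem cobarInr_mem (n : ℤ) (a : Cobar R C') (ha : a ∈ gr R (Cobar R C') n) :
    cobarInr R C C' a ∈ gr R (Cobar R (C ⊗[R] C')) n := by
  refine talg_gr_induction (p := fun n a => cobarInr R C C' a ∈ gr R (Cobar R (C ⊗[R] C')) n)
    ?_ ?_ ?_ ?_ ?_ ha
  · rw [map_one]; exact talg_one_mem
  · intro n; rw [map_zero]; exact zero_mem _
  · intro n a b ha hb; rw [map_add]; exact add_mem ha hb
  · intro n r a ha; rw [map_smul]; exact Submodule.smul_mem _ _ ha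
  · intro i w hw n a _ ha
    have hw' : desuspIncl R C' w ∈ gr R C' (i + 1) := hw
    rw [ι_eq_univTw, map_mul, cobarInr_univTw]
    have := talg_mul_mem (hasDegree_letterR _ _ hw') ha
    rwa [add_neg_cancel_right] at this

theorem hasDegree_milgramSection : HasDegree R 0 (milgramSection R C C') :=
  hasDegree_tensor fun i a ha j b hb => by
    rw [add_zero, milgramSection_tmul]
    exact talg_mul_mem (cobarInl_mem i a ha) (cobarInr_mem j b hb)

end Letters

/-! ### The quadratic part of the differential and its contracting homotopy -/

section Quadratic

variable (R : Type u) [CommRing R]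
variable (C : Type*) [AddCommGroup C] [Module R C] [DGCoalg R C]
variable (C' : Type*) [AddCommGroup C'] [Module R C'] [DGCoalg R C']

/-- `c ⊗ c' ↦ (-1)^|c| s⁻¹(c ⊗ 1) | s⁻¹(1 ⊗ c') + (-1)^(|c||c'| + |c'|) s⁻¹(1 ⊗ c') | s⁻¹(c ⊗ 1)` -/
def commGen : C ⊗[R] C' →ₗ[R] Cobar R (C ⊗[R] C') :=
  LinearMap.mul' R _ ∘ₗ TensorProduct.map (letterL R C C' ∘ₗ sgn R 1) (letterR R C C') +
    LinearMap.mul' R _ ∘ₗ TensorProduct.map (letterR R C C' ∘ₗ sgn R 1) (letterL R C C') ∘ₗ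
      gswap R C C'

/-- The derivation of `Ω (C ⊗ C')` given on generators by `commGen`. -/
def commD : Cobar R (C ⊗[R] C') →ₗ[R] Cobar R (C ⊗[R] C') :=
  derivExt (commGen R C C' ∘ₗ desuspIncl R (C ⊗[R] C'))

variable {R C C'}

/-- The two letters have degrees `i - 1` and `j - 1`, and `-(-1)^i (-1)^((i-1)(j-1)) = (-1)^(ij +
j)`. The right side is thus `(-1)^i` times their graded commutator. -/
theorem commGen_tmul {i j : ℤ} {c : C} {c' : C'} (hc : c ∈ gr R C i) (hc' : c' ∈ gr R C' j) :
    commGen R C C' (c ⊗ₜ c') = ksign R i • (letterL R C C' c * letterR R C C' c') +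
      (ksign R (i * j) * ksign R j) • (letterR R C C' c' * letterL R C C' c) := by
  simp only [commGen, LinearMap.add_apply, LinearMap.comp_apply, gswap_tmul_tmul hc hc', map_smul,
    TensorProduct.map_tmul, LinearMap.mul'_apply, sgn_apply 1 hc, sgn_apply 1 hc', smul_mul_assoc,
    one_mul, smul_smul]

theorem commGen_tmul_one (c : C) : commGen R C C' (c ⊗ₜ one R C') = 0 := by
  refine gr_induction (R := R) (p := fun c => commGen R C C' (c ⊗ₜ one R C') = 0) ?_ ?_ c
  · intro x y hx hy; rw [TensorProduct.add_tmul, map_add, hx, hy, add_zero]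
  · intro i c hc; rw [commGen_tmul hc DGCoalg.one_mem, letterR_one]; simp

theorem commGen_one_tmul (c : C') : commGen R C C' (one R C ⊗ₜ c) = 0 := by
  refine gr_induction (R := R) (p := fun c => commGen R C C' (one R C ⊗ₜ c) = 0) ?_ ?_ c
  · intro x y hx hy; rw [TensorProduct.tmul_add, map_add, hx, hy, add_zero]
  · intro i c hc; rw [commGen_tmul DGCoalg.one_mem hc, letterL_one]; simp

theorem commD_univTw (z : C ⊗[R] C') : commD R C C' (univTw R z) = commGen R C C' z := by
  rw [commD, univTw, LinearMap.comp_apply, derivExt_ι, LinearMap.comp_apply, desuspIncl_desusp,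
    map_sub, map_smul]
  show _ - _ • commGen R C C' (one R C ⊗ₜ one R C') = _
  rw [commGen_tmul_one, smul_zero, sub_zero]

theorem commD_one : commD R C C' 1 = 0 := derivExt_one _

theorem commD_mul (a b : Cobar R (C ⊗[R] C')) :
    commD R C C' (a * b) = commD R C C' a * b + sgn R 1 a * commD R C C' b := derivExt_mul _ a b

theorem commD_letterL (c : C) : commD R C C' (letterL R C C' c) = 0 := by
  rw [letterL_apply, commD_univTw, commGen_tmul_one]

theorem commD_letterR (c : C') : commD R C C' (letterR R C C' c) = 0 := by
  rw [letterR_apply, commD_univTw, commGen_one_tmul]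

/-- Unmixed letters are cycles for `commD`, so its value on any letter comes from the mixed part
alone. -/
theorem commD_letterM (z : C ⊗[R] C') : commD R C C' (letterM R C C' z) = commGen R C C' z := by
  rw [letterM_apply, map_sub, map_sub, commD_letterL, commD_letterR, commD_univTw, sub_zero,
    sub_zero]

theorem commD_cobarInl (a : Cobar R C) : commD R C C' (cobarInl R C C' a) = 0 := by
  refine cobar_induction (p := fun a => commD R C C' (cobarInl R C C' a) = 0) ?_ ?_ ?_ ?_ a
  · rw [map_one, commD_one]
  · intro a b ha hb; rw [map_add, map_add, ha, hb, add_zero]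
  · intro r a ha; rw [map_smul, map_smul, ha, smul_zero]
  · intro i c _ a ha
    rw [map_mul, cobarInl_univTw, commD_mul, commD_letterL, ha, zero_mul, mul_zero, add_zero]

theorem commD_cobarInr (a : Cobar R C') : commD R C C' (cobarInr R C C' a) = 0 := by
  refine cobar_induction (p := fun a => commD R C C' (cobarInr R C C' a) = 0) ?_ ?_ ?_ ?_ a
  · rw [map_one, commD_one]
  · intro a b ha hb; rw [map_add, map_add, ha, hb, add_zero]
  · intro r a ha; rw [map_smul, map_smul, ha, smul_zero]
  · intro i c _ a ha
    rw [map_mul, cobarInr_univTw, commD_mul, commD_letterR, ha, zero_mul, mul_zero, add_zero]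

/-- Left and right letters commute in the graded sense inside `Ω C ⊗ Ω C'`, so their commutator dies
there. -/
theorem milgramLin_commGen (z : C ⊗[R] C') : milgramLin R C C' (commGen R C C' z) = 0 := by
  suffices h : milgramLin R C C' ∘ₗ commGen R C C' = 0 from LinearMap.congr_fun h z
  refine tensor_hom_ext fun i c hc j c' hc' => ?_
  have h1 : sgn R (j - 1) (univTw R c) = ksign R ((j - 1) * (i - 1)) • univTw R c :=
    sgn_apply _ (by simpa [sub_eq_add_neg] using hasDegree_univTw R i c hc)
  rw [LinearMap.comp_apply, commGen_tmul hc hc', map_add, map_smul, map_smul,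
    milgramLin_letterL_mul, milgramLin_letterR_mul hc', milgramLin_letterL, milgramLin_letterR,
    LinearMap.rTensor_tmul, TensorProduct.map_tmul, LinearMap.mulLeft_apply,
    LinearMap.mulLeft_apply, h1, ← TensorProduct.smul_tmul', smul_smul, mul_one, mul_one,
    ← add_smul]
  have h2 : ksign R (i * j) * ksign R j * ksign R ((j - 1) * (i - 1)) = - ksign R i := by
    rw [← ksign_add, ← ksign_add, show i * j + j + (j - 1) * (i - 1) =
      2 * (i * j) + (1 - i) by ring, ksign_add, ksign_even ⟨i * j, by ring⟩, ksign_sub, ksign_one]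
    ring
  rw [h2, add_neg_cancel, zero_smul, LinearMap.zero_apply]

theorem milgramLin_commD (a : Cobar R (C ⊗[R] C')) :
    milgramLin R C C' (commD R C C' a) = 0 := by
  refine cobar_induction (p := fun a => milgramLin R C C' (commD R C C' a) = 0) ?_ ?_ ?_ ?_ a
  · rw [commD_one, map_zero]
  · intro a b ha hb; rw [map_add, map_add, ha, hb, add_zero]
  · intro r a ha; rw [map_smul, map_smul, ha, smul_zero]
  · intro i z _ a ha
    rw [commD_mul, map_add, milgramLin_mul, milgramLin_mul, ha, commD_univTw, milgramLin_commGen]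
    simp

/-! ### Exchanging a right letter with a word of left letters. -/

theorem letterM_one_tmul (c : C') : letterM R C C' (one R C ⊗ₜ c) = 0 := by
  rw [letterM_apply, projL_tmul, projR_tmul, DGCoalg.counit_one, one_smul, map_smul, letterL_one,
    letterR_apply]; simp

/-- The values on generators of the algebra map `swapMat`. -/
def swapMatGen (j : ℤ) (c' : C') : C →ₗ[R] Matrix (Fin 2) (Fin 2) (Cobar R (C ⊗[R] C')) where
  toFun c := !![letterL R C C' (ksign R j • sgn R j c),
    letterM R C C' ((ksign R j • sgn R j c) ⊗ₜ c'); 0, letterL R C C' c]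
  map_add' x y := by
    ext a b; fin_cases a <;> fin_cases b <;> simp [TensorProduct.add_tmul]
  map_smul' r x := by
    ext a b
    fin_cases a <;> fin_cases b <;>
      simp [smul_comm _ r, ← TensorProduct.smul_tmul', map_smul]

/-- Auxiliary algebra map encoding the derivation `swapHom`. -/
def swapMat (j : ℤ) (c' : C') :
    Cobar R C →ₐ[R] Matrix (Fin 2) (Fin 2) (Cobar R (C ⊗[R] C')) :=
  TensorAlgebra.lift R (swapMatGen j c' ∘ₗ desuspIncl R C)

theorem swapMat_univTw (j : ℤ) (c' : C') (c : C) : swapMat j c' (univTw R c) =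
    !![letterL R C C' (ksign R j • sgn R j c),
      letterM R C C' ((ksign R j • sgn R j c) ⊗ₜ c'); 0, letterL R C C' c] := by
  refine lift_desuspIncl_univTw _ ?_ c
  ext a b
  simp only [swapMatGen, LinearMap.coe_mk, AddHom.coe_mk, sgn_of_mem_zero j DGCoalg.one_mem,
    map_smul, letterL_one, ← TensorProduct.smul_tmul', letterM_one_tmul, smul_zero]
  fin_cases a <;> fin_cases b <;> simp

/-- The matrices are upper triangular, so the diagonal entries are multiplicative and the upper
right entry obeys a Leibniz rule relative to them. The lower diagonal entry is identified as
`cobarInl`. -/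
theorem swapMat_apply (j : ℤ) (c' : C') (a : Cobar R C) :
    swapMat j c' a 1 0 = 0 ∧ swapMat j c' a 1 1 = cobarInl R C C' a := by
  refine cobar_induction (p := fun a => swapMat j c' a 1 0 = 0 ∧
    swapMat j c' a 1 1 = cobarInl R C C' a) ?_ ?_ ?_ ?_ a
  · simp
  · rintro a b ⟨h1, h2⟩ ⟨h1', h2'⟩; simp [h1, h2, h1', h2']
  · rintro r a ⟨h1, h2⟩; simp [h1, h2]
  · rintro i c _ a ⟨h1, h2⟩
    simp only [map_mul, Matrix.mul_apply, Fin.sum_univ_two, h1, h2, swapMat_univTw,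
      cobarInl_univTw]
    simp

/-- For `c'` of degree `j`, the derivation `Ω C → Ω (C ⊗ C')` of degree `j` along `cobarInl` with
`s⁻¹c ↦ ± s⁻¹(c̄ ⊗ c̄')`. -/
def swapHomAux (j : ℤ) (c' : C') : Cobar R C →ₗ[R] Cobar R (C ⊗[R] C') :=
  Matrix.entryLinearMap R _ 0 1 ∘ₗ (swapMat j c').toLinearMap

theorem swapHomAux_one (j : ℤ) (c' : C') : swapHomAux (C := C) j c' (1 : Cobar R C) = 0 := by
  simp [swapHomAux]

theorem swapHomAux_univTw_mul (j : ℤ) (c' : C') (c : C) (a : Cobar R C) :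
    swapHomAux j c' (univTw R c * a) =
      letterL R C C' (ksign R j • sgn R j c) * swapHomAux j c' a +
      letterM R C C' ((ksign R j • sgn R j c) ⊗ₜ c') * cobarInl R C C' a := by
  simp only [swapHomAux, LinearMap.comp_apply, AlgHom.toLinearMap_apply, map_mul,
    Matrix.entryLinearMap_apply, Matrix.mul_apply, Fin.sum_univ_two, (swapMat_apply j c' a).2,
    swapMat_univTw]
  simp

/-- With the sign parameter `j` held fixed, independently of any degree, the construction is linear
in the second entry. This permits gluing over the homogeneous components of `C'`. -/
theorem swapHomAux_add (j : ℤ) (x y : C') (a : Cobar R C) :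
    swapHomAux j (x + y) a = swapHomAux j x a + swapHomAux j y a := by
  refine cobar_induction (p := fun a =>
    swapHomAux j (x + y) a = swapHomAux j x a + swapHomAux j y a) ?_ ?_ ?_ ?_ a
  · simp [swapHomAux_one]
  · intro a b ha hb; simp only [map_add, ha, hb]; abel
  · intro r a ha; simp only [map_smul, ha, smul_add]
  · intro i c _ a ha
    simp only [swapHomAux_univTw_mul, ha, TensorProduct.tmul_add, map_add]
    noncomm_ring

theorem swapHomAux_smul (j : ℤ) (r : R) (x : C') (a : Cobar R C) :
    swapHomAux j (r • x) a = r • swapHomAux j x a := by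
  refine cobar_induction (p := fun a => swapHomAux j (r • x) a = r • swapHomAux j x a)
    ?_ ?_ ?_ ?_ a
  · simp [swapHomAux_one]
  · intro a b ha hb; simp only [map_add, ha, hb, smul_add]
  · intro s a ha; simp only [map_smul, ha, smul_comm s r]
  · intro i c _ a ha
    rw [swapHomAux_univTw_mul, swapHomAux_univTw_mul, ha, TensorProduct.tmul_smul,
      map_smul (letterM R C C'), smul_add, mul_smul_comm, smul_mul_assoc]

variable (R C C')

/-- The linear extension of `swapHomAux` to all of `C'`. -/
def swapHom : C' →ₗ[R] Cobar R C →ₗ[R] Cobar R (C ⊗[R] C') :=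
  ofComponents fun j =>
    { toFun := fun c' => swapHomAux j (c' : C')
      map_add' := fun x y => LinearMap.ext (swapHomAux_add j (x : C') y)
      map_smul' := fun r x => LinearMap.ext (swapHomAux_smul j r (x : C')) }

variable {R C C'}

theorem swapHom_apply {j : ℤ} {c' : C'} (hc' : c' ∈ gr R C' j) (a : Cobar R C) :
    swapHom R C C' c' a = swapHomAux j c' a := by
  rw [swapHom, ofComponents_apply _ hc']; rfl

theorem swapHom_at_one (c' : C') : swapHom R C C' c' 1 = 0 := by
  refine gr_induction (R := R) (p := fun c' => swapHom R C C' c' 1 = 0) ?_ ?_ c'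
  · intro x y hx hy; rw [map_add, LinearMap.add_apply, hx, hy, add_zero]
  · intro j c' hc'; rw [swapHom_apply hc', swapHomAux_one]

/-- The sign is `(-1)^(j(i-1))`, for moving an operator of degree `j` past a letter of degree `i -
1`. Giving the mixed summand the same sign is the normalisation that makes `commD_swapHom` hold. -/
theorem swapHom_univTw_mul {i j : ℤ} {c : C} {c' : C'} (hc : c ∈ gr R C i) (hc' : c' ∈ gr R C' j)
    (a : Cobar R C) : swapHom R C C' c' (univTw R c * a) = (ksign R j * ksign R (j * i)) •
      (letterL R C C' c * swapHom R C C' c' a +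
        letterM R C C' (c ⊗ₜ c') * cobarInl R C C' a) := by
  rw [swapHom_apply hc', swapHom_apply hc', swapHomAux_univTw_mul, sgn_apply j hc]
  simp only [map_smul, ← TensorProduct.smul_tmul', smul_mul_assoc, smul_add, smul_smul]

/-- Each summand of the derivation contains a mixed letter with second entry `1`, and such a letter
vanishes. -/
theorem swapHom_one : swapHom R C C' (one R C') = 0 := by
  ext1 a
  refine cobar_induction (p := fun a => swapHom R C C' (one R C') a =
    (0 : Cobar R C →ₗ[R] Cobar R (C ⊗[R] C')) a) ?_ ?_ ?_ ?_ a
  · rw [swapHom_at_one]; rfl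
  · intro a b ha hb; rw [map_add, map_add, ha, hb]
  · intro r a ha; rw [map_smul, map_smul, ha]
  · intro i c hc a ha
    rw [swapHom_univTw_mul hc DGCoalg.one_mem, ha, letterM_tmul_one]; simp

theorem swapHom_mem {j n : ℤ} {c' : C'} (hc' : c' ∈ gr R C' j) {a : Cobar R C}
    (ha : a ∈ gr R (Cobar R C) n) : swapHom R C C' c' a ∈ gr R (Cobar R (C ⊗[R] C')) (n + j) := by
  refine talg_gr_induction (p := fun n a =>
    swapHom R C C' c' a ∈ gr R (Cobar R (C ⊗[R] C')) (n + j)) ?_ ?_ ?_ ?_ ?_ ha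
  · rw [swapHom_at_one]; exact zero_mem _
  · intro n; rw [map_zero]; exact zero_mem _
  · intro n a b ha hb; rw [map_add]; exact add_mem ha hb
  · intro n r a ha; rw [map_smul]; exact Submodule.smul_mem _ _ ha
  · intro i w hw n a ha' ha
    have hw' : desuspIncl R C w ∈ gr R C (i + 1) := hw
    rw [ι_eq_univTw, swapHom_univTw_mul hw' hc']
    refine Submodule.smul_mem _ _ (add_mem ?_ ?_)
    · have := talg_mul_mem (hasDegree_letterL (C' := C') _ _ hw') ha
      rwa [add_neg_cancel_right, ← add_assoc] at this
    · have := talg_mul_mem (hasDegree_letterM _ _ (tmul_mem hw' hc'))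
        (cobarInl_mem (C' := C') n a ha')
      rwa [show i + 1 + j + -1 + n = i + n + j by ring] at this

/-- Moving `s⁻¹(1 ⊗ c')` through a word of left letters costs one commutator per letter. `swapHom`
marks each exchange by a mixed letter, `commD` opens the marks into commutators, and the sum
telescopes to the difference of the two extreme positions. -/
theorem commD_swapHom {j : ℤ} {c' : C'} (hc' : c' ∈ gr R C' j) (a : Cobar R C) :
    commD R C C' (swapHom R C C' c' a) = letterR R C C' c' * cobarInl R C C' a -
      cobarInl R C C' (sgn R (j - 1) a) * letterR R C C' c' := by
  refine cobar_induction (p := fun a =>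
    commD R C C' (swapHom R C C' c' a) = letterR R C C' c' * cobarInl R C C' a -
      cobarInl R C C' (sgn R (j - 1) a) * letterR R C C' c') ?_ ?_ ?_ ?_ a
  · rw [swapHom_at_one, sgn_talg_one, map_one]; simp
  · intro a b ha hb; simp only [map_add, ha, hb, mul_add, add_mul]; abel
  · intro r a ha
    simp only [map_smul, ha, mul_smul_comm, smul_mul_assoc, smul_sub]
  · intro i c hc a ha
    have h1 : sgn R (j - 1) (univTw R c) = ksign R ((j - 1) * (i - 1)) • univTw R c :=
      sgn_apply _ (by simpa [sub_eq_add_neg] using hasDegree_univTw R i c hc)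
    have h2 : sgn R 1 (letterL R C C' c) = ksign R (i - 1) • letterL R C C' c := by
      have := sgn_apply 1 (hasDegree_letterL (C' := C') i c hc)
      rwa [one_mul, ← sub_eq_add_neg] at this
    rw [swapHom_univTw_mul hc hc', map_smul, map_add, commD_mul, commD_letterL, commD_mul,
      commD_letterM, commD_cobarInl, ha, h2, sgn_talg_mul, h1, map_mul, commGen_tmul hc hc',
      smul_mul_assoc (ksign R ((j - 1) * (i - 1))), map_smul, map_mul, cobarInl_univTw]
    -- `e1` makes the term with the right letter in front appear with coefficient one. `e2` makes
    -- the terms with the right letter between `c` and `a` cancel: one comes from the commutator,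
    -- the other from the induction hypothesis. `e3` matches the sign of the term with the right
    -- letter at the end.
    have e1 : ksign R j * ksign R (j * i) * (ksign R (i * j) * ksign R j) = 1 := by
      rw [← ksign_add, ← ksign_add, ← ksign_add, ksign_even ⟨j + i * j, by ring⟩]
    have e2 : ksign R (i - 1) = - ksign R i := by rw [ksign_sub, ksign_one]; ring
    have e3 : ksign R ((j - 1) * (i - 1)) = - (ksign R j * ksign R (j * i) * ksign R i) := by
      rw [show (j - 1) * (i - 1) = j * i - j - i + 1 by ring, ksign_add, ksign_sub, ksign_sub,
        ksign_one]; ring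
    simp only [e2, e3]
    simp only [zero_mul, zero_add, mul_zero, add_zero, neg_smul, neg_mul, mul_sub,
      add_mul, smul_mul_assoc, smul_add, smul_neg, smul_smul, e1, one_smul, mul_assoc,
      sub_neg_eq_add]
    abel

variable (R C C')

/-- `c' ⊗ (w ⊗ w') ↦ swapHom c' w | w'` -/
def swapTensor : C' →ₗ[R] Cobar R C ⊗[R] Cobar R C' →ₗ[R] Cobar R (C ⊗[R] C') where
  toFun c' := LinearMap.mul' R _ ∘ₗ
    TensorProduct.map (swapHom R C C' c') (cobarInr R C C').toLinearMap
  map_add' x y := by rw [map_add, TensorProduct.map_add_left, LinearMap.comp_add]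
  map_smul' r x := by rw [map_smul, TensorProduct.map_smul_left, LinearMap.comp_smul]; rfl

variable {R C C'}

theorem swapTensor_tmul (c' : C') (a : Cobar R C) (b : Cobar R C') :
    swapTensor R C C' c' (a ⊗ₜ b) = swapHom R C C' c' a * cobarInr R C C' b := rfl

theorem swapTensor_one : swapTensor R C C' (one R C') = 0 := by
  refine TensorProduct.ext' fun a b => ?_
  rw [swapTensor_tmul, swapHom_one]; simp

theorem swapTensor_mul {i j : ℤ} {c : C} {c' : C'} (hc : c ∈ gr R C i) (hc' : c' ∈ gr R C' j)
    (y : Cobar R C ⊗[R] Cobar R C') :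
    swapTensor R C C' c' ((LinearMap.mulLeft R (univTw R c)).rTensor _ y) =
      (ksign R j * ksign R (j * i)) • (letterL R C C' c * swapTensor R C C' c' y +
        letterM R C C' (c ⊗ₜ c') * milgramSection R C C' y) := by
  induction y with
  | zero => simp
  | add x y hx hy => simp only [map_add, hx, hy, mul_add, smul_add]; abel
  | tmul a b =>
    rw [LinearMap.rTensor_tmul, LinearMap.mulLeft_apply, swapTensor_tmul, swapTensor_tmul,
      swapHom_univTw_mul hc hc', milgramSection_tmul, smul_mul_assoc, add_mul, mul_assoc, mul_assoc]

theorem milgramSection_mulLeft (c : C) (y : Cobar R C ⊗[R] Cobar R C') :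
    milgramSection R C C' ((LinearMap.mulLeft R (univTw R c)).rTensor _ y) =
      letterL R C C' c * milgramSection R C C' y := by
  induction y with
  | zero => simp
  | add x y hx hy => simp only [map_add, hx, hy, mul_add]
  | tmul a b =>
    rw [LinearMap.rTensor_tmul, LinearMap.mulLeft_apply, milgramSection_tmul, milgramSection_tmul,
      map_mul, cobarInl_univTw, mul_assoc]

/-- A right letter in front of a normal form `s y` is out of order. `swapTensor` is the
`commD`-homotopy between this product and the normal form of the product computed in `Ω C ⊗ Ω C'`.
-/
theorem commD_swapTensor {j : ℤ} {c' : C'} (hc' : c' ∈ gr R C' j)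
    (y : Cobar R C ⊗[R] Cobar R C') :
    commD R C C' (swapTensor R C C' c' y) = letterR R C C' c' * milgramSection R C C' y -
      milgramSection R C C'
        (TensorProduct.map (sgn R (j - 1)) (LinearMap.mulLeft R (univTw R c')) y) := by
  induction y with
  | zero => simp
  | add x y hx hy => simp only [map_add, hx, hy, mul_add]; abel
  | tmul a b =>
    rw [swapTensor_tmul, commD_mul, commD_cobarInr, mul_zero, add_zero, commD_swapHom hc',
      TensorProduct.map_tmul, LinearMap.mulLeft_apply, milgramSection_tmul, milgramSection_tmul,
      map_mul, cobarInr_univTw, sub_mul, mul_assoc, mul_assoc]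

/-! ### The contracting homotopy for the quadratic part. -/

variable (R C C')

/-- The values on generators of the action defining `cobarHomotopy`. -/
def cobarHomotopyGen : C ⊗[R] C' →ₗ[R]
    Module.End R ((Cobar R C ⊗[R] Cobar R C') × Cobar R (C ⊗[R] C')) where
  -- The recursion for `h` needs `q a` besides `h a`, so a letter acts on pairs `(q a, h a)`. This
  -- makes `h` a component of an action of the free algebra, and no separate recursion on words is
  -- needed.
  toFun z := (cobarTensorMul R C C' (milgramGen R C C' z) ∘ₗ LinearMap.fst R _ _).prod
    (swapTensor R C C' (projR R C C' z) ∘ₗ LinearMap.fst R _ _ -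
      LinearMap.mulLeft R (univTw R (sgn R 1 z)) ∘ₗ LinearMap.snd R _ _)
  map_add' x y := by
    refine LinearMap.ext fun p => Prod.ext ?_ ?_
    · simp
    · simp [add_mul]; abel
  map_smul' r x := by
    refine LinearMap.ext fun p => Prod.ext ?_ ?_ <;> simp [smul_sub]

/-- The map `h` of degree `1` on `Ω (C ⊗ C')` with `h 1 = 0` and
`h (v | a) = (-1)^|v| v | h a + G (v, q a)`, where `q` is Milgram's map, and `G` vanishes except
on the letters `s⁻¹(1 ⊗ c')`, for which it is `swapTensor`. -/
def cobarHomotopy : Cobar R (C ⊗[R] C') →ₗ[R] Cobar R (C ⊗[R] C') :=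
  LinearMap.snd R _ _ ∘ₗ LinearMap.applyₗ ((1 : Cobar R C) ⊗ₜ[R] (1 : Cobar R C'), 0) ∘ₗ
    (TensorAlgebra.lift R (cobarHomotopyGen R C C' ∘ₗ desuspIncl R (C ⊗[R] C'))).toLinearMap

variable {R C C'}

/-- The unit has to act by zero for the action of a letter to be given by the same formula on every
representative in `C ⊗ C'`. -/
theorem cobarHomotopyGen_one : cobarHomotopyGen R C C' (one R (C ⊗[R] C')) = 0 := by
  have h : milgramGen R C C' (one R (C ⊗[R] C')) = 0 := by
    show milgramGen R C C' (one R C ⊗ₜ one R C') = 0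
    rw [milgramGen_one_right, univTw_one, TensorProduct.zero_tmul]
  have h2 : projR R C C' (one R (C ⊗[R] C')) = one R C' := by
    show projR R C C' (one R C ⊗ₜ one R C') = _
    rw [projR_tmul, DGCoalg.counit_one, one_smul]
  have h3 : univTw R (sgn R 1 (one R (C ⊗[R] C'))) = 0 := by
    rw [sgn_of_mem_zero 1 DGCoalg.one_mem, univTw_one]
  refine LinearMap.ext fun p => Prod.ext ?_ ?_
  · simp [cobarHomotopyGen, h]
  · simp [cobarHomotopyGen, h2, h3, swapTensor_one]

/-- The first component reproduces Milgram's map, which turns the action on pairs into the recursion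
`cobarHomotopy_univTw_mul`. -/
theorem cobarHomotopy_aux (a : Cobar R (C ⊗[R] C')) :
    TensorAlgebra.lift R (cobarHomotopyGen R C C' ∘ₗ desuspIncl R (C ⊗[R] C')) a
      ((1 : Cobar R C) ⊗ₜ[R] (1 : Cobar R C'), 0) =
    (milgramLin R C C' a, cobarHomotopy R C C' a) := by
  refine Prod.ext ?_ rfl
  refine cobar_induction (p := fun a => (TensorAlgebra.lift R
    (cobarHomotopyGen R C C' ∘ₗ desuspIncl R (C ⊗[R] C')) a
      ((1 : Cobar R C) ⊗ₜ[R] (1 : Cobar R C'), 0)).1 = milgramLin R C C' a) ?_ ?_ ?_ ?_ a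
  · rw [map_one, milgramLin_one]; rfl
  · intro a b ha hb; rw [map_add, LinearMap.add_apply, Prod.fst_add, ha, hb, map_add]
  · intro r a ha; rw [map_smul, LinearMap.smul_apply, Prod.smul_fst, ha, map_smul]
  · intro i c _ a ha
    rw [map_mul, Module.End.mul_apply, lift_desuspIncl_univTw _ cobarHomotopyGen_one,
      milgramLin_univTw_mul, ← ha]
    rfl

theorem cobarHomotopy_one : cobarHomotopy R C C' 1 = 0 := by
  simp [cobarHomotopy]

theorem cobarHomotopy_univTw_mul (z : C ⊗[R] C') (a : Cobar R (C ⊗[R] C')) :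
    cobarHomotopy R C C' (univTw R z * a) =
      swapTensor R C C' (projR R C C' z) (milgramLin R C C' a) -
        univTw R (sgn R 1 z) * cobarHomotopy R C C' a := by
  have h := cobarHomotopy_aux (univTw R z * a)
  rw [map_mul, Module.End.mul_apply, cobarHomotopy_aux a,
    lift_desuspIncl_univTw _ cobarHomotopyGen_one] at h
  exact (congrArg Prod.snd h).symm

theorem cobarHomotopy_letterL_mul (c : C) (a : Cobar R (C ⊗[R] C')) :
    cobarHomotopy R C C' (letterL R C C' c * a) =
      - (letterL R C C' (sgn R 1 c) * cobarHomotopy R C C' a) := by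
  rw [letterL_apply, cobarHomotopy_univTw_mul, projR_tmul, map_smul, swapTensor_one, sgn_tmul,
    sgn_of_mem_zero 1 DGCoalg.one_mem, letterL_apply]
  simp

theorem cobarHomotopy_letterR_mul (c : C') (a : Cobar R (C ⊗[R] C')) :
    cobarHomotopy R C C' (letterR R C C' c * a) = swapTensor R C C' c (milgramLin R C C' a) -
      letterR R C C' (sgn R 1 c) * cobarHomotopy R C C' a := by
  rw [letterR_apply, cobarHomotopy_univTw_mul, projR_tmul, DGCoalg.counit_one, one_smul, sgn_tmul,
    sgn_of_mem_zero 1 DGCoalg.one_mem, letterR_apply]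

theorem cobarHomotopy_letterM_mul (z : C ⊗[R] C') (a : Cobar R (C ⊗[R] C')) :
    cobarHomotopy R C C' (letterM R C C' z * a) =
      - (letterM R C C' (sgn R 1 z) * cobarHomotopy R C C' a) := by
  rw [letterM_apply, sub_mul, sub_mul, map_sub, map_sub, cobarHomotopy_univTw_mul,
    cobarHomotopy_letterL_mul, cobarHomotopy_letterR_mul, letterM_apply, projL_sgn, projR_sgn]
  noncomm_ring

/-- Induction on the first letter. A left letter passes through `h`, `commD` and `s q` compatibly.
For a right letter `commD_swapTensor` supplies the difference between the product with `s q a` and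
its normal form, while the other correction vanishes since `q commD = 0`. For a mixed letter `s q`
vanishes on the product, and `h` applied to the commutator returns the part `letterM · s q a` that
the induction hypothesis lacks. -/
theorem cobarHomotopy_comm (a : Cobar R (C ⊗[R] C')) :
    commD R C C' (cobarHomotopy R C C' a) + cobarHomotopy R C C' (commD R C C' a) =
      a - milgramSection R C C' (milgramLin R C C' a) := by
  refine cobar_tensor_induction (p := fun a =>
    commD R C C' (cobarHomotopy R C C' a) + cobarHomotopy R C C' (commD R C C' a) =
      a - milgramSection R C C' (milgramLin R C C' a)) ?_ ?_ ?_ ?_ ?_ ?_ a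
  · rw [cobarHomotopy_one, commD_one, map_zero, map_zero, milgramLin_one, milgramSection_tmul]
    simp
  · intro a b ha hb
    simp only [map_add]
    rw [add_add_add_comm, ha, hb]; abel
  · intro r a ha
    simp only [map_smul]
    rw [← smul_add, ha, smul_sub]
  · intro i c hc a ha
    have h1 := eq_sub_of_add_eq ha
    rw [cobarHomotopy_letterL_mul, map_neg, commD_mul, commD_mul, commD_letterL, commD_letterL,
      zero_mul, zero_mul, zero_add, zero_add, (hasDegree_letterL).sgn_comm,
      (hasDegree_letterL).sgn_comm, smul_mul_assoc, smul_mul_assoc, map_smul,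
      cobarHomotopy_letterL_mul, sgn_sgn, milgramLin_letterL_mul, milgramSection_mulLeft, h1]
    simp only [one_mul, ksign_neg, ksign_one, neg_smul, one_smul, mul_sub]
    abel
  · intro j c hc a ha
    have h1 := eq_sub_of_add_eq ha
    rw [cobarHomotopy_letterR_mul, map_sub, commD_mul, commD_mul, commD_letterR, commD_letterR,
      zero_mul, zero_mul, zero_add, zero_add, (hasDegree_letterR).sgn_comm,
      (hasDegree_letterR).sgn_comm, smul_mul_assoc, smul_mul_assoc, map_smul,
      cobarHomotopy_letterR_mul, sgn_sgn, milgramLin_commD, map_zero, commD_swapTensor hc,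
      milgramLin_letterR_mul hc, h1]
    simp only [one_mul, ksign_neg, ksign_one, neg_smul, one_smul, mul_sub]
    abel
  · intro i c hc j c' hc' a ha
    have h1 := eq_sub_of_add_eq ha
    -- Both orders of the commutator produce a term with the left letter in front of `swapTensor`,
    -- and these cancel. By `swapTensor_mul` the order with the right letter in front contributes
    -- one more term, the mixed letter times the normal form of `b`.
    have h2 : ∀ b, cobarHomotopy R C C' (commGen R C C' (c ⊗ₜ c') * b) =
        ksign R (i + j) • (commGen R C C' (c ⊗ₜ c') * cobarHomotopy R C C' b) +
          letterM R C C' (c ⊗ₜ c') * milgramSection R C C' (milgramLin R C C' b) := by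
      intro b
      rw [commGen_tmul hc hc', add_mul, map_add, smul_mul_assoc, smul_mul_assoc, map_smul, map_smul,
        mul_assoc, mul_assoc, cobarHomotopy_letterL_mul, cobarHomotopy_letterR_mul,
        cobarHomotopy_letterR_mul, cobarHomotopy_letterL_mul, sgn_apply 1 hc, sgn_apply 1 hc',
        milgramLin_letterL_mul, swapTensor_mul hc hc']
      have e1 : ksign R (i * j) * ksign R j * (ksign R j * ksign R (j * i)) = 1 := by
        rw [← ksign_add, ← ksign_add, ← ksign_add, ksign_even ⟨j + i * j, by ring⟩]
      simp only [one_mul, map_smul, smul_mul_assoc, mul_sub, mul_neg, mul_smul_comm, smul_add,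
        smul_sub, smul_neg, smul_smul, e1, ksign_mul_self, one_smul, ksign_add, add_mul, mul_assoc]
      rw [mul_comm (ksign R j) (ksign R i), mul_left_comm (ksign R i)]
      simp only [mul_left_comm (ksign R i) (ksign R j), mul_comm (ksign R i) (ksign R j),
        ksign_mul_self, mul_left_comm (ksign R i) (ksign R (i * j))]
      rw [mul_left_comm (ksign R j) (ksign R (i * j))]
      abel
    rw [cobarHomotopy_letterM_mul, map_neg, commD_mul, commD_mul, commD_letterM, commD_letterM,
      map_add, h2, (hasDegree_letterM).sgn_comm, (hasDegree_letterM).sgn_comm, smul_mul_assoc,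
      smul_mul_assoc, map_smul, cobarHomotopy_letterM_mul, sgn_sgn, h1, milgramLin_letterM_mul,
      sgn_apply 1 (tmul_mem hc hc'), map_zero, map_smul]
    simp only [one_mul, ksign_neg, ksign_one, neg_smul, one_smul, mul_sub, smul_mul_assoc]
    abel

end Quadratic

/-! ### Degrees and weights of the contracting homotopy -/

section Weights

variable {R : Type u} [CommRing R]
variable {C : Type*} [AddCommGroup C] [Module R C] [DGCoalg R C]
variable {C' : Type*} [AddCommGroup C'] [Module R C'] [DGCoalg R C']

theorem swapTensor_mem {j n : ℤ} {c' : C'} (hc' : c' ∈ gr R C' j)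
    {y : Cobar R C ⊗[R] Cobar R C'} (hy : y ∈ gr R (Cobar R C ⊗[R] Cobar R C') n) :
    swapTensor R C C' c' y ∈ gr R (Cobar R (C ⊗[R] C')) (n + j) := by
  refine hasDegree_tensor (f := swapTensor R C C' c') (k := j) (fun i a ha l b hb => ?_) n y hy
  rw [swapTensor_tmul]
  have := talg_mul_mem (swapHom_mem hc' ha) (cobarInr_mem (C := C) l b hb)
  rwa [add_right_comm] at this

theorem hasDegree_cobarHomotopy : HasDegree R 1 (cobarHomotopy R C C') := by
  intro n a ha
  refine talg_gr_induction (p := fun n a =>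
    cobarHomotopy R C C' a ∈ gr R (Cobar R (C ⊗[R] C')) (n + 1)) ?_ ?_ ?_ ?_ ?_ ha
  · rw [cobarHomotopy_one]; exact zero_mem _
  · intro n; rw [map_zero]; exact zero_mem _
  · intro n a b ha hb; rw [map_add]; exact add_mem ha hb
  · intro n r a ha; rw [map_smul]; exact Submodule.smul_mem _ _ ha
  · intro i w hw n a ha' ha
    have hw' : desuspIncl R (C ⊗[R] C') w ∈ gr R (C ⊗[R] C') (i + 1) := hw
    rw [ι_eq_univTw, cobarHomotopy_univTw_mul]
    refine sub_mem ?_ ?_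
    · have h := hasDegree_projR _ _ hw'
      rw [add_zero] at h
      have := swapTensor_mem h (milgramLin_mem n a ha')
      rwa [show n + (i + 1) = i + n + 1 by ring] at this
    · have := talg_mul_mem (hasDegree_univTw R _ _ (sgn_mem 1 hw')) ha
      rwa [add_neg_cancel_right, ← add_assoc] at this

theorem mixed_proj {w : DesuspCoideal R (C ⊗[R] C')} (hw : w ∈ mixed R C C') :
    projL R C C' (desuspIncl R _ w) = 0 ∧ projR R C C' (desuspIncl R _ w) = 0 := hw

theorem univTw_of_mixed {z : C ⊗[R] C'} (hL : projL R C C' z = 0) (hR : projR R C C' z = 0) :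
    univTw R z = letterM R C C' z := by
  rw [letterM_apply, hL, hR]; simp

theorem univTw_sgn_of_mixed (k : ℤ) {z : C ⊗[R] C'} (hL : projL R C C' z = 0)
    (hR : projR R C C' z = 0) : univTw R (sgn R k z) = letterM R C C' (sgn R k z) :=
  univTw_of_mixed (by rw [projL_sgn, hL, map_zero]) (by rw [projR_sgn, hR, map_zero])

/-- For the zero submodule every letter counts, so `weightLE ⊥` is the filtration of `Ω C` by word
length; `cobarInl` turns letters into unmixed ones, one for one. -/
theorem cobarInl_weight {r : ℤ} {a : Cobar R C}
    (ha : a ∈ weightLE (⊥ : Submodule R (DesuspCoideal R C)) r) :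
    cobarInl R C C' a ∈ weightLE (mixed R C C') r := by
  refine weightLE_induction (p := fun r a => cobarInl R C C' a ∈ weightLE (mixed R C C') r)
    ?_ ?_ ?_ ?_ ?_ ?_ ha
  · intro r; rw [map_zero]; exact zero_mem _
  · intro r hr; rw [map_one]; exact weightLE_one hr
  · intro r a b ha hb; rw [map_add]; exact add_mem ha hb
  · intro r x a ha; rw [map_smul]; exact Submodule.smul_mem _ _ ha
  · intro r w a _ ha
    rw [ι_eq_univTw, map_mul, cobarInl_univTw]; exact univTw_mul_mem _ ha
  · intro r w hw a _ ha
    rw [(Submodule.mem_bot R).1 hw, map_zero, zero_mul, map_zero]; exact zero_mem _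

theorem cobarInr_weight {r : ℤ} {a : Cobar R C'}
    (ha : a ∈ weightLE (⊥ : Submodule R (DesuspCoideal R C')) r) :
    cobarInr R C C' a ∈ weightLE (mixed R C C') r := by
  refine weightLE_induction (p := fun r a => cobarInr R C C' a ∈ weightLE (mixed R C C') r)
    ?_ ?_ ?_ ?_ ?_ ?_ ha
  · intro r; rw [map_zero]; exact zero_mem _
  · intro r hr; rw [map_one]; exact weightLE_one hr
  · intro r a b ha hb; rw [map_add]; exact add_mem ha hb
  · intro r x a ha; rw [map_smul]; exact Submodule.smul_mem _ _ ha
  · intro r w a _ ha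
    rw [ι_eq_univTw, map_mul, cobarInr_univTw]; exact univTw_mul_mem _ ha
  · intro r w hw a _ ha
    rw [(Submodule.mem_bot R).1 hw, map_zero, zero_mul, map_zero]; exact zero_mem _

/-- Every summand turns exactly one left letter into a mixed one, which no longer counts. -/
theorem swapHom_weight (c' : C') {r : ℤ} {a : Cobar R C}
    (ha : a ∈ weightLE (⊥ : Submodule R (DesuspCoideal R C)) r) :
    swapHom R C C' c' a ∈ weightLE (mixed R C C') (r - 1) := by
  revert ha
  refine gr_induction (R := R) (p := fun c' => a ∈ weightLE ⊥ r →
    swapHom R C C' c' a ∈ weightLE (mixed R C C') (r - 1)) ?_ ?_ c'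
  · intro x y hx hy ha
    rw [map_add, LinearMap.add_apply]; exact add_mem (hx ha) (hy ha)
  intro j c' hc' ha
  refine weightLE_induction (p := fun r a =>
    swapHom R C C' c' a ∈ weightLE (mixed R C C') (r - 1)) ?_ ?_ ?_ ?_ ?_ ?_ ha
  · intro r; rw [map_zero]; exact zero_mem _
  · intro r _; rw [swapHom_at_one]; exact zero_mem _
  · intro r a b ha hb; rw [map_add]; exact add_mem ha hb
  · intro r x a ha; rw [map_smul]; exact Submodule.smul_mem _ _ ha
  · intro r w a ha' ha
    rw [ι_eq_univTw]
    refine gr_induction (R := R) (p := fun c => swapHom R C C' c' (univTw R c * a) ∈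
      weightLE (mixed R C C') (r + 1 - 1)) ?_ ?_ (desuspIncl R C w)
    · intro x y hx hy; rw [map_add, add_mul, map_add]; exact add_mem hx hy
    · intro i c hc
      rw [swapHom_univTw_mul hc hc']
      refine Submodule.smul_mem _ _ (add_mem ?_ ?_)
      · have := univTw_mul_mem (c ⊗ₜ[R] one R C') ha
        rwa [sub_add_eq_add_sub] at this
      · rw [add_sub_cancel_right]; exact letterM_mul_mem _ (cobarInl_weight ha')
  · intro r w hw a _ ha
    rw [(Submodule.mem_bot R).1 hw, map_zero, zero_mul, map_zero]; exact zero_mem _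

variable (R C C') in
/-- The filtration of `Ω C ⊗ Ω C'` by word length. -/
def lengthLE (r : ℤ) : Submodule R (Cobar R C ⊗[R] Cobar R C') :=
  Submodule.span R {y | ∃ s t, s + t = r ∧ ∃ a ∈ weightLE (⊥ : Submodule R (DesuspCoideal R C)) s,
    ∃ b ∈ weightLE (⊥ : Submodule R (DesuspCoideal R C')) t, a ⊗ₜ[R] b = y}

theorem lengthLE_tmul {s t : ℤ} {a : Cobar R C} {b : Cobar R C'} (ha : a ∈ weightLE ⊥ s)
    (hb : b ∈ weightLE ⊥ t) : a ⊗ₜ[R] b ∈ lengthLE R C C' (s + t) :=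
  Submodule.subset_span ⟨s, t, rfl, a, ha, b, hb, rfl⟩

theorem swapTensor_weight (c' : C') {r : ℤ} {y : Cobar R C ⊗[R] Cobar R C'}
    (hy : y ∈ lengthLE R C C' r) : swapTensor R C C' c' y ∈ weightLE (mixed R C C') (r - 1) := by
  refine (Submodule.span_le (p := (weightLE (mixed R C C') (r - 1)).comap
    (swapTensor R C C' c'))).2 ?_ hy
  rintro _ ⟨s, t, rfl, a, ha, b, hb, rfl⟩
  have := weightLE_mul (swapHom_weight (C := C) c' ha) (cobarInr_weight (C := C) hb)
  rwa [sub_add_eq_add_sub] at this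

/-- Unmixed letters are carried to letters of one of the factors, and words with a mixed letter go
to zero, so weight becomes word length. -/
theorem milgramLin_weight {r : ℤ} {a : Cobar R (C ⊗[R] C')}
    (ha : a ∈ weightLE (mixed R C C') r) : milgramLin R C C' a ∈ lengthLE R C C' r := by
  refine weightLE_induction (p := fun r a => milgramLin R C C' a ∈ lengthLE R C C' r)
    ?_ ?_ ?_ ?_ ?_ ?_ ha
  · intro r; rw [map_zero]; exact zero_mem _
  · intro r hr
    rw [milgramLin_one, ← add_zero r]; exact lengthLE_tmul (weightLE_one hr) (weightLE_one le_rfl)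
  · intro r a b ha hb; rw [map_add]; exact add_mem ha hb
  · intro r x a ha; rw [map_smul]; exact Submodule.smul_mem _ _ ha
  · intro r w a _ ha
    rw [ι_eq_univTw, univTw_eq_letters, add_mul, add_mul, map_add, map_add, milgramLin_letterM_mul,
      zero_add, milgramLin_letterL_mul]
    refine add_mem ?_ ?_
    · refine (Submodule.span_le (p := (lengthLE R C C' (r + 1)).comap
        ((LinearMap.mulLeft R (univTw R _)).rTensor _))).2 ?_ ha
      rintro _ ⟨s, t, rfl, a, ha, b, hb, rfl⟩
      have := lengthLE_tmul (univTw_mul_mem (projL R C C' (desuspIncl R _ w)) ha) hb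
      rwa [add_right_comm] at this
    · refine gr_induction (R := R) (p := fun c => milgramLin R C C' (letterR R C C' c * a) ∈
        lengthLE R C C' (r + 1)) ?_ ?_ _
      · intro x y hx hy; rw [map_add, add_mul, map_add]; exact add_mem hx hy
      · intro j c hc
        rw [milgramLin_letterR_mul hc]
        refine (Submodule.span_le (p := (lengthLE R C C' (r + 1)).comap
          (TensorProduct.map (sgn R (j - 1)) (LinearMap.mulLeft R (univTw R c))))).2 ?_ ha
        rintro _ ⟨s, t, rfl, a, ha, b, hb, rfl⟩
        have := lengthLE_tmul (weightLE_sgn (j - 1) (fun w hw => by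
          rw [(Submodule.mem_bot R).1 hw, map_zero]; exact zero_mem _) ha) (univTw_mul_mem c hb)
        rwa [← add_assoc] at this
  · intro r w hw a _ _
    obtain ⟨h1, h2⟩ := mixed_proj hw
    rw [ι_eq_univTw, univTw_of_mixed h1 h2, milgramLin_letterM_mul]; exact zero_mem _

/-- The homotopy trades one right letter and one left letter for a single mixed letter, hence the
loss of two. -/
theorem cobarHomotopy_weight {r : ℤ} {a : Cobar R (C ⊗[R] C')}
    (ha : a ∈ weightLE (mixed R C C') r) :
    cobarHomotopy R C C' a ∈ weightLE (mixed R C C') (r - 2) := by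
  refine weightLE_induction (p := fun r a =>
    cobarHomotopy R C C' a ∈ weightLE (mixed R C C') (r - 2)) ?_ ?_ ?_ ?_ ?_ ?_ ha
  · intro r; rw [map_zero]; exact zero_mem _
  · intro r hr; rw [cobarHomotopy_one]; exact zero_mem _
  · intro r a b ha hb; rw [map_add]; exact add_mem ha hb
  · intro r x a ha; rw [map_smul]; exact Submodule.smul_mem _ _ ha
  · intro r w a ha' ha
    rw [ι_eq_univTw, cobarHomotopy_univTw_mul]
    refine sub_mem ?_ ?_
    · rw [show r + 1 - 2 = r - 1 by ring]; exact swapTensor_weight _ (milgramLin_weight ha')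
    · rw [add_sub_right_comm]; exact univTw_mul_mem _ ha
  · intro r w hw a _ ha
    obtain ⟨h1, h2⟩ := mixed_proj hw
    rw [ι_eq_univTw, cobarHomotopy_univTw_mul, h2, map_zero, LinearMap.zero_apply, zero_sub,
      univTw_sgn_of_mixed 1 h1 h2]
    exact neg_mem (letterM_mul_mem _ ha)

/-- The homotopy introduces a mixed letter into every term, and `q` is multiplicative and kills
mixed letters. -/
theorem milgramLin_cobarHomotopy (a : Cobar R (C ⊗[R] C')) :
    milgramLin R C C' (cobarHomotopy R C C' a) = 0 := by
  have hT : ∀ (c' : C') (y : Cobar R C ⊗[R] Cobar R C'),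
      milgramLin R C C' (swapTensor R C C' c' y) = 0 := by
    intro c' y
    refine gr_induction (R := R) (p := fun c' => milgramLin R C C' (swapTensor R C C' c' y) = 0)
      ?_ ?_ c'
    · intro a b ha hb; rw [map_add, LinearMap.add_apply, map_add, ha, hb, add_zero]
    intro j c' hc'
    induction y with
    | zero => simp
    | add x y hx hy => rw [map_add, map_add, hx, hy, add_zero]
    | tmul a b =>
      rw [swapTensor_tmul]
      refine cobar_induction (p := fun a =>
        milgramLin R C C' (swapHom R C C' c' a * cobarInr R C C' b) = 0) ?_ ?_ ?_ ?_ a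
      · rw [swapHom_at_one, zero_mul, map_zero]
      · intro a b ha hb; rw [map_add, add_mul, map_add, ha, hb, add_zero]
      · intro r a ha; rw [map_smul, smul_mul_assoc, map_smul, ha, smul_zero]
      · intro i c hc a ha
        rw [swapHom_univTw_mul hc hc', smul_mul_assoc, map_smul, add_mul, map_add, mul_assoc,
          mul_assoc, milgramLin_letterL_mul, milgramLin_letterM_mul, ha, map_zero, add_zero,
          smul_zero]
  refine cobar_induction (p := fun a => milgramLin R C C' (cobarHomotopy R C C' a) = 0)
    ?_ ?_ ?_ ?_ a
  · rw [cobarHomotopy_one, map_zero]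
  · intro a b ha hb; rw [map_add, map_add, ha, hb, add_zero]
  · intro r a ha; rw [map_smul, map_smul, ha, smul_zero]
  · intro i z _ a ha
    rw [cobarHomotopy_univTw_mul, map_sub, hT, milgramLin_mul, ha, map_zero, sub_zero]

/-! ### The remainder of the differential -/

variable (R C C') in
/-- The part of `univTw` given by unmixed letters. -/
def unmixedTw : C ⊗[R] C' →ₗ[R] Cobar R (C ⊗[R] C') :=
  letterL R C C' ∘ₗ projL R C C' + letterR R C C' ∘ₗ projR R C C'

theorem unmixedTw_tmul (c : C) (c' : C') : unmixedTw R C C' (c ⊗ₜ c') =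
    counit R c' • letterL R C C' c + counit R c • letterR R C C' c' := by
  simp [unmixedTw]

variable (R C C') in
/-- The part of `univTwSq` given by unmixed letters. -/
def unmixedTwSq : (C ⊗[R] C') ⊗[R] (C ⊗[R] C') →ₗ[R] Cobar R (C ⊗[R] C') :=
  LinearMap.mul' R _ ∘ₗ TensorProduct.map (unmixedTw R C C' ∘ₗ sgn R 1) (unmixedTw R C C')

/-- What is discarded are the products with at least one mixed factor, and these have at most one
unmixed letter. -/
theorem univTwSq_sub_unmixedTwSq (y : (C ⊗[R] C') ⊗[R] (C ⊗[R] C')) :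
    univTwSq R y - unmixedTwSq R C C' y ∈ weightLE (mixed R C C') 1 := by
  have hdec : ∀ z, univTw R z = letterM R C C' z + unmixedTw R C C' z := fun z => by
    rw [univTw_eq_letters, add_assoc]; rfl
  have hu : ∀ z, unmixedTw R C C' z ∈ weightLE (mixed R C C') 1 := fun z =>
    add_mem (univTw_mem_weightLE _) (univTw_mem_weightLE _)
  have hm : ∀ z, letterM R C C' z ∈ weightLE (mixed R C C') 0 := fun z => by
    simpa using letterM_mul_mem z (weightLE_one (U := mixed R C C') le_rfl)
  induction y with
  | zero => simp
  | add x y hx hy => rw [map_add, map_add, add_sub_add_comm]; exact add_mem hx hy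
  | tmul a b =>
    have : univTwSq R (a ⊗ₜ[R] b) - unmixedTwSq R C C' (a ⊗ₜ b) =
        letterM R C C' (sgn R 1 a) * univTw R b +
          unmixedTw R C C' (sgn R 1 a) * letterM R C C' b := by
      rw [univTwSq_tmul, unmixedTwSq, LinearMap.comp_apply, TensorProduct.map_tmul,
        LinearMap.mul'_apply, LinearMap.comp_apply, hdec, hdec]
      noncomm_ring
    rw [this]
    refine add_mem (letterM_mul_mem _ (univTw_mem_weightLE _)) ?_
    simpa using weightLE_mul (hu (sgn R 1 a)) (hm b)

theorem cobarInl_univTwSq_tmul (a b : C) : cobarInl R C C' (univTwSq R (a ⊗ₜ[R] b)) =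
    letterL R C C' (sgn R 1 a) * letterL R C C' b := by
  rw [univTwSq_tmul, map_mul, cobarInl_univTw, cobarInl_univTw]

theorem cobarInr_univTwSq_tmul (a b : C') : cobarInr R C C' (univTwSq R (a ⊗ₜ[R] b)) =
    letterR R C C' (sgn R 1 a) * letterR R C C' b := by
  rw [univTwSq_tmul, map_mul, cobarInr_univTw, cobarInr_univTw]

/-- Writing each unmixed letter as left plus right gives four products. Left-left and right-right
form the quadratic terms of `Ω C` and `Ω C'`, with the other factor collapsed by its counits.
Left-right and right-left pair one projection of `u` with the opposite one of `u'`. The statement is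
for arbitrary `u` and `u'`, so that the counit axioms are applied only afterwards. -/
theorem unmixedTwSq_midSwap (u : C ⊗[R] C) (u' : C' ⊗[R] C') :
    unmixedTwSq R C C' (midSwap R C C C' C' (u ⊗ₜ u')) =
      tensorCounit R C' C' u' • cobarInl R C C' (univTwSq R u) +
      tensorCounit R C C u • cobarInr R C C' (univTwSq R u') +
      (LinearMap.mul' R _ (TensorProduct.map (letterL R C C' ∘ₗ sgn R 1) (letterR R C C')
        (projL R C C u ⊗ₜ projR R C' C' u')) +
      LinearMap.mul' R _ (TensorProduct.map (letterR R C C' ∘ₗ sgn R 1) (letterL R C C')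
        (gswap R C C' (projR R C C u ⊗ₜ projL R C' C' u')))) := by
  induction u' with
  | zero => simp
  | add x y hx hy => simp only [TensorProduct.tmul_add, map_add, hx, hy, add_smul, smul_add]; abel
  | tmul c₀' c₁' =>
  induction u with
  | zero => simp
  | add x y hx hy => simp only [TensorProduct.add_tmul, map_add, hx, hy, add_smul, smul_add]; abel
  | tmul c₀ c₁ =>
  refine gr_induction (R := R) (p := fun c₁ =>
    unmixedTwSq R C C' (midSwap R C C C' C' ((c₀ ⊗ₜ c₁) ⊗ₜ (c₀' ⊗ₜ c₁'))) =
      tensorCounit R C' C' (c₀' ⊗ₜ c₁') • cobarInl R C C' (univTwSq R (c₀ ⊗ₜ[R] c₁)) +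
      tensorCounit R C C (c₀ ⊗ₜ c₁) • cobarInr R C C' (univTwSq R (c₀' ⊗ₜ[R] c₁')) +
      (LinearMap.mul' R _ (TensorProduct.map (letterL R C C' ∘ₗ sgn R 1) (letterR R C C')
        (projL R C C (c₀ ⊗ₜ c₁) ⊗ₜ projR R C' C' (c₀' ⊗ₜ c₁'))) +
      LinearMap.mul' R _ (TensorProduct.map (letterR R C C' ∘ₗ sgn R 1) (letterL R C C')
        (gswap R C C' (projR R C C (c₀ ⊗ₜ c₁) ⊗ₜ projL R C' C' (c₀' ⊗ₜ c₁')))))) ?_ ?_ c₁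
  · intro x y hx hy
    simp only [TensorProduct.add_tmul, TensorProduct.tmul_add, map_add, add_smul, smul_add]
      at hx hy ⊢
    rw [hx, hy]; abel
  intro j c₁ hc₁
  -- The factor `ε(c₁)` vanishes unless `c₁` has degree zero, so the interchange sign may be dropped
  -- next to it.
  have h1 : counit R c₁ • (letterR R C C' (sgn R 1 (sgn R j c₀')) * letterR R C C' c₁') =
      counit R c₁ • (letterR R C C' (sgn R 1 c₀') * letterR R C C' c₁') := by
    have := congrArg (fun x => letterR R C C' (sgn R 1 x) * letterR R C C' c₁')
      (counit_smul_sgn hc₁ c₀')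
    simpa only [map_smul, smul_mul_assoc] using this
  rw [midSwap_tmul _ hc₁, cobarInl_univTwSq_tmul, cobarInr_univTwSq_tmul]
  simp only [unmixedTwSq, LinearMap.comp_apply, TensorProduct.map_tmul, LinearMap.mul'_apply,
    sgn_tmul, unmixedTw_tmul, counit_sgn, projL_tmul, projR_tmul, gswap_tmul hc₁, map_smul,
    ← TensorProduct.smul_tmul', TensorProduct.tmul_smul, tensorCounit_tmul, mul_add, add_mul,
    smul_mul_assoc, mul_smul_comm, smul_smul]
  rw [mul_smul (counit R c₀) (counit R c₁), ← h1]
  module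

theorem projL_comul (c : C) : projL R C C (comul R c) = c := counit_right c

theorem projR_comul (c : C) : projR R C C (comul R c) = c := counit_left c

theorem tensorCounit_comul (c : C) : tensorCounit R C C (comul R c) = counit R c := by
  have h : ∀ y, tensorCounit R C C y = counit R (projR R C C y) := fun y => (counit_projR y).symm
  rw [h, projR_comul]

/-- By the counit axioms all projections of `Δ c` and `Δ c'` return `c` and `c'`, so the two cross
products of unmixed letters add up to `commGen`. -/
theorem unmixedTwSq_comul (z : C ⊗[R] C') : unmixedTwSq R C C' (comul R z) =
    cobarInl R C C' (univTwSq R (comul R (projL R C C' z))) +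
      cobarInr R C C' (univTwSq R (comul R (projR R C C' z))) + commGen R C C' z := by
  induction z with
  | zero => simp
  | add x y hx hy => simp only [map_add, hx, hy]; abel
  | tmul c c' =>
    have : comul R (c ⊗ₜ[R] c') = midSwap R C C C' C' (comul R c ⊗ₜ comul R c') := rfl
    rw [this, unmixedTwSq_midSwap, tensorCounit_comul, tensorCounit_comul, projL_comul,
      projR_comul, projL_comul, projR_comul, projL_tmul, projR_tmul, map_smul, map_smul, map_smul,
      map_smul, map_smul, map_smul]
    rfl

theorem commGen_weight (z : C ⊗[R] C') : commGen R C C' z ∈ weightLE (mixed R C C') 2 := by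
  suffices h : ⊤ ≤ (weightLE (mixed R C C') 2).comap (commGen R C C') from h Submodule.mem_top
  rintro z -
  rw [Submodule.mem_comap]
  refine gr_induction (R := R) (p := fun z => commGen R C C' z ∈ weightLE (mixed R C C') 2) ?_ ?_ z
  · intro x y hx hy; rw [map_add]; exact add_mem hx hy
  · intro n z hz
    induction hz using Submodule.span_induction with
    | mem z hz =>
      obtain ⟨i, j, rfl, c, hc, c', hc', rfl⟩ := hz
      rw [commGen_tmul hc hc']
      exact add_mem
        (Submodule.smul_mem _ _ (weightLE_mul (r := 1) (s := 1) (weightLE_ι _) (weightLE_ι _)))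
        (Submodule.smul_mem _ _ (weightLE_mul (r := 1) (s := 1) (weightLE_ι _) (weightLE_ι _)))
    | zero => rw [map_zero]; exact zero_mem _
    | add x y _ _ hx hy => rw [map_add]; exact add_mem hx hy
    | smul r x _ hx => rw [map_smul]; exact Submodule.smul_mem _ _ hx

theorem univTwSq_weight {U : Submodule R (DesuspCoideal R C)} (y : C ⊗[R] C) :
    univTwSq R y ∈ weightLE U 2 := by
  induction y with
  | zero => rw [map_zero]; exact zero_mem _
  | add x y hx hy => rw [map_add]; exact add_mem hx hy
  | tmul a b =>
    exact weightLE_mul (r := 1) (s := 1) (univTw_mem_weightLE _) (univTw_mem_weightLE _)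

/-- By the Leibniz rule only the first letter matters. An unmixed letter has weight one and its
image consists of at most two letters. For a mixed letter, of weight zero, the products of two
unmixed letters in the diagonal are exactly `commGen`, and subtracting it leaves weight at most one.
-/
theorem cobarD_sub_commD_weight {r : ℤ} {a : Cobar R (C ⊗[R] C')}
    (ha : a ∈ weightLE (mixed R C C') r) :
    cobarD R _ a - commD R C C' a ∈ weightLE (mixed R C C') (r + 1) := by
  have hmul : ∀ (z : C ⊗[R] C') (a : Cobar R (C ⊗[R] C')),
      cobarD R _ (univTw R z * a) - commD R C C' (univTw R z * a) =
        (- univTw R (d R z) + (univTwSq R (comul R z) - commGen R C C' z)) * a +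
          sgn R 1 (univTw R z) * (cobarD R _ a - commD R C C' a) := by
    intro z a
    rw [cobarD_mul, commD_mul, cobarD_univTw, commD_univTw]
    noncomm_ring
  refine weightLE_induction (p := fun r a =>
    cobarD R _ a - commD R C C' a ∈ weightLE (mixed R C C') (r + 1)) ?_ ?_ ?_ ?_ ?_ ?_ ha
  · intro r; rw [map_zero, map_zero, sub_zero]; exact zero_mem _
  · intro r hr; rw [cobarD_one, commD_one, sub_zero]; exact zero_mem _
  · intro r a b ha hb; rw [map_add, map_add, add_sub_add_comm]; exact add_mem ha hb
  · intro r x a ha; rw [map_smul, map_smul, ← smul_sub]; exact Submodule.smul_mem _ _ ha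
  · intro r w a ha' ha
    rw [ι_eq_univTw, hmul]
    refine add_mem ?_ ?_
    · rw [add_assoc, add_comm r]
      refine weightLE_mul (r := 2) (add_mem (neg_mem ?_) (sub_mem ?_ ?_)) ha'
      · exact weightLE_mono one_le_two (univTw_mem_weightLE _)
      · exact univTwSq_weight _
      · exact commGen_weight _
    · rw [sgn_univTw, smul_mul_assoc]
      exact Submodule.smul_mem _ _ (univTw_mul_mem _ ha)
  · intro r w hw a ha' ha
    obtain ⟨h1, h2⟩ := mixed_proj hw
    rw [ι_eq_univTw, hmul]
    refine add_mem ?_ ?_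
    · rw [add_comm r]
      refine weightLE_mul (add_mem (neg_mem (univTw_mem_weightLE _)) ?_) ha'
      -- Both projections of a mixed letter vanish, so the quadratic terms of `Ω C` and `Ω C'` drop
      -- out and `commGen` alone remains.
      have h3 := unmixedTwSq_comul (desuspIncl R _ w)
      rw [h1, h2, map_zero, map_zero, map_zero, map_zero, map_zero, map_zero, add_zero,
        zero_add] at h3
      rw [← h3]
      exact univTwSq_sub_unmixedTwSq _
    · rw [sgn_univTw, smul_mul_assoc, univTw_sgn_of_mixed 1 h1 h2]
      exact Submodule.smul_mem _ _ (letterM_mul_mem _ ha)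

end Weights

/-! ### The extension of Milgram's map to coHochschild complexes -/

section CohochMilgram

variable {R : Type u} [CommRing R]

theorem midSwap_midSwap {A B A' B' : Type*}
    [AddCommGroup A] [Module R A] [GrMod R A] [AddCommGroup B] [Module R B] [GrMod R B]
    [AddCommGroup A'] [Module R A'] [GrMod R A'] [AddCommGroup B'] [Module R B']
    (z : (A ⊗[R] B) ⊗[R] (A' ⊗[R] B')) :
    midSwap R A A' B B' (midSwap R A B A' B' z) = z := by
  refine mid_induction (R := R)
    (p := fun z => midSwap R A A' B B' (midSwap R A B A' B' z) = z) ?_ ?_ ?_ z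
  · simp
  · intro x y hx hy; simp only [map_add, hx, hy]
  · intro a j b hb a' b'
    refine gr_induction (R := R) (p := fun a' => midSwap R A A' B B' (midSwap R A B A' B'
      ((a ⊗ₜ b) ⊗ₜ (a' ⊗ₜ b'))) = (a ⊗ₜ b) ⊗ₜ (a' ⊗ₜ b')) ?_ ?_ a'
    · intro x y hx hy
      simp only [TensorProduct.add_tmul, TensorProduct.tmul_add, map_add, hx, hy]
    · intro k a' ha'
      rw [midSwap_tmul _ hb, midSwap_tmul _ (sgn_mem j ha'), sgn_apply j ha', sgn_apply k hb]
      simp only [TensorProduct.tmul_smul, ← TensorProduct.smul_tmul', smul_smul]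
      rw [mul_comm k j, ksign_mul_self, one_smul]

variable {C : Type*} [AddCommGroup C] [Module R C] [DGCoalg R C]
variable {C' : Type*} [AddCommGroup C'] [Module R C'] [DGCoalg R C']
variable {N : Type*} [AddCommGroup N] [Module R N] [DGMod R N]
variable {N' : Type*} [AddCommGroup N'] [Module R N'] [DGMod R N']

variable (R C C' N N') in
/-- `(x ⊗ x') ⊗ a ↦ ± (x ⊗ w) ⊗ (x' ⊗ w')`, where Milgram's map sends `a` to `w ⊗ w'`. -/
def cohochMilgramLin : (N ⊗[R] N') ⊗[R] Cobar R (C ⊗[R] C') →ₗ[R]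
    (N ⊗[R] Cobar R C) ⊗[R] (N' ⊗[R] Cobar R C') :=
  midSwap R N N' (Cobar R C) (Cobar R C') ∘ₗ (milgramLin R C C').lTensor (N ⊗[R] N')

theorem cohochMilgramLin_tmul (z : N ⊗[R] N') (a : Cobar R (C ⊗[R] C')) :
    cohochMilgramLin R C C' N N' (z ⊗ₜ a) =
      midSwap R N N' (Cobar R C) (Cobar R C') (z ⊗ₜ milgramLin R C C' a) := rfl

theorem hasDegree_cohochMilgramLin : HasDegree R 0 (cohochMilgramLin R C C' N N') := by
  have h1 : HasDegree R 0 (LinearMap.id : N ⊗[R] N' →ₗ[R] N ⊗[R] N') := fun n x hx => by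
    simpa using hx
  have h2 : HasDegree R 0 (milgramLin R C C') := fun n x hx => by
    rw [add_zero]; exact milgramLin_mem n x hx
  intro n z hz
  have h3 := hasDegree_map h1 h2 n z hz
  have h4 := hasDegree_midSwap (R := R) _ _ h3
  rwa [add_zero] at h4

theorem d_cohochMilgramLin (z : (N ⊗[R] N') ⊗[R] Cobar R (C ⊗[R] C')) :
    d R (cohochMilgramLin R C C' N N' z) = cohochMilgramLin R C C' N N' (d R z) := by
  have h : d R ((milgramLin R C C').lTensor (N ⊗[R] N') z) =
      (milgramLin R C C').lTensor (N ⊗[R] N') (d R z) :=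
    ((DGHom.id R (N ⊗[R] N')).tensor (milgram R C C')).comm z
  rw [cohochMilgramLin, LinearMap.comp_apply, LinearMap.comp_apply, d_midSwap, h]

theorem insertL_comp {D : Type*} [AddCommGroup D] [Module R D] [DGCoalg R D] {M : Type*}
    [AddCommGroup M] [Module R M] [DGMod R M] {p : ℤ} {c : D} (hc : c ∈ gr R D p) :
    insertL R D M ∘ₗ (TensorProduct.mk R D M c).rTensor (Cobar R D) =
      TensorProduct.map (sgn R (p - 1))
        (LinearMap.mulRight R (univTw R c) ∘ₗ sgn R (p - 1)) :=
  TensorProduct.ext' fun x w => insertL_tmul hc x w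

theorem tensor_insertL_tmul {p : ℤ} {c : C ⊗[R] C'} (hc : c ∈ gr R (C ⊗[R] C') p) (z : N ⊗[R] N')
    (a : Cobar R (C ⊗[R] C')) : insertL R (C ⊗[R] C') (N ⊗[R] N') ((c ⊗ₜ z) ⊗ₜ a) =
      sgn R (p - 1) z ⊗ₜ (sgn R (p - 1) a * univTw R c) := by
  have h : insertL R (C ⊗[R] C') (N ⊗[R] N') ∘ₗ
      (TensorProduct.mk R (C ⊗[R] C') (N ⊗[R] N') c).rTensor (Cobar R (C ⊗[R] C')) =
      TensorProduct.map (sgn R (p - 1))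
        (LinearMap.mulRight R (univTw R c) ∘ₗ sgn R (p - 1)) := insertL_comp hc
  have h2 := LinearMap.congr_fun h (z ⊗ₜ a)
  rwa [LinearMap.comp_apply, LinearMap.rTensor_tmul, TensorProduct.mk_apply,
    TensorProduct.map_tmul, LinearMap.comp_apply, LinearMap.mulRight_apply] at h2

/-- In contrast with `tensor_induction`, the relation `i + j = n` stays available; it is needed
where a sign depends on the total degree. -/
theorem gr_tensor_induction {A B : Type*} [AddCommGroup A] [Module R A] [GrMod R A]
    [AddCommGroup B] [Module R B] [GrMod R B] {p : A ⊗[R] B → Prop} (h0 : p 0)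
    (hadd : ∀ x y, p x → p y → p (x + y)) {n : ℤ}
    (h : ∀ i, ∀ a ∈ gr R A i, ∀ j, ∀ b ∈ gr R B j, i + j = n → p (a ⊗ₜ b)) {z : A ⊗[R] B}
    (hz : z ∈ gr R (A ⊗[R] B) n) : p z := by
  -- The predicate is not assumed stable under scalars, so all multiples are carried along and
  -- absorbed into the first tensor factor.
  suffices hs : ∀ r : R, p (r • z) by simpa using hs 1
  induction hz using Submodule.span_induction with
  | mem z hz =>
    obtain ⟨i, j, hij, a, ha, b, hb, rfl⟩ := hz
    intro r
    rw [TensorProduct.smul_tmul']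
    exact h i _ (Submodule.smul_mem _ _ ha) j b hb hij
  | zero => intro r; rw [smul_zero]; exact h0
  | add x y _ _ hx hy => intro r; rw [smul_add]; exact hadd _ _ (hx r) (hy r)
  | smul s x _ hx => intro r; rw [smul_smul]; exact hx _

theorem tensor_induction {A B : Type*} [AddCommGroup A] [Module R A] [GrMod R A]
    [AddCommGroup B] [Module R B] [GrMod R B] {p : A ⊗[R] B → Prop} (h0 : p 0)
    (hadd : ∀ x y, p x → p y → p (x + y))
    (h : ∀ i, ∀ a ∈ gr R A i, ∀ j, ∀ b ∈ gr R B j, p (a ⊗ₜ b)) (z : A ⊗[R] B) : p z :=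
  gr_induction (R := R) hadd
    (fun _ _ hx => gr_tensor_induction h0 hadd (fun i a ha j b hb _ => h i a ha j b hb) hx) z

/-- Milgram's map sends the letter `s⁻¹(c ⊗ c')` to a left part weighted by `ε(c')` and a right part
weighted by `ε(c)`. In the first summand `u'` is collapsed by the counit and `c` is inserted; in the
second the roles are exchanged. The operator `sgn R m` on `w` is the cost of moving `w` past the
factor of degree `m`. -/
theorem cohochMilgram_insertR_aux (u : N ⊗[R] C) {m : ℤ} {u' : N' ⊗[R] C'}
    (hu' : u' ∈ gr R (N' ⊗[R] C') m) (w : Cobar R C) (w' : Cobar R C')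
    (a : Cobar R (C ⊗[R] C')) (ha : milgramLin R C C' a = w ⊗ₜ w') :
    cohochMilgramLin R C C' N N'
      (insertR R (C ⊗[R] C') (N ⊗[R] N') (midSwap R N C N' C' (u ⊗ₜ u') ⊗ₜ a)) =
    insertR R C N (u ⊗ₜ sgn R m w) ⊗ₜ
        (TensorProduct.rid R N' ((counit R).lTensor N' u') ⊗ₜ w') +
      sgn R 1 (TensorProduct.rid R N ((counit R).lTensor N u) ⊗ₜ[R] sgn R m w) ⊗ₜ
        insertR R C' N' (u' ⊗ₜ w') := by
  have hw : ∀ {i : ℤ} {c : C}, c ∈ gr R C i → ∀ k, sgn R k (univTw R c) =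
      ksign R (k * (i - 1)) • univTw R c := fun {i c} hc k =>
    sgn_apply k (by simpa [sub_eq_add_neg] using hasDegree_univTw R i c hc)
  refine gr_tensor_induction (R := R) (p := fun u' => cohochMilgramLin R C C' N N'
      (insertR R (C ⊗[R] C') (N ⊗[R] N') (midSwap R N C N' C' (u ⊗ₜ u') ⊗ₜ a)) =
    insertR R C N (u ⊗ₜ sgn R m w) ⊗ₜ
        (TensorProduct.rid R N' ((counit R).lTensor N' u') ⊗ₜ w') +
      sgn R 1 (TensorProduct.rid R N ((counit R).lTensor N u) ⊗ₜ[R] sgn R m w) ⊗ₜ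
        insertR R C' N' (u' ⊗ₜ w')) ?_ ?_ ?_ hu'
  · simp
  · intro x y hx hy
    simp only [TensorProduct.add_tmul, TensorProduct.tmul_add, map_add, hx, hy]; abel
  intro k x' hx' p c' hc' hkp
  refine tensor_induction (R := R) (p := fun u => cohochMilgramLin R C C' N N'
      (insertR R (C ⊗[R] C') (N ⊗[R] N') (midSwap R N C N' C' (u ⊗ₜ (x' ⊗ₜ c')) ⊗ₜ a)) =
    insertR R C N (u ⊗ₜ sgn R m w) ⊗ₜ
        (TensorProduct.rid R N' ((counit R).lTensor N' (x' ⊗ₜ c')) ⊗ₜ w') +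
      sgn R 1 (TensorProduct.rid R N ((counit R).lTensor N u) ⊗ₜ[R] sgn R m w) ⊗ₜ
        insertR R C' N' ((x' ⊗ₜ c') ⊗ₜ w')) ?_ ?_ ?_ u
  · simp
  · intro x y hx hy
    simp only [TensorProduct.add_tmul, map_add, hx, hy]; abel
  intro i x hx j c hc
  -- The factor `ε(c')` forces `p = 0`, hence `k = m`. The signs from moving `c` past `x'`, from
  -- moving its letter past `x'`, and from `sgn R 1` on `x'` then multiply to one.
  have hA : counit R c' • ((sgn R 1 x ⊗ₜ[R] sgn R k (univTw R c * w)) ⊗ₜ[R]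
      (sgn R 1 (sgn R j x') ⊗ₜ[R] w')) =
      counit R c' • ((sgn R 1 x ⊗ₜ[R] (univTw R c * sgn R m w)) ⊗ₜ[R] (x' ⊗ₜ[R] w')) := by
    by_cases hp : p = 0
    · obtain rfl : k = m := by omega
      congr 1
      rw [sgn_talg_mul, hw hc, sgn_apply j hx', map_smul, sgn_apply 1 hx']
      simp only [smul_mul_assoc, TensorProduct.tmul_smul, ← TensorProduct.smul_tmul', smul_smul]
      rw [← ksign_add, ← ksign_add, ksign_even ⟨j * k, by ring⟩, one_smul]
    · rw [counit_of_ne p hp c' hc', zero_smul, zero_smul]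
  -- Here `ε(c)` forces `j = 0`, so the interchange of `c` and `x'` is free of signs.
  have hB : counit R c • ((sgn R 1 x ⊗ₜ[R] sgn R k (sgn R (p - 1) w)) ⊗ₜ[R]
      (sgn R 1 (sgn R j x') ⊗ₜ[R] (univTw R c' * w'))) =
      counit R c • ((sgn R 1 x ⊗ₜ[R] sgn R 1 (sgn R m w)) ⊗ₜ[R]
        (sgn R 1 x' ⊗ₜ[R] (univTw R c' * w'))) := by
    by_cases hj : j = 0
    · subst hj
      rw [sgn_apply 0 hx', zero_mul, ksign_zero, one_smul, ← sgn_add, ← sgn_add,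
        sgn_congr (k := k + (p - 1)) (l := 1 + m) (by rw [← hkp]; exact ⟨-1, by ring⟩)]
    · rw [counit_of_ne j hj c hc, zero_smul, zero_smul]
  have hmul : milgramLin R C C' (univTw R (c ⊗ₜ c') * a) =
      counit R c' • ((univTw R c * w) ⊗ₜ w') +
        counit R c • (sgn R (p - 1) w ⊗ₜ (univTw R c' * w')) := by
    have h0 : sgn R 0 w = w := by
      rw [sgn_congr (k := 0) (l := 1 + 1) (by decide), sgn_add, sgn_sgn]
    rw [milgramLin_univTw_mul, ha, milgramGen_tmul, map_add, LinearMap.add_apply,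
      TensorProduct.tmul_smul, map_smul, LinearMap.smul_apply,
      cobarTensorMul_tmul _ talg_one_mem, one_mul, h0, ← TensorProduct.smul_tmul', map_smul,
      LinearMap.smul_apply, cobarTensorMul_tmul _ (hasDegree_univTw R p c' hc'), one_mul,
      ← sub_eq_add_neg]
  rw [midSwap_tmul _ hc, insertR_tmul, cohochMilgramLin_tmul, hmul, TensorProduct.tmul_add, map_add,
    TensorProduct.tmul_smul, TensorProduct.tmul_smul, map_smul, map_smul, sgn_tmul,
    midSwap_tmul _ (sgn_mem 1 (sgn_mem j hx')), midSwap_tmul _ (sgn_mem 1 (sgn_mem j hx')), hA, hB,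
    insertR_tmul, insertR_tmul, sgn_tmul]
  simp only [LinearMap.lTensor_tmul, TensorProduct.rid_tmul, map_smul, TensorProduct.tmul_smul,
    ← TensorProduct.smul_tmul']

/-- The mechanism is that of `cohochMilgram_insertR_aux`, but the letter is now appended behind the
word. Its left part must move past `w'`, which is why `w'` has to be homogeneous. -/
theorem cohochMilgram_insertL_aux {n m l : ℤ} {u : C ⊗[R] N} (hu : u ∈ gr R (C ⊗[R] N) n)
    {u' : C' ⊗[R] N'}
    (hu' : u' ∈ gr R (C' ⊗[R] N') m) (w : Cobar R C) {w' : Cobar R C'}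
    (hw' : w' ∈ gr R (Cobar R C') l)
    (a : Cobar R (C ⊗[R] C')) (ha : milgramLin R C C' a = w ⊗ₜ w') :
    cohochMilgramLin R C C' N N'
      (insertL R (C ⊗[R] C') (N ⊗[R] N') (midSwap R C N C' N' (u ⊗ₜ u') ⊗ₜ a)) =
    insertL R C N (u ⊗ₜ sgn R m w) ⊗ₜ
        (TensorProduct.lid R N' ((counit R).rTensor N' u') ⊗ₜ w') +
      sgn R 1 (TensorProduct.lid R N ((counit R).rTensor N u) ⊗ₜ[R] sgn R m w) ⊗ₜ
        insertL R C' N' (u' ⊗ₜ w') := by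
  have hw : ∀ {i : ℤ} {c : C}, c ∈ gr R C i → ∀ k, sgn R k (univTw R c) =
      ksign R (k * (i - 1)) • univTw R c := fun {i c} hc k =>
    sgn_apply k (by simpa [sub_eq_add_neg] using hasDegree_univTw R i c hc)
  refine gr_tensor_induction (R := R) (p := fun u' => cohochMilgramLin R C C' N N'
      (insertL R (C ⊗[R] C') (N ⊗[R] N') (midSwap R C N C' N' (u ⊗ₜ u') ⊗ₜ a)) =
    insertL R C N (u ⊗ₜ sgn R m w) ⊗ₜ
        (TensorProduct.lid R N' ((counit R).rTensor N' u') ⊗ₜ w') +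
      sgn R 1 (TensorProduct.lid R N ((counit R).rTensor N u) ⊗ₜ[R] sgn R m w) ⊗ₜ
        insertL R C' N' (u' ⊗ₜ w')) ?_ ?_ ?_ hu'
  · simp
  · intro x y hx hy
    simp only [TensorProduct.add_tmul, TensorProduct.tmul_add, map_add, hx, hy]; abel
  intro p c' hc' k x' hx' hkp
  refine gr_tensor_induction (R := R) (p := fun u => cohochMilgramLin R C C' N N'
      (insertL R (C ⊗[R] C') (N ⊗[R] N') (midSwap R C N C' N' (u ⊗ₜ (c' ⊗ₜ x')) ⊗ₜ a)) =
    insertL R C N (u ⊗ₜ sgn R m w) ⊗ₜ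
        (TensorProduct.lid R N' ((counit R).rTensor N' (c' ⊗ₜ x')) ⊗ₜ w') +
      sgn R 1 (TensorProduct.lid R N ((counit R).rTensor N u) ⊗ₜ[R] sgn R m w) ⊗ₜ
        insertL R C' N' ((c' ⊗ₜ x') ⊗ₜ w')) ?_ ?_ ?_ hu
  · simp
  · intro x y hx hy
    simp only [TensorProduct.add_tmul, map_add, hx, hy]; abel
  intro j c hc i x hx _
  -- With `p = 0` forced by `ε(c')`, the operators of index `j - 1` on `x'` and `w'` cancel the sign
  -- of moving the letter of degree `j - 1` past both of them.
  have hA : counit R c' • ((sgn R (j + p - 1) x ⊗ₜ[R] sgn R k (sgn R (j + p - 1) w *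
        sgn R l (univTw R c))) ⊗ₜ[R] (sgn R (j + p - 1) x' ⊗ₜ[R] sgn R (j + p - 1) w')) =
      counit R c' • ((sgn R (j - 1) x ⊗ₜ[R] (sgn R (j - 1) (sgn R m w) * univTw R c)) ⊗ₜ[R]
        (x' ⊗ₜ[R] w')) := by
    by_cases hp : p = 0
    · subst hp
      obtain rfl : k = m := by omega
      congr 1
      rw [add_zero, sgn_talg_mul, hw hc, map_smul, hw hc, sgn_apply (j - 1) hx',
        sgn_apply (j - 1) hw', ← sgn_add, ← sgn_add, add_comm k]
      simp only [mul_smul_comm, TensorProduct.tmul_smul, ← TensorProduct.smul_tmul', smul_smul]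
      rw [← ksign_add, ← ksign_add, ← ksign_add, ksign_even ⟨(j - 1) * (k + l), by ring⟩, one_smul]
    · rw [counit_of_ne p hp c' hc', zero_smul, zero_smul]
  -- With `j = 0` forced by `ε(c)`, the interchange sign `(-1)^(ip)` combines with `sgn R (p - 1)`
  -- on `x` into `sgn R 1`.
  have hB : counit R c • ksign R (i * p) • ((sgn R (j + p - 1) x ⊗ₜ[R]
        sgn R k (sgn R (j + p - 1) w)) ⊗ₜ[R]
        (sgn R (j + p - 1) x' ⊗ₜ[R] (sgn R (j + p - 1) w' * univTw R c'))) =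
      counit R c • ((sgn R 1 x ⊗ₜ[R] sgn R 1 (sgn R m w)) ⊗ₜ[R]
        (sgn R (p - 1) x' ⊗ₜ[R] (sgn R (p - 1) w' * univTw R c'))) := by
    by_cases hj : j = 0
    · subst hj
      congr 1
      rw [zero_add, sgn_apply (p - 1) hx, sgn_apply 1 hx, ← sgn_add, ← sgn_add,
        sgn_congr (k := k + (p - 1)) (l := 1 + m) (by rw [← hkp]; exact ⟨-1, by ring⟩)]
      simp only [← TensorProduct.smul_tmul', smul_smul]
      congr 1
      rw [← ksign_add]
      exact ksign_congr ⟨i * p - i, by ring⟩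
    · rw [counit_of_ne j hj c hc, zero_smul, zero_smul]
  have hmul : milgramLin R C C' (sgn R (j + p - 1) a * univTw R (c ⊗ₜ c')) =
      counit R c' • ((sgn R (j + p - 1) w * sgn R l (univTw R c)) ⊗ₜ sgn R (j + p - 1) w') +
        counit R c • (sgn R (j + p - 1) w ⊗ₜ (sgn R (j + p - 1) w' * univTw R c')) := by
    rw [milgramLin_mul, ← sgn_milgramLin, milgramLin_univTw, ha, sgn_tmul, milgramGen_tmul, map_add,
      TensorProduct.tmul_smul, map_smul,
      cobarTensorMul_tmul _ (sgn_mem _ hw'), mul_one, ← TensorProduct.smul_tmul', map_smul,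
      cobarTensorMul_tmul _ (sgn_mem _ hw'), sgn_talg_one, mul_one]
  -- The interchange sign is invisible next to `ε(c')`, which vanishes unless `p = 0`.
  have hc1 : counit R c' • ksign R (i * p) = counit R c' := by
    by_cases hp : p = 0
    · subst hp; simp
    · rw [counit_of_ne p hp c' hc', zero_smul]
  rw [midSwap_tmul _ hx, sgn_apply i hc', TensorProduct.tmul_smul, ← TensorProduct.smul_tmul',
    ← TensorProduct.smul_tmul', map_smul, map_smul, tensor_insertL_tmul (tmul_mem hc hc'),
    cohochMilgramLin_tmul, hmul, TensorProduct.tmul_add, map_add,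
    TensorProduct.tmul_smul, TensorProduct.tmul_smul, map_smul, map_smul, sgn_tmul,
    midSwap_tmul _ (sgn_mem _ hx'), midSwap_tmul _ (sgn_mem _ hx'), smul_add,
    smul_comm _ (counit R c), hB, smul_smul, mul_comm, ← smul_eq_mul, hc1, hA,
    insertL_tmul hc, insertL_tmul hc', sgn_tmul]
  simp only [LinearMap.rTensor_tmul, TensorProduct.lid_tmul, map_smul, TensorProduct.tmul_smul,
    ← TensorProduct.smul_tmul']

/-- The kernel of Milgram's map is a two-sided ideal, so inserting a letter at either end of a word
in the kernel stays in the kernel; the same applies to `insertL`. -/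
theorem cohochMilgram_insertR_eq_zero (y : (N ⊗[R] N') ⊗[R] (C ⊗[R] C'))
    {b : Cobar R (C ⊗[R] C')} (hb : milgramLin R C C' b = 0) :
    cohochMilgramLin R C C' N N' (insertR R (C ⊗[R] C') (N ⊗[R] N') (y ⊗ₜ b)) = 0 := by
  induction y with
  | zero => simp
  | add x y hx hy => rw [TensorProduct.add_tmul, map_add, map_add, hx, hy, add_zero]
  | tmul z c =>
    rw [insertR_tmul, cohochMilgramLin_tmul, milgramLin_mul, hb, map_zero, TensorProduct.tmul_zero,
      map_zero]

theorem cohochMilgram_insertL_eq_zero (y : (C ⊗[R] C') ⊗[R] (N ⊗[R] N'))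
    {b : Cobar R (C ⊗[R] C')} (hb : milgramLin R C C' b = 0) :
    cohochMilgramLin R C C' N N' (insertL R (C ⊗[R] C') (N ⊗[R] N') (y ⊗ₜ b)) = 0 := by
  refine tmul_induction_left (R := R) (p := fun y =>
    cohochMilgramLin R C C' N N' (insertL R (C ⊗[R] C') (N ⊗[R] N') (y ⊗ₜ b)) = 0) ?_ ?_ ?_ y
  · simp
  · intro x y hx hy; rw [TensorProduct.add_tmul, map_add, map_add, hx, hy, add_zero]
  · intro i c hc z
    rw [tensor_insertL_tmul hc, cohochMilgramLin_tmul, milgramLin_mul, ← sgn_milgramLin, hb,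
      map_zero, map_zero, LinearMap.zero_apply, TensorProduct.tmul_zero, map_zero]

variable [DGBicomod R C N] [DGBicomod R C' N']

/-- `f - g + h` -/
def subAdd {K L : Type*} [AddCommGroup K] [Module R K] [AddCommGroup L] [Module R L]
    (f g h : K →ₗ[R] L) : K →ₗ[R] L := f - g + h

theorem cohochD_eq {D : Type*} [AddCommGroup D] [Module R D] [DGCoalg R D] {M : Type*}
    [AddCommGroup M] [Module R M] [DGMod R M] [DGBicomod R D M] : cohochD R D M =
    subAdd (d R) (insertR R D M ∘ₗ (coactR R D).rTensor (Cobar R D))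
      (insertL R D M ∘ₗ (coactL R D).rTensor (Cobar R D)) :=
  TensorProduct.ext' cohochD_tmul

theorem tensor_cohochD_tmul (z : N ⊗[R] N') (a : Cobar R (C ⊗[R] C')) :
    cohochD R (C ⊗[R] C') (N ⊗[R] N') (z ⊗ₜ a) = d R (z ⊗ₜ[R] a) -
      insertR R (C ⊗[R] C') (N ⊗[R] N') (coactR R (C ⊗[R] C') z ⊗ₜ a) +
      insertL R (C ⊗[R] C') (N ⊗[R] N') (coactL R (C ⊗[R] C') z ⊗ₜ a) := by
  have h : cohochD R (C ⊗[R] C') (N ⊗[R] N') = subAdd (d R)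
      (insertR R (C ⊗[R] C') (N ⊗[R] N') ∘ₗ (coactR R (C ⊗[R] C')).rTensor _)
      (insertL R (C ⊗[R] C') (N ⊗[R] N') ∘ₗ (coactL R (C ⊗[R] C')).rTensor _) := cohochD_eq
  rw [h, subAdd, LinearMap.add_apply, LinearMap.sub_apply, LinearMap.comp_apply,
    LinearMap.comp_apply, LinearMap.rTensor_tmul, LinearMap.rTensor_tmul]

variable (R C C' N N') in
/-- The differential of the tensor product of two coHochschild complexes. -/
def cohochTensorD : (N ⊗[R] Cobar R C) ⊗[R] (N' ⊗[R] Cobar R C') →ₗ[R]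
    (N ⊗[R] Cobar R C) ⊗[R] (N' ⊗[R] Cobar R C') :=
  TensorProduct.map (cohochD R C N) LinearMap.id +
    TensorProduct.map (sgn R 1) (cohochD R C' N')

theorem cohochTensorD_tmul (y : N ⊗[R] Cobar R C) (y' : N' ⊗[R] Cobar R C') :
    cohochTensorD R C C' N N' (y ⊗ₜ y') =
      cohochD R C N y ⊗ₜ y' + sgn R 1 y ⊗ₜ cohochD R C' N' y' := rfl

/-- The word may be taken either in the kernel of Milgram's map or in the image of its section,
since the two span. On the kernel both sides vanish. On the image `q a` may be taken to be a single
homogeneous tensor, so the two insertion formulas apply, and the counit axioms turn the collapsed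
coactions into `x` and `x'`. -/
theorem cohochMilgram_comm (z : (N ⊗[R] N') ⊗[R] Cobar R (C ⊗[R] C')) :
    cohochTensorD R C C' N N' (cohochMilgramLin R C C' N N' z) =
    cohochMilgramLin R C C' N N' (cohochD R (C ⊗[R] C') (N ⊗[R] N') z) := by
  suffices h : ∀ n, ∀ x ∈ gr R N n, ∀ m, ∀ x' ∈ gr R N' m, ∀ a : Cobar R (C ⊗[R] C'),
      cohochTensorD R C C' N N'
        (cohochMilgramLin R C C' N N' ((x ⊗ₜ x') ⊗ₜ a)) =
      cohochMilgramLin R C C' N N' (cohochD R (C ⊗[R] C') (N ⊗[R] N') ((x ⊗ₜ x') ⊗ₜ a)) by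
    induction z with
    | zero => simp
    | add x y hx hy => rw [map_add, map_add, hx, hy, map_add, map_add]
    | tmul z a =>
      refine tensor_induction (R := R) (p := fun z =>
        cohochTensorD R C C' N N'
          (cohochMilgramLin R C C' N N' (z ⊗ₜ a)) =
        cohochMilgramLin R C C' N N' (cohochD R (C ⊗[R] C') (N ⊗[R] N') (z ⊗ₜ a))) ?_ ?_ ?_ z
      · simp
      · intro x y hx hy; rw [TensorProduct.add_tmul, map_add, map_add, hx, hy, map_add, map_add]
      · intro n x hx m x' hx'; exact h n x hx m x' hx' a
  intro n x hx m x' hx' a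
  have hzero : ∀ b, milgramLin R C C' b = 0 →
      cohochTensorD R C C' N N'
        (cohochMilgramLin R C C' N N' ((x ⊗ₜ x') ⊗ₜ b)) =
      cohochMilgramLin R C C' N N' (cohochD R (C ⊗[R] C') (N ⊗[R] N') ((x ⊗ₜ x') ⊗ₜ b)) := by
    intro b hb
    have h0 : cohochMilgramLin R C C' N N' ((x ⊗ₜ x') ⊗ₜ b) = 0 := by
      rw [cohochMilgramLin_tmul, hb, TensorProduct.tmul_zero, map_zero]
    rw [tensor_cohochD_tmul, map_add, map_sub, cohochMilgram_insertR_eq_zero _ hb,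
      cohochMilgram_insertL_eq_zero _ hb, ← d_cohochMilgramLin, h0, map_zero, map_zero, sub_zero,
      add_zero]
  -- Any `a` is `s (q a)` plus an element of the kernel, and the kernel has just been settled.
  suffices hs : ∀ y, cohochTensorD R C C' N N'
        (cohochMilgramLin R C C' N N' ((x ⊗ₜ x') ⊗ₜ milgramSection R C C' y)) =
      cohochMilgramLin R C C' N N' (cohochD R (C ⊗[R] C') (N ⊗[R] N')
        ((x ⊗ₜ x') ⊗ₜ milgramSection R C C' y)) by
    have h1 := hzero (a - milgramSection R C C' (milgramLin R C C' a))
      (by rw [map_sub, milgramLin_milgramSection, sub_self])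
    have h2 := hs (milgramLin R C C' a)
    rw [TensorProduct.tmul_sub, map_sub, map_sub, map_sub, map_sub, h2] at h1
    exact sub_left_injective h1
  intro y
  refine tensor_induction (R := R) (p := fun y =>
    cohochTensorD R C C' N N'
        (cohochMilgramLin R C C' N N' ((x ⊗ₜ x') ⊗ₜ milgramSection R C C' y)) =
      cohochMilgramLin R C C' N N' (cohochD R (C ⊗[R] C') (N ⊗[R] N')
        ((x ⊗ₜ x') ⊗ₜ milgramSection R C C' y))) ?_ ?_ ?_ y
  · simp
  · intro y y' h h'
    simp only [map_add, TensorProduct.tmul_add] at h h' ⊢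
    rw [h, h']
  intro k w hw l w' hw'
  have hq := milgramLin_milgramSection (w ⊗ₜ[R] w')
  have hR : coactR R (C ⊗[R] C') (x ⊗ₜ[R] x') =
      midSwap R N C N' C' (coactR R C x ⊗ₜ coactR R C' x') := rfl
  have hL : coactL R (C ⊗[R] C') (x ⊗ₜ[R] x') =
      midSwap R C N C' N' (coactL R C x ⊗ₜ coactL R C' x') := rfl
  rw [tensor_cohochD_tmul, map_add, map_sub, ← d_cohochMilgramLin, hR, hL,
    cohochMilgram_insertR_aux _ (coactR_mem m x' hx') w w' _ hq,
    cohochMilgram_insertL_aux (coactL_mem n x hx) (coactL_mem m x' hx') w hw' _ hq,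
    counitL, counitL, counitR, counitR, cohochMilgramLin_tmul, hq, midSwap_tmul _ hx', d_tmul,
    cohochTensorD_tmul, cohochD_tmul, cohochD_tmul]
  simp only [TensorProduct.add_tmul, TensorProduct.tmul_add, TensorProduct.sub_tmul,
    TensorProduct.tmul_sub]
  abel

end CohochMilgram

/-! ### The contraction for coHochschild complexes -/

section CohochContraction

variable {R : Type u} [CommRing R]

/-! ### The weight filtration on coHochschild complexes. -/

section Filtration

variable {D : Type*} [AddCommGroup D] [Module R D] [DGCoalg R D]
variable {M : Type*} [AddCommGroup M] [Module R M]

variable (M) in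
/-- The filtration of `M ⊗ Ω D` induced by `weightLE U`. -/
def tensorWeightLE (U : Submodule R (DesuspCoideal R D)) (r : ℤ) : Submodule R (M ⊗[R] Cobar R D) :=
  Submodule.span R {z | ∃ x : M, ∃ a ∈ weightLE U r, x ⊗ₜ[R] a = z}

variable {U : Submodule R (DesuspCoideal R D)}

theorem tmul_mem_tensorWeightLE {r : ℤ} (x : M) {a : Cobar R D} (ha : a ∈ weightLE U r) :
    x ⊗ₜ[R] a ∈ tensorWeightLE M U r := Submodule.subset_span ⟨x, a, ha, rfl⟩

theorem map_mem_tensorWeightLE {P : Type*} [AddCommGroup P] [Module R P] {r : ℤ}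
    {G : Submodule R P} {f : M ⊗[R] Cobar R D →ₗ[R] P}
    (h : ∀ x, ∀ a ∈ weightLE U r, f (x ⊗ₜ a) ∈ G) {z : M ⊗[R] Cobar R D}
    (hz : z ∈ tensorWeightLE M U r) : f z ∈ G := by
  refine (Submodule.span_le (p := G.comap f)).2 ?_ hz
  rintro _ ⟨x, a, ha, rfl⟩
  exact h x a ha

theorem exists_tensorWeightLE (z : M ⊗[R] Cobar R D) : ∃ r, z ∈ tensorWeightLE M U r := by
  have mono : ∀ {r s}, r ≤ s → ∀ z ∈ tensorWeightLE M U r, z ∈ tensorWeightLE M U s :=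
    fun hrs z hz => map_mem_tensorWeightLE (f := LinearMap.id)
      (fun x a ha => tmul_mem_tensorWeightLE x (weightLE_mono hrs ha)) hz
  induction z with
  | zero => exact ⟨0, zero_mem _⟩
  | add x y hx hy =>
    obtain ⟨r, hr⟩ := hx
    obtain ⟨s, hs⟩ := hy
    exact ⟨max r s, add_mem (mono (le_max_left _ _) _ hr) (mono (le_max_right _ _) _ hs)⟩
  | tmul x a =>
    obtain ⟨r, hr⟩ := exists_weightLE U a
    exact ⟨r, tmul_mem_tensorWeightLE x hr⟩

theorem tensorWeightLE_neg {r : ℤ} (hr : r < 0) {z : M ⊗[R] Cobar R D}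
    (hz : z ∈ tensorWeightLE M U r) : z = 0 := by
  have : LinearMap.id z ∈ (⊥ : Submodule R (M ⊗[R] Cobar R D)) :=
    map_mem_tensorWeightLE (fun x a ha => by
      rw [weightLE_neg hr ha, TensorProduct.tmul_zero]; exact zero_mem _) hz
  exact (Submodule.mem_bot R).1 this

/-- The differential of `M` adds no letter and each coaction term adds one. To leading order in the
weight the differential is therefore `±1 ⊗ E`, where `E` approximates the cobar differential. -/
theorem cohochD_sub_weight [DGMod R M] [DGBicomod R D M] {E : Cobar R D →ₗ[R] Cobar R D}
    (hU : ∀ k, ∀ w ∈ U, sgn R k w ∈ U)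
    (hE : ∀ r, ∀ a ∈ weightLE U r, cobarD R D a - E a ∈ weightLE U (r + 1)) {r : ℤ}
    {z : M ⊗[R] Cobar R D} (hz : z ∈ tensorWeightLE M U r) :
    cohochD R D M z - TensorProduct.map (sgn R 1) E z ∈ tensorWeightLE M U (r + 1) := by
  refine map_mem_tensorWeightLE (f := cohochD R D M - TensorProduct.map (sgn R 1) E) ?_ hz
  intro x a ha
  have hR : ∀ y : M ⊗[R] D, insertR R D M (y ⊗ₜ a) ∈ tensorWeightLE M U (r + 1) := by
    intro y
    induction y with
    | zero => simp
    | add x y hx hy => rw [TensorProduct.add_tmul, map_add]; exact add_mem hx hy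
    | tmul x c => rw [insertR_tmul]; exact tmul_mem_tensorWeightLE _ (univTw_mul_mem c ha)
  have hL : ∀ y : D ⊗[R] M, insertL R D M (y ⊗ₜ a) ∈ tensorWeightLE M U (r + 1) := by
    intro y
    refine tmul_induction_left (R := R)
      (p := fun y => insertL R D M (y ⊗ₜ a) ∈ tensorWeightLE M U (r + 1)) ?_ ?_ ?_ y
    · simp
    · intro x y hx hy; rw [TensorProduct.add_tmul, map_add]; exact add_mem hx hy
    · intro i c hc x
      rw [insertL_tmul hc]
      exact tmul_mem_tensorWeightLE _
        (weightLE_mul (weightLE_sgn _ (hU _) ha) (univTw_mem_weightLE c))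
  have : (cohochD R D M - TensorProduct.map (sgn R 1) E :
      M ⊗[R] Cobar R D →ₗ[R] M ⊗[R] Cobar R D) (x ⊗ₜ[R] a) =
      d R x ⊗ₜ a + sgn R 1 x ⊗ₜ (cobarD R D a - E a) - insertR R D M (coactR R D x ⊗ₜ a) +
        insertL R D M (coactL R D x ⊗ₜ a) := by
    rw [LinearMap.sub_apply, cohochD_tmul, d_tmul, TensorProduct.map_tmul, TensorProduct.tmul_sub,
      d_cobar]
    abel
  rw [this]
  exact add_mem (sub_mem (add_mem
    (tmul_mem_tensorWeightLE _ (weightLE_mono (by omega) ha))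
    (tmul_mem_tensorWeightLE _ (hE r a ha))) (hR _)) (hL _)

/-- The maps `f` and `g` differ on `p` by elements of `q`. -/
def CongrOn {K L : Type*} [AddCommGroup K] [Module R K] [AddCommGroup L] [Module R L]
    (f g : K →ₗ[R] L) (p : Submodule R K) (q : Submodule R L) : Prop := ∀ z ∈ p, f z - g z ∈ q

theorem cohochD_congrOn [DGMod R M] [DGBicomod R D M] {E : Cobar R D →ₗ[R] Cobar R D}
    (hU : ∀ k, ∀ w ∈ U, sgn R k w ∈ U)
    (hE : ∀ r, ∀ a ∈ weightLE U r, cobarD R D a - E a ∈ weightLE U (r + 1)) (r : ℤ) :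
    CongrOn (cohochD R D M) (TensorProduct.map (sgn R 1) E) (tensorWeightLE M U r)
      (tensorWeightLE M U (r + 1)) := fun _ hz => cohochD_sub_weight hU hE hz

end Filtration

variable (C : Type*) [AddCommGroup C] [Module R C] [DGCoalg R C]
variable (C' : Type*) [AddCommGroup C'] [Module R C'] [DGCoalg R C']
variable (N : Type*) [AddCommGroup N] [Module R N] [DGMod R N]
variable (N' : Type*) [AddCommGroup N'] [Module R N'] [DGMod R N']

theorem mixed_sgn (k : ℤ) {w : DesuspCoideal R (C ⊗[R] C')} (hw : w ∈ mixed R C C') :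
    sgn R k w ∈ mixed R C C' := by
  have h : ∀ w, desuspIncl R (C ⊗[R] C') (sgn R k w) =
      ksign R k • sgn R k (desuspIncl R (C ⊗[R] C') w) := by
    intro w
    have hd : HasDegree R 1 (desuspIncl R (C ⊗[R] C')) := fun n x hx => hx
    rw [hd.sgn_comm, mul_one, ksign_smul_self]
  obtain ⟨h1, h2⟩ := mixed_proj hw
  rw [mixed, Submodule.mem_inf, LinearMap.mem_ker, LinearMap.mem_ker, LinearMap.comp_apply,
    LinearMap.comp_apply, h, map_smul, map_smul, projL_sgn, projR_sgn, h1, h2]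
  simp

variable (R) in
/-- A linear section of `cohochMilgramLin`. -/
def cohochSection : (N ⊗[R] Cobar R C) ⊗[R] (N' ⊗[R] Cobar R C') →ₗ[R]
    (N ⊗[R] N') ⊗[R] Cobar R (C ⊗[R] C') :=
  (milgramSection R C C').lTensor (N ⊗[R] N') ∘ₗ midSwap R N (Cobar R C) N' (Cobar R C')

variable (R) in
/-- The homotopy `x ⊗ a ↦ (-1)^|x| x ⊗ h a`. -/
def cohochHomotopy : (N ⊗[R] N') ⊗[R] Cobar R (C ⊗[R] C') →ₗ[R]
    (N ⊗[R] N') ⊗[R] Cobar R (C ⊗[R] C') :=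
  TensorProduct.map (sgn R 1) (cobarHomotopy R C C')

variable {C C' N N'}

theorem hasDegree_cohochSection : HasDegree R 0 (cohochSection R C C' N N') := by
  have h1 : HasDegree R 0 (LinearMap.id : N ⊗[R] N' →ₗ[R] N ⊗[R] N') := fun n x hx => by
    simpa using hx
  intro n z hz
  have h3 := hasDegree_midSwap (R := R) n z hz
  have h4 := hasDegree_map h1 (hasDegree_milgramSection (R := R) (C := C) (C' := C')) _ _ h3
  rwa [add_zero] at h4

theorem hasDegree_cohochHomotopy : HasDegree R 1 (cohochHomotopy R C C' N N') := by
  refine hasDegree_tensor fun i x hx j a ha => ?_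
  exact tmul_mem' (sgn_mem 1 hx) (hasDegree_cobarHomotopy j a ha) (by ring)

theorem cohochMilgramLin_section (y : (N ⊗[R] Cobar R C) ⊗[R] (N' ⊗[R] Cobar R C')) :
    cohochMilgramLin R C C' N N' (cohochSection R C C' N N' y) = y := by
  have h : ∀ z : (N ⊗[R] N') ⊗[R] (Cobar R C ⊗[R] Cobar R C'),
      (milgramLin R C C').lTensor (N ⊗[R] N') ((milgramSection R C C').lTensor (N ⊗[R] N') z) =
        z := by
    intro z
    rw [← LinearMap.comp_apply, ← LinearMap.lTensor_comp]
    have : milgramLin R C C' ∘ₗ milgramSection R C C' = LinearMap.id :=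
      LinearMap.ext milgramLin_milgramSection
    rw [this, LinearMap.lTensor_id, LinearMap.id_apply]
  rw [cohochSection, cohochMilgramLin, LinearMap.comp_apply, LinearMap.comp_apply, h,
    midSwap_midSwap]

theorem cohochSection_milgramLin (z : (N ⊗[R] N') ⊗[R] Cobar R (C ⊗[R] C')) :
    cohochSection R C C' N N' (cohochMilgramLin R C C' N N' z) =
      (milgramSection R C C' ∘ₗ milgramLin R C C').lTensor (N ⊗[R] N') z := by
  rw [cohochSection, cohochMilgramLin, LinearMap.comp_apply, LinearMap.comp_apply, midSwap_midSwap,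
    ← LinearMap.comp_apply, ← LinearMap.lTensor_comp]

theorem cohochMilgramLin_homotopy (z : (N ⊗[R] N') ⊗[R] Cobar R (C ⊗[R] C')) :
    cohochMilgramLin R C C' N N' (cohochHomotopy R C C' N N' z) = 0 := by
  induction z with
  | zero => simp
  | add x y hx hy => rw [map_add, map_add, hx, hy, add_zero]
  | tmul z a =>
    rw [cohochHomotopy, TensorProduct.map_tmul, cohochMilgramLin_tmul, milgramLin_cobarHomotopy,
      TensorProduct.tmul_zero, map_zero]

theorem cohochHomotopy_weight {r : ℤ} {z : (N ⊗[R] N') ⊗[R] Cobar R (C ⊗[R] C')}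
    (hz : z ∈ tensorWeightLE (N ⊗[R] N') (mixed R C C') r) :
    cohochHomotopy R C C' N N' z ∈ tensorWeightLE (N ⊗[R] N') (mixed R C C') (r - 2) :=
  map_mem_tensorWeightLE (fun _ _ ha => tmul_mem_tensorWeightLE _ (cobarHomotopy_weight ha)) hz

/-- Both maps carry the sign operator on the coefficients, and it squares to one, so the identity is
`cobarHomotopy_comm` with coefficients. -/
theorem cohochHomotopy_comm (z : (N ⊗[R] N') ⊗[R] Cobar R (C ⊗[R] C')) :
    TensorProduct.map (sgn R 1) (commD R C C') (cohochHomotopy R C C' N N' z) +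
      cohochHomotopy R C C' N N' (TensorProduct.map (sgn R 1) (commD R C C') z) =
    z - cohochSection R C C' N N' (cohochMilgramLin R C C' N N' z) := by
  rw [cohochSection_milgramLin]
  induction z with
  | zero => simp
  | add x y hx hy =>
    simp only [map_add]
    rw [add_add_add_comm, hx, hy]; abel
  | tmul z a =>
    rw [cohochHomotopy, TensorProduct.map_tmul, TensorProduct.map_tmul, TensorProduct.map_tmul,
      TensorProduct.map_tmul, sgn_sgn, ← TensorProduct.tmul_add, cobarHomotopy_comm,
      TensorProduct.tmul_sub, LinearMap.lTensor_tmul, LinearMap.comp_apply]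

variable [DGBicomod R C N] [DGBicomod R C' N']

/-- If the differential were `±1 ⊗ commD`, the expression would vanish. Replacing one by the other
makes an error raising the weight by at most one, before or after `h`, which lowers it by two; both
errors land in weight `r - 1`. -/
theorem cohochHomotopy_defect {r : ℤ} {z : (N ⊗[R] N') ⊗[R] Cobar R (C ⊗[R] C')}
    (hz : z ∈ tensorWeightLE (N ⊗[R] N') (mixed R C C') r) :
    z - cohochD R (C ⊗[R] C') (N ⊗[R] N') (cohochHomotopy R C C' N N' z) -
      cohochHomotopy R C C' N N' (cohochD R (C ⊗[R] C') (N ⊗[R] N') z) -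
      cohochSection R C C' N N' (cohochMilgramLin R C C' N N' z) ∈
      tensorWeightLE (N ⊗[R] N') (mixed R C C') (r - 1) := by
  have hU : ∀ k, ∀ w ∈ mixed R C C', sgn R k w ∈ mixed R C C' := fun k w hw =>
    mixed_sgn C C' k hw
  have hE : ∀ r, ∀ a ∈ weightLE (mixed R C C') r,
      cobarD R (C ⊗[R] C') a - commD R C C' a ∈ weightLE (mixed R C C') (r + 1) :=
    fun r a ha => cobarD_sub_commD_weight ha
  have h0 : ∀ r, CongrOn (cohochD R (C ⊗[R] C') (N ⊗[R] N'))
      (TensorProduct.map (sgn R 1) (commD R C C')) (tensorWeightLE (N ⊗[R] N') (mixed R C C') r)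
      (tensorWeightLE (N ⊗[R] N') (mixed R C C') (r + 1)) := cohochD_congrOn hU hE
  have h1 := h0 _ _ (cohochHomotopy_weight hz)
  have h2 := cohochHomotopy_weight (h0 _ _ hz)
  rw [show r - 2 + 1 = r - 1 by ring] at h1
  rw [show r + 1 - 2 = r - 1 by ring, map_sub] at h2
  have h3 := neg_mem (add_mem h1 h2)
  have h4 := eq_add_of_sub_eq (cohochHomotopy_comm z).symm
  -- Once `z` is rewritten through the exact identity for `commD`, the defect equals minus the sum
  -- of the two errors.
  convert h3 using 1
  nth_rewrite 1 [h4]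
  abel

end CohochContraction

/-! ### The contraction as maps of coHochschild complexes -/

section CohochPreContraction

variable {R : Type u} [CommRing R]
variable {C : Type*} [AddCommGroup C] [Module R C] [DGCoalg R C]
variable {C' : Type*} [AddCommGroup C'] [Module R C'] [DGCoalg R C']
variable {N : Type*} [AddCommGroup N] [Module R N] [DGMod R N] [DGBicomod R C N]
variable {N' : Type*} [AddCommGroup N'] [Module R N'] [DGMod R N'] [DGBicomod R C' N']

variable (R C N) in
/-- The underlying module of the coHochschild complex. -/
def hatEquiv : (N ⊗[R] Cobar R C) ≃ₗ[R] CoHochschild R C N :=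
  LinearEquiv.refl R (N ⊗[R] Cobar R C)

theorem hatEquiv_mem {n : ℤ} {z : N ⊗[R] Cobar R C} :
    hatEquiv R C N z ∈ gr R (CoHochschild R C N) n ↔ z ∈ gr R (N ⊗[R] Cobar R C) n := Iff.rfl

/-- `N ⊗ Ω C` and `CoHochschild` share module and grading but carry different differentials, the
tensor product one and the twisted one. `hatEquiv` marks every passage between them. -/
theorem d_hatEquiv (z : N ⊗[R] Cobar R C) :
    d R (hatEquiv R C N z) = hatEquiv R C N (cohochD R C N z) := rfl

theorem d_comp_hatEquiv : d R ∘ₗ (hatEquiv R C N).toLinearMap =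
    (hatEquiv R C N).toLinearMap ∘ₗ cohochD R C N := rfl

theorem tensor_d_hatEquiv (z : (N ⊗[R] N') ⊗[R] Cobar R (C ⊗[R] C')) :
    d R (hatEquiv R (C ⊗[R] C') (N ⊗[R] N') z) =
      hatEquiv R (C ⊗[R] C') (N ⊗[R] N') (cohochD R (C ⊗[R] C') (N ⊗[R] N') z) := by
  have h : d R ∘ₗ (hatEquiv R (C ⊗[R] C') (N ⊗[R] N')).toLinearMap =
      (hatEquiv R (C ⊗[R] C') (N ⊗[R] N')).toLinearMap ∘ₗ cohochD R (C ⊗[R] C') (N ⊗[R] N') :=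
    d_comp_hatEquiv
  exact LinearMap.congr_fun h z

theorem sgn_hatEquiv (k : ℤ) (z : N ⊗[R] Cobar R C) :
    sgn R k (hatEquiv R C N z) = hatEquiv R C N (sgn R k z) := by
  have : HasDegree R 0 (hatEquiv R C N).toLinearMap := fun n z hz => by
    rw [add_zero]; exact hatEquiv_mem.2 hz
  simpa using this.sgn_comm k z

variable (R C C' N N') in
/-- The underlying module of the tensor product of two coHochschild complexes. -/
def hatTensorEquiv : ((N ⊗[R] Cobar R C) ⊗[R] (N' ⊗[R] Cobar R C')) ≃ₗ[R]
    CoHochschild R C N ⊗[R] CoHochschild R C' N' :=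
  TensorProduct.congr (hatEquiv R C N) (hatEquiv R C' N')

theorem hatTensorEquiv_tmul (y : N ⊗[R] Cobar R C) (y' : N' ⊗[R] Cobar R C') :
    hatTensorEquiv R C C' N N' (y ⊗ₜ y') = hatEquiv R C N y ⊗ₜ hatEquiv R C' N' y' := rfl

theorem hatTensorEquiv_mem {n : ℤ} {z : (N ⊗[R] Cobar R C) ⊗[R] (N' ⊗[R] Cobar R C')} :
    hatTensorEquiv R C C' N N' z ∈ gr R (CoHochschild R C N ⊗[R] CoHochschild R C' N') n ↔
      z ∈ gr R ((N ⊗[R] Cobar R C) ⊗[R] (N' ⊗[R] Cobar R C')) n := by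
  constructor
  · intro hz
    have h : HasDegree R 0 (hatTensorEquiv R C C' N N').symm.toLinearMap :=
      hasDegree_tensor fun i x hx j y hy =>
        tmul_mem' (hatEquiv_mem.1 hx) (hatEquiv_mem.1 hy) (add_zero _).symm
    have h2 := h n _ hz
    rwa [add_zero, LinearEquiv.coe_coe, LinearEquiv.symm_apply_apply] at h2
  · intro hz
    have h : HasDegree R 0 (hatTensorEquiv R C C' N N').toLinearMap :=
      hasDegree_tensor fun i x hx j y hy =>
        tmul_mem' (hatEquiv_mem.2 hx) (hatEquiv_mem.2 hy) (add_zero _).symm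
    have h2 := h n _ hz
    rwa [add_zero] at h2

theorem d_hatTensorEquiv (z : (N ⊗[R] Cobar R C) ⊗[R] (N' ⊗[R] Cobar R C')) :
    d R (hatTensorEquiv R C C' N N' z) =
      hatTensorEquiv R C C' N N' (cohochTensorD R C C' N N' z) := by
  induction z with
  | zero => simp only [map_zero]
  | add x y hx hy => simp only [map_add, hx, hy]
  | tmul y y' =>
    rw [hatTensorEquiv_tmul, d_tmul, d_hatEquiv, d_hatEquiv, sgn_hatEquiv, cohochTensorD_tmul,
      map_add, hatTensorEquiv_tmul, hatTensorEquiv_tmul]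

variable (R C C' N N') in
/-- `cohochMilgramLin` as a map of coHochschild complexes. -/
def hatMilgram : CoHochschild R (C ⊗[R] C') (N ⊗[R] N') →ₗ[R]
    CoHochschild R C N ⊗[R] CoHochschild R C' N' :=
  (hatTensorEquiv R C C' N N').toLinearMap ∘ₗ cohochMilgramLin R C C' N N' ∘ₗ
    (hatEquiv R (C ⊗[R] C') (N ⊗[R] N')).symm.toLinearMap

theorem hatMilgram_hatEquiv (z : (N ⊗[R] N') ⊗[R] Cobar R (C ⊗[R] C')) :
    hatMilgram R C C' N N' (hatEquiv R (C ⊗[R] C') (N ⊗[R] N') z) =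
      hatTensorEquiv R C C' N N' (cohochMilgramLin R C C' N N' z) := by
  simp only [hatMilgram, LinearMap.comp_apply, LinearEquiv.coe_coe,
    LinearEquiv.symm_apply_apply]

theorem hatMilgram_mem (n : ℤ) (z : CoHochschild R (C ⊗[R] C') (N ⊗[R] N'))
    (hz : z ∈ gr R (CoHochschild R (C ⊗[R] C') (N ⊗[R] N')) n) :
    hatMilgram R C C' N N' z ∈ gr R (CoHochschild R C N ⊗[R] CoHochschild R C' N') n := by
  obtain ⟨z, rfl⟩ := (hatEquiv R (C ⊗[R] C') (N ⊗[R] N')).surjective z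
  rw [hatMilgram_hatEquiv, hatTensorEquiv_mem]
  have := hasDegree_cohochMilgramLin (R := R) (C := C) (C' := C') (N := N) (N' := N') n z
    (hatEquiv_mem.1 hz)
  rwa [add_zero] at this

theorem d_hatMilgram (z : CoHochschild R (C ⊗[R] C') (N ⊗[R] N')) :
    d R (hatMilgram R C C' N N' z) = hatMilgram R C C' N N' (d R z) := by
  obtain ⟨z, rfl⟩ := (hatEquiv R (C ⊗[R] C') (N ⊗[R] N')).surjective z
  rw [tensor_d_hatEquiv, hatMilgram_hatEquiv, hatMilgram_hatEquiv, d_hatTensorEquiv,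
    cohochMilgram_comm]

variable (R C C' N N') in
/-- The chain map `Ĥ(N ⊗ N', C ⊗ C') → Ĥ(N, C) ⊗ Ĥ(N', C')`. -/
def cohochMilgram : DGHom R (CoHochschild R (C ⊗[R] C') (N ⊗[R] N'))
    (CoHochschild R C N ⊗[R] CoHochschild R C' N') where
  lin := hatMilgram R C C' N N'
  mem := hatMilgram_mem
  comm := d_hatMilgram

variable (R C C' N N') in
/-- `cohochSection` as a map of coHochschild complexes. -/
def hatSection : CoHochschild R C N ⊗[R] CoHochschild R C' N' →ₗ[R]
    CoHochschild R (C ⊗[R] C') (N ⊗[R] N') :=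
  (hatEquiv R (C ⊗[R] C') (N ⊗[R] N')).toLinearMap ∘ₗ cohochSection R C C' N N' ∘ₗ
    (hatTensorEquiv R C C' N N').symm.toLinearMap

theorem hatSection_hatTensorEquiv (y : (N ⊗[R] Cobar R C) ⊗[R] (N' ⊗[R] Cobar R C')) :
    hatSection R C C' N N' (hatTensorEquiv R C C' N N' y) =
      hatEquiv R (C ⊗[R] C') (N ⊗[R] N') (cohochSection R C C' N N' y) := by
  simp only [hatSection, LinearMap.comp_apply, LinearEquiv.coe_coe, LinearEquiv.symm_apply_apply]

variable (R C C' N N') in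
/-- `cohochHomotopy` as a map of coHochschild complexes. -/
def hatHomotopy : CoHochschild R (C ⊗[R] C') (N ⊗[R] N') →ₗ[R]
    CoHochschild R (C ⊗[R] C') (N ⊗[R] N') :=
  (hatEquiv R (C ⊗[R] C') (N ⊗[R] N')).toLinearMap ∘ₗ cohochHomotopy R C C' N N' ∘ₗ
    (hatEquiv R (C ⊗[R] C') (N ⊗[R] N')).symm.toLinearMap

theorem hatHomotopy_hatEquiv (z : (N ⊗[R] N') ⊗[R] Cobar R (C ⊗[R] C')) :
    hatHomotopy R C C' N N' (hatEquiv R (C ⊗[R] C') (N ⊗[R] N') z) =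
      hatEquiv R (C ⊗[R] C') (N ⊗[R] N') (cohochHomotopy R C C' N N' z) := by
  simp only [hatHomotopy, LinearMap.comp_apply, LinearEquiv.coe_coe, LinearEquiv.symm_apply_apply]

theorem hatMilgram_hatHomotopy (z : CoHochschild R (C ⊗[R] C') (N ⊗[R] N')) :
    hatMilgram R C C' N N' (hatHomotopy R C C' N N' z) = 0 := by
  obtain ⟨z, rfl⟩ := (hatEquiv R (C ⊗[R] C') (N ⊗[R] N')).surjective z
  rw [hatHomotopy_hatEquiv, hatMilgram_hatEquiv, cohochMilgramLin_homotopy, map_zero]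

theorem hatMilgram_hatSection (y : CoHochschild R C N ⊗[R] CoHochschild R C' N') :
    hatMilgram R C C' N N' (hatSection R C C' N N' y) = y := by
  obtain ⟨y, rfl⟩ := (hatTensorEquiv R C C' N N').surjective y
  rw [hatSection_hatTensorEquiv, hatMilgram_hatEquiv, cohochMilgramLin_section]

theorem hatSection_mem (n : ℤ) (y : CoHochschild R C N ⊗[R] CoHochschild R C' N')
    (hy : y ∈ gr R (CoHochschild R C N ⊗[R] CoHochschild R C' N') n) :
    hatSection R C C' N N' y ∈ gr R (CoHochschild R (C ⊗[R] C') (N ⊗[R] N')) n := by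
  obtain ⟨y, rfl⟩ := (hatTensorEquiv R C C' N N').surjective y
  rw [hatSection_hatTensorEquiv, hatEquiv_mem]
  have := hasDegree_cohochSection (R := R) (C := C) (C' := C') (N := N) (N' := N') n y
    (hatTensorEquiv_mem.1 hy)
  rwa [add_zero] at this

theorem hatHomotopy_mem (n : ℤ) (z : CoHochschild R (C ⊗[R] C') (N ⊗[R] N'))
    (hz : z ∈ gr R (CoHochschild R (C ⊗[R] C') (N ⊗[R] N')) n) :
    hatHomotopy R C C' N N' z ∈ gr R (CoHochschild R (C ⊗[R] C') (N ⊗[R] N')) (n + 1) := by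
  obtain ⟨z, rfl⟩ := (hatEquiv R (C ⊗[R] C') (N ⊗[R] N')).surjective z
  rw [hatHomotopy_hatEquiv, hatEquiv_mem]
  exact hasDegree_cohochHomotopy (R := R) (C := C) (C' := C') (N := N) (N' := N') n z
    (hatEquiv_mem.1 hz)

variable (R C C' N N') in
/-- The filtration `tensorWeightLE` of the coHochschild complex. -/
def hatWeightLE (r : ℤ) : Submodule R (CoHochschild R (C ⊗[R] C') (N ⊗[R] N')) :=
  (tensorWeightLE (N ⊗[R] N') (mixed R C C') r).comap
    (hatEquiv R (C ⊗[R] C') (N ⊗[R] N')).symm.toLinearMap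

theorem hatEquiv_mem_hatWeightLE {r : ℤ} {z : (N ⊗[R] N') ⊗[R] Cobar R (C ⊗[R] C')} :
    hatEquiv R (C ⊗[R] C') (N ⊗[R] N') z ∈ hatWeightLE R C C' N N' r ↔
      z ∈ tensorWeightLE (N ⊗[R] N') (mixed R C C') r := by
  rw [hatWeightLE, Submodule.mem_comap, LinearEquiv.coe_coe, LinearEquiv.symm_apply_apply]

theorem hatHomotopy_defect {r : ℤ} {z : CoHochschild R (C ⊗[R] C') (N ⊗[R] N')}
    (hz : z ∈ hatWeightLE R C C' N N' r) :
    z - d R (hatHomotopy R C C' N N' z) - hatHomotopy R C C' N N' (d R z) -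
      hatSection R C C' N N' (hatMilgram R C C' N N' z) ∈ hatWeightLE R C C' N N' (r - 1) := by
  obtain ⟨z, rfl⟩ := (hatEquiv R (C ⊗[R] C') (N ⊗[R] N')).surjective z
  rw [hatHomotopy_hatEquiv, tensor_d_hatEquiv, tensor_d_hatEquiv, hatHomotopy_hatEquiv,
    hatMilgram_hatEquiv, hatSection_hatTensorEquiv, ← map_sub, ← map_sub, ← map_sub,
    hatEquiv_mem_hatWeightLE]
  exact cohochHomotopy_defect (hatEquiv_mem_hatWeightLE.1 hz)

theorem exists_hatWeightLE (z : CoHochschild R (C ⊗[R] C') (N ⊗[R] N')) :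
    ∃ r, z ∈ hatWeightLE R C C' N N' r := exists_tensorWeightLE (M := N ⊗[R] N') _

theorem hatWeightLE_neg (r : ℤ) (hr : r < 0) (z : CoHochschild R (C ⊗[R] C') (N ⊗[R] N'))
    (hz : z ∈ hatWeightLE R C C' N N' r) : z = 0 := by
  obtain ⟨z, rfl⟩ := (hatEquiv R (C ⊗[R] C') (N ⊗[R] N')).surjective z
  rw [tensorWeightLE_neg hr (hatEquiv_mem_hatWeightLE.1 hz), map_zero]

variable (R C C' N N') in
/-- The data contracting `Ĥ(N ⊗ N', C ⊗ C')` onto `Ĥ(N, C) ⊗ Ĥ(N', C')`. -/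
def cohochPreContraction : PreContraction R (CoHochschild R (C ⊗[R] C') (N ⊗[R] N'))
    (CoHochschild R C N ⊗[R] CoHochschild R C' N') where
  q := cohochMilgram R C C' N N'
  s := hatSection R C C' N N'
  h := hatHomotopy R C C' N N'
  s_mem := hatSection_mem
  h_mem := hatHomotopy_mem
  q_s := hatMilgram_hatSection
  q_h := hatMilgram_hatHomotopy
  nil := PreContraction.nil_of_filtration (q := cohochMilgram R C C' N N')
    (s := hatSection R C C' N N') (hatWeightLE R C C' N N')
    exists_hatWeightLE hatWeightLE_neg hatMilgram_hatHomotopy fun _ _ => hatHomotopy_defect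

end CohochPreContraction

/-! ### Naturality of the contraction of the cobar construction -/

section Naturality

variable {R : Type u} [CommRing R]
variable {C : Type*} [AddCommGroup C] [Module R C] [DGCoalg R C]
variable {C' : Type*} [AddCommGroup C'] [Module R C'] [DGCoalg R C']
variable {D : Type*} [AddCommGroup D] [Module R D] [DGCoalg R D]
variable {D' : Type*} [AddCommGroup D'] [Module R D'] [DGCoalg R D']
variable {φ : CoalgHom R C D} {φ' : CoalgHom R C' D'} {ψ : CoalgHom R (C ⊗[R] C') (D ⊗[R] D')}

theorem sgn_lin_natural {M P : Type*} [AddCommGroup M] [Module R M] [DGMod R M]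
    [AddCommGroup P] [Module R P] [DGMod R P] (f : DGHom R M P) (k : ℤ) (x : M) :
    sgn R k (f.lin x) = f.lin (sgn R k x) := by
  simpa using f.hasDegree.sgn_comm k x

theorem projR_natural (z : C ⊗[R] C') :
    projR R D D' (TensorProduct.map φ.lin φ'.lin z) = φ'.lin (projR R C C' z) := by
  induction z with
  | zero => simp
  | add x y hx hy => simp only [map_add, hx, hy]
  | tmul c c' =>
    rw [TensorProduct.map_tmul, projR_tmul, projR_tmul, φ.counit_lin, map_smul]

variable (hψ : ψ.lin = TensorProduct.map φ.lin φ'.lin)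
include hψ

/-- Only the underlying map `φ ⊗ φ'` of `ψ` matters. Coalgebra maps preserve units and counits, so
letters of each type go to letters of the same type. -/
theorem letterL_natural (c : C) :
    letterL R D D' (φ.lin c) = cobarMapAlg ψ (letterL R C C' c) := by
  rw [letterL_apply, letterL_apply, cobarMapAlg_univTw, hψ, TensorProduct.map_tmul, φ'.lin_one]

theorem letterR_natural (c : C') :
    letterR R D D' (φ'.lin c) = cobarMapAlg ψ (letterR R C C' c) := by
  rw [letterR_apply, letterR_apply, cobarMapAlg_univTw, hψ, TensorProduct.map_tmul, φ.lin_one]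

theorem letterM_natural (c : C) (c' : C') :
    letterM R D D' (φ.lin c ⊗ₜ φ'.lin c') = cobarMapAlg ψ (letterM R C C' (c ⊗ₜ c')) := by
  rw [letterM_apply, letterM_apply, map_sub, map_sub, cobarMapAlg_univTw, hψ,
    TensorProduct.map_tmul, projL_tmul, projL_tmul, projR_tmul, projR_tmul, φ.counit_lin,
    φ'.counit_lin, ← map_smul, ← map_smul, letterL_natural hψ, letterR_natural hψ]

theorem cobarInl_natural (a : Cobar R C) :
    cobarInl R D D' (cobarMapAlg φ a) = cobarMapAlg ψ (cobarInl R C C' a) := by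
  refine cobar_induction (p := fun a =>
    cobarInl R D D' (cobarMapAlg φ a) = cobarMapAlg ψ (cobarInl R C C' a)) ?_ ?_ ?_ ?_ a
  · simp only [map_one]
  · intro a b ha hb; simp only [map_add, ha, hb]
  · intro r a ha; simp only [map_smul, ha]
  · intro i c _ a ha
    simp only [map_mul, ha, cobarMapAlg_univTw, cobarInl_univTw, letterL_natural hψ]

theorem cobarInr_natural (a : Cobar R C') :
    cobarInr R D D' (cobarMapAlg φ' a) = cobarMapAlg ψ (cobarInr R C C' a) := by
  refine cobar_induction (p := fun a =>
    cobarInr R D D' (cobarMapAlg φ' a) = cobarMapAlg ψ (cobarInr R C C' a)) ?_ ?_ ?_ ?_ a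
  · simp only [map_one]
  · intro a b ha hb; simp only [map_add, ha, hb]
  · intro r a ha; simp only [map_smul, ha]
  · intro i c _ a ha
    simp only [map_mul, ha, cobarMapAlg_univTw, cobarInr_univTw, letterR_natural hψ]

theorem milgramSection_natural (y : Cobar R C ⊗[R] Cobar R C') :
    milgramSection R D D' (TensorProduct.map (cobarMap φ).lin (cobarMap φ').lin y) =
      (cobarMap ψ).lin (milgramSection R C C' y) := by
  induction y with
  | zero => simp only [map_zero]
  | add x y hx hy => simp only [map_add, hx, hy]
  | tmul a b =>
    rw [TensorProduct.map_tmul, milgramSection_tmul, milgramSection_tmul]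
    exact (congrArg₂ (· * ·) (cobarInl_natural hψ a) (cobarInr_natural hψ b)).trans
      (map_mul (cobarMapAlg ψ) _ _).symm

theorem milgramLin_natural (a : Cobar R (C ⊗[R] C')) :
    milgramLin R D D' ((cobarMap ψ).lin a) =
      TensorProduct.map (cobarMap φ).lin (cobarMap φ').lin (milgramLin R C C' a) := by
  have hm : ∀ a b, (cobarMap ψ).lin (a * b) = (cobarMap ψ).lin a * (cobarMap ψ).lin b :=
    fun a b => map_mul (cobarMapAlg ψ) a b
  have hmL : ∀ a b, (cobarMap φ).lin (a * b) = (cobarMap φ).lin a * (cobarMap φ).lin b :=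
    fun a b => map_mul (cobarMapAlg φ) a b
  have hmR : ∀ a b, (cobarMap φ').lin (a * b) = (cobarMap φ').lin a * (cobarMap φ').lin b :=
    fun a b => map_mul (cobarMapAlg φ') a b
  have hL : ∀ c, (cobarMap ψ).lin (letterL R C C' c) = letterL R D D' (φ.lin c) :=
    fun c => (letterL_natural hψ c).symm
  have hR : ∀ c, (cobarMap ψ).lin (letterR R C C' c) = letterR R D D' (φ'.lin c) :=
    fun c => (letterR_natural hψ c).symm
  have hM : ∀ c c', (cobarMap ψ).lin (letterM R C C' (c ⊗ₜ c')) =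
      letterM R D D' (φ.lin c ⊗ₜ φ'.lin c') := fun c c' => (letterM_natural hψ c c').symm
  refine cobar_tensor_induction (p := fun a => milgramLin R D D' ((cobarMap ψ).lin a) =
    TensorProduct.map (cobarMap φ).lin (cobarMap φ').lin (milgramLin R C C' a))
    ?_ ?_ ?_ ?_ ?_ ?_ a
  · have h1 : (cobarMap ψ).lin 1 = 1 := map_one (cobarMapAlg ψ)
    have h2 : (cobarMap φ).lin 1 = 1 := map_one (cobarMapAlg φ)
    have h3 : (cobarMap φ').lin 1 = 1 := map_one (cobarMapAlg φ')
    rw [h1, milgramLin_one, milgramLin_one, TensorProduct.map_tmul, h2, h3]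
  · intro a b ha hb; simp only [map_add, ha, hb]
  · intro r a ha; simp only [map_smul, ha]
  · intro i c _ a ha
    rw [hm, hL, milgramLin_letterL_mul, milgramLin_letterL_mul, ha]
    generalize milgramLin R C C' a = y
    induction y with
    | zero => simp only [map_zero]
    | add x y hx hy => simp only [map_add, hx, hy]
    | tmul w w' =>
      have h : (cobarMap φ).lin (univTw R c) = univTw R (φ.lin c) := cobarMapAlg_univTw φ c
      simp only [TensorProduct.map_tmul, LinearMap.rTensor_tmul, LinearMap.mulLeft_apply, hmL, h]
  · intro j c hc a ha
    rw [hm, hR, milgramLin_letterR_mul (φ'.mem j c hc), milgramLin_letterR_mul hc, ha]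
    generalize milgramLin R C C' a = y
    induction y with
    | zero => simp only [map_zero]
    | add x y hx hy => simp only [map_add, hx, hy]
    | tmul w w' =>
      have h : (cobarMap φ').lin (univTw R c) = univTw R (φ'.lin c) := cobarMapAlg_univTw φ' c
      simp only [TensorProduct.map_tmul, LinearMap.mulLeft_apply, hmR, h,
        sgn_lin_natural (cobarMap φ)]
  · intro i c _ j c' _ a _
    rw [hm, hM, milgramLin_letterM_mul, milgramLin_letterM_mul, map_zero]

theorem swapHom_natural (c' : C') (a : Cobar R C) :
    swapHom R D D' (φ'.lin c') (cobarMapAlg φ a) = cobarMapAlg ψ (swapHom R C C' c' a) := by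
  refine gr_induction (R := R) (p := fun c' =>
    swapHom R D D' (φ'.lin c') (cobarMapAlg φ a) = cobarMapAlg ψ (swapHom R C C' c' a)) ?_ ?_ c'
  · intro x y hx hy; simp only [map_add, LinearMap.add_apply, hx, hy]
  intro j c' hc'
  refine cobar_induction (p := fun a =>
    swapHom R D D' (φ'.lin c') (cobarMapAlg φ a) = cobarMapAlg ψ (swapHom R C C' c' a))
    ?_ ?_ ?_ ?_ a
  · rw [map_one, swapHom_at_one, swapHom_at_one, map_zero]
  · intro a b ha hb; simp only [map_add, ha, hb]
  · intro r a ha; simp only [map_smul, ha]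
  · intro i c hc a ha
    rw [map_mul, cobarMapAlg_univTw, swapHom_univTw_mul (φ.mem i c hc) (φ'.mem j c' hc'),
      swapHom_univTw_mul hc hc', ha, letterL_natural hψ, letterM_natural hψ, cobarInl_natural hψ,
      map_smul, map_add, map_mul, map_mul]

theorem swapTensor_natural (c' : C') (y : Cobar R C ⊗[R] Cobar R C') :
    swapTensor R D D' (φ'.lin c') (TensorProduct.map (cobarMap φ).lin (cobarMap φ').lin y) =
      (cobarMap ψ).lin (swapTensor R C C' c' y) := by
  induction y with
  | zero => simp only [map_zero]
  | add x y hx hy => simp only [map_add, hx, hy]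
  | tmul a b =>
    rw [TensorProduct.map_tmul, swapTensor_tmul, swapTensor_tmul]
    exact (congrArg₂ (· * ·) (swapHom_natural hψ c' a) (cobarInr_natural hψ b)).trans
      (map_mul (cobarMapAlg ψ) _ _).symm

/-- The recursion for `h` involves only `q`, `swapTensor`, the projection to `C'` and signs, each of
which commutes with the maps induced by coalgebra morphisms. -/
theorem cobarHomotopy_natural (a : Cobar R (C ⊗[R] C')) :
    cobarHomotopy R D D' ((cobarMap ψ).lin a) = (cobarMap ψ).lin (cobarHomotopy R C C' a) := by
  have hm : ∀ a b, (cobarMap ψ).lin (a * b) = (cobarMap ψ).lin a * (cobarMap ψ).lin b :=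
    fun a b => map_mul (cobarMapAlg ψ) a b
  have ht : ∀ c, (cobarMap ψ).lin (univTw R c) = univTw R (ψ.lin c) := cobarMapAlg_univTw ψ
  refine cobar_induction (p := fun a => cobarHomotopy R D D' ((cobarMap ψ).lin a) =
    (cobarMap ψ).lin (cobarHomotopy R C C' a)) ?_ ?_ ?_ ?_ a
  · have h1 : (cobarMap ψ).lin 1 = 1 := map_one (cobarMapAlg ψ)
    rw [h1, cobarHomotopy_one, cobarHomotopy_one, map_zero]
  · intro a b ha hb; simp only [map_add, ha, hb]
  · intro r a ha; simp only [map_smul, ha]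
  · intro i z _ a ha
    rw [hm, ht, cobarHomotopy_univTw_mul, cobarHomotopy_univTw_mul, ha, map_sub, hm, ht,
      sgn_lin_natural ψ.toDGHom, milgramLin_natural hψ, ← swapTensor_natural hψ, hψ, projR_natural]

end Naturality

/-! ### Naturality for coHochschild complexes -/

section CohochNaturality

variable {R : Type u} [CommRing R]
variable {C : Type*} [AddCommGroup C] [Module R C] [DGCoalg R C]
variable {C' : Type*} [AddCommGroup C'] [Module R C'] [DGCoalg R C']
variable {D : Type*} [AddCommGroup D] [Module R D] [DGCoalg R D]
variable {D' : Type*} [AddCommGroup D'] [Module R D'] [DGCoalg R D']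
variable {φ : CoalgHom R C D} {φ' : CoalgHom R C' D'} {ψ : CoalgHom R (C ⊗[R] C') (D ⊗[R] D')}
variable {N : Type*} [AddCommGroup N] [Module R N] [DGMod R N]
variable {N' : Type*} [AddCommGroup N'] [Module R N'] [DGMod R N']
variable {P : Type*} [AddCommGroup P] [Module R P] [DGMod R P]
variable {P' : Type*} [AddCommGroup P'] [Module R P'] [DGMod R P']

theorem cohochMilgramLin_natural (hψ : ψ.lin = TensorProduct.map φ.lin φ'.lin)
    (f : DGHom R N P) (f' : DGHom R N' P') (z : (N ⊗[R] N') ⊗[R] Cobar R (C ⊗[R] C')) :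
    cohochMilgramLin R D D' P P'
        (TensorProduct.map (TensorProduct.map f.lin f'.lin) (cobarMap ψ).lin z) =
      TensorProduct.map (TensorProduct.map f.lin (cobarMap φ).lin)
        (TensorProduct.map f'.lin (cobarMap φ').lin) (cohochMilgramLin R C C' N N' z) := by
  induction z with
  | zero => simp only [map_zero]
  | add x y hx hy => simp only [map_add, hx, hy]
  | tmul x a =>
    rw [TensorProduct.map_tmul, cohochMilgramLin_tmul, cohochMilgramLin_tmul,
      milgramLin_natural hψ, ← midSwap_natural f.lin f'.hasDegree (cobarMap φ).hasDegree,
      TensorProduct.map_tmul]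

theorem cohochSection_natural (hψ : ψ.lin = TensorProduct.map φ.lin φ'.lin)
    (f : DGHom R N P) (f' : DGHom R N' P') (y : (N ⊗[R] Cobar R C) ⊗[R] (N' ⊗[R] Cobar R C')) :
    cohochSection R D D' P P' (TensorProduct.map (TensorProduct.map f.lin (cobarMap φ).lin)
        (TensorProduct.map f'.lin (cobarMap φ').lin) y) =
      TensorProduct.map (TensorProduct.map f.lin f'.lin) (cobarMap ψ).lin
        (cohochSection R C C' N N' y) := by
  rw [cohochSection, cohochSection, LinearMap.comp_apply, LinearMap.comp_apply,
    midSwap_natural f.lin (cobarMap φ).hasDegree f'.hasDegree]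
  generalize midSwap R N (Cobar R C) N' (Cobar R C') y = z
  induction z with
  | zero => simp only [map_zero]
  | add x y hx hy => simp only [map_add, hx, hy]
  | tmul x a =>
    rw [TensorProduct.map_tmul, LinearMap.lTensor_tmul, LinearMap.lTensor_tmul,
      milgramSection_natural hψ, TensorProduct.map_tmul]

theorem cohochHomotopy_natural (hψ : ψ.lin = TensorProduct.map φ.lin φ'.lin)
    (f : DGHom R N P) (f' : DGHom R N' P') (z : (N ⊗[R] N') ⊗[R] Cobar R (C ⊗[R] C')) :
    cohochHomotopy R D D' P P'
        (TensorProduct.map (TensorProduct.map f.lin f'.lin) (cobarMap ψ).lin z) =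
      TensorProduct.map (TensorProduct.map f.lin f'.lin) (cobarMap ψ).lin
        (cohochHomotopy R C C' N N' z) := by
  induction z with
  | zero => simp only [map_zero]
  | add x y hx hy => simp only [map_add, hx, hy]
  | tmul x a =>
    rw [cohochHomotopy, cohochHomotopy, TensorProduct.map_tmul, TensorProduct.map_tmul,
      TensorProduct.map_tmul, TensorProduct.map_tmul, cobarHomotopy_natural hψ]
    exact congrArg (· ⊗ₜ _) (sgn_lin_natural (f.tensor f') 1 x)

/-! ### Compatibility with the inclusions and the projections -/

/-- The coaugmentation of `N'` has degree zero, so interchanging it with `w` costs no sign. -/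
theorem cohochMilgramLin_one_tmul [DGBicomod R C N] [DGBicomod R C' N']
    (a : Cobar R (C ⊗[R] C')) :
    cohochMilgramLin R C C' N N' (coaug R (C ⊗[R] C') (N ⊗[R] N') ⊗ₜ a) =
      TensorProduct.map (TensorProduct.mk R N (Cobar R C) (coaug R C N))
        (TensorProduct.mk R N' (Cobar R C') (coaug R C' N')) (milgramLin R C C' a) := by
  rw [cohochMilgramLin_tmul]
  show midSwap R N N' (Cobar R C) (Cobar R C')
    ((coaug R C N ⊗ₜ coaug R C' N') ⊗ₜ milgramLin R C C' a) = _
  generalize milgramLin R C C' a = y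
  induction y with
  | zero => simp only [map_zero, TensorProduct.tmul_zero]
  | add x y hx hy => simp only [map_add, TensorProduct.tmul_add, hx, hy]
  | tmul w w' =>
    have h : sgn R 0 w = w := by
      rw [sgn_congr (k := 0) (l := 1 + 1) (by decide), sgn_add, sgn_sgn]
    rw [midSwap_tmul _ (coaug_mem (C := C') (N := N')), TensorProduct.map_tmul, h]
    rfl

theorem algebraMapInv_univTw_mul (c : C) (a : Cobar R C) :
    (TensorAlgebra.algebraMapInv : Cobar R C →ₐ[R] R) (univTw R c * a) = 0 := by
  rw [map_mul]; simp [univTw, TensorAlgebra.algebraMapInv]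

/-- The augmentation sees only the coefficient of the empty word, which has degree zero. -/
theorem algebraMapInv_sgn (k : ℤ) (a : Cobar R C) :
    (TensorAlgebra.algebraMapInv : Cobar R C →ₐ[R] R) (sgn R k a) =
      (TensorAlgebra.algebraMapInv : Cobar R C →ₐ[R] R) a := by
  refine cobar_induction (p := fun a =>
    (TensorAlgebra.algebraMapInv : Cobar R C →ₐ[R] R) (sgn R k a) =
      (TensorAlgebra.algebraMapInv : Cobar R C →ₐ[R] R) a) ?_ ?_ ?_ ?_ a
  · rw [sgn_talg_one]
  · intro a b ha hb; simp only [map_add, ha, hb]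
  · intro r a ha; simp only [map_smul, ha]
  · intro i c hc a _
    rw [sgn_talg_mul, sgn_apply k (hasDegree_univTw R i c hc), smul_mul_assoc, map_smul,
      algebraMapInv_univTw_mul, algebraMapInv_univTw_mul, smul_zero]

/-- The projection `N ⊗ Ω C → N`. -/
def tensorAug (R : Type u) [CommRing R] (C N : Type*) [AddCommGroup C] [Module R C] [DGCoalg R C]
    [AddCommGroup N] [Module R N] : N ⊗[R] Cobar R C →ₗ[R] N :=
  (TensorProduct.rid R N).toLinearMap ∘ₗ
    (TensorAlgebra.algebraMapInv : Cobar R C →ₐ[R] R).toLinearMap.lTensor N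

theorem tensorAug_tmul (x : N) (a : Cobar R C) : tensorAug R C N (x ⊗ₜ a) =
    (TensorAlgebra.algebraMapInv : Cobar R C →ₐ[R] R) a • x := by
  simp [tensorAug]

/-- Milgram's map is compatible with the augmentations: it sends `1` to `1 ⊗ 1` and a word of
positive length either to zero or to words of positive total length. -/
theorem tensorAug_cohochMilgramLin (z : (N ⊗[R] N') ⊗[R] Cobar R (C ⊗[R] C')) :
    TensorProduct.map (tensorAug R C N) (tensorAug R C' N') (cohochMilgramLin R C C' N N' z) =
      tensorAug R (C ⊗[R] C') (N ⊗[R] N') z := by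
  have hmid : ∀ (x : N) (x' : N') (y : Cobar R C ⊗[R] Cobar R C'),
      TensorProduct.map (tensorAug R C N) (tensorAug R C' N')
        (midSwap R N N' (Cobar R C) (Cobar R C') ((x ⊗ₜ x') ⊗ₜ y)) =
      LinearMap.mul' R R (TensorProduct.map
        (TensorAlgebra.algebraMapInv : Cobar R C →ₐ[R] R).toLinearMap
        (TensorAlgebra.algebraMapInv : Cobar R C' →ₐ[R] R).toLinearMap y) • x ⊗ₜ x' := by
    intro x x' y
    induction y with
    | zero => simp only [map_zero, TensorProduct.tmul_zero, zero_smul]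
    | add y y' hy hy' => simp only [map_add, TensorProduct.tmul_add, add_smul, hy, hy']
    | tmul w w' =>
      refine gr_induction (R := R) (p := fun x' => TensorProduct.map (tensorAug R C N)
        (tensorAug R C' N')
        (midSwap R N N' (Cobar R C) (Cobar R C') ((x ⊗ₜ x') ⊗ₜ (w ⊗ₜ w'))) =
        LinearMap.mul' R R (TensorProduct.map
        (TensorAlgebra.algebraMapInv : Cobar R C →ₐ[R] R).toLinearMap
        (TensorAlgebra.algebraMapInv : Cobar R C' →ₐ[R] R).toLinearMap (w ⊗ₜ w')) • x ⊗ₜ x')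
        ?_ ?_ x'
      · intro y y' hy hy'
        simp only [TensorProduct.add_tmul, TensorProduct.tmul_add, map_add, smul_add, hy, hy']
      · intro k x' hx'
        rw [midSwap_tmul _ hx', TensorProduct.map_tmul, tensorAug_tmul, tensorAug_tmul,
          algebraMapInv_sgn, TensorProduct.smul_tmul_smul, TensorProduct.map_tmul,
          LinearMap.mul'_apply]
        rfl
  -- By type of the first letter: a left or right letter survives as a letter in one factor, which
  -- the augmentation there kills, and a mixed letter is killed by `q` itself.
  have hq : ∀ a : Cobar R (C ⊗[R] C'), LinearMap.mul' R R (TensorProduct.map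
        (TensorAlgebra.algebraMapInv : Cobar R C →ₐ[R] R).toLinearMap
        (TensorAlgebra.algebraMapInv : Cobar R C' →ₐ[R] R).toLinearMap (milgramLin R C C' a)) =
      (TensorAlgebra.algebraMapInv : Cobar R (C ⊗[R] C') →ₐ[R] R) a := by
    intro a
    refine cobar_tensor_induction (p := fun a => LinearMap.mul' R R (TensorProduct.map
        (TensorAlgebra.algebraMapInv : Cobar R C →ₐ[R] R).toLinearMap
        (TensorAlgebra.algebraMapInv : Cobar R C' →ₐ[R] R).toLinearMap (milgramLin R C C' a)) =
      (TensorAlgebra.algebraMapInv : Cobar R (C ⊗[R] C') →ₐ[R] R) a) ?_ ?_ ?_ ?_ ?_ ?_ a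
    · rw [milgramLin_one]; simp
    · intro a b ha hb; simp only [map_add, ha, hb]
    · intro r a ha; simp only [map_smul, ha]
    · intro i c _ a _
      rw [milgramLin_letterL_mul, letterL_apply, algebraMapInv_univTw_mul]
      generalize milgramLin R C C' a = y
      induction y with
      | zero => simp only [map_zero]
      | add x y hx hy => simp only [map_add, hx, hy, add_zero]
      | tmul w w' =>
        rw [LinearMap.rTensor_tmul, TensorProduct.map_tmul, LinearMap.mulLeft_apply,
          AlgHom.toLinearMap_apply, algebraMapInv_univTw_mul, TensorProduct.zero_tmul, map_zero]
    · intro j c hc a _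
      rw [milgramLin_letterR_mul hc, letterR_apply, algebraMapInv_univTw_mul]
      generalize milgramLin R C C' a = y
      induction y with
      | zero => simp only [map_zero]
      | add x y hx hy => simp only [map_add, hx, hy, add_zero]
      | tmul w w' =>
        rw [TensorProduct.map_tmul, TensorProduct.map_tmul, LinearMap.mulLeft_apply,
          AlgHom.toLinearMap_apply, AlgHom.toLinearMap_apply, algebraMapInv_univTw_mul,
          TensorProduct.tmul_zero, map_zero]
    · intro i c _ j c' _ a _
      rw [milgramLin_letterM_mul, letterM_apply, sub_mul, sub_mul, map_sub, map_sub,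
        letterL_apply, letterR_apply, algebraMapInv_univTw_mul, algebraMapInv_univTw_mul,
        algebraMapInv_univTw_mul]
      simp
  induction z with
  | zero => simp only [map_zero]
  | add x y hx hy => simp only [map_add, hx, hy]
  | tmul z a =>
    induction z with
    | zero => simp only [map_zero, TensorProduct.zero_tmul]
    | add x y hx hy => simp only [map_add, TensorProduct.add_tmul, hx, hy]
    | tmul x x' => rw [cohochMilgramLin_tmul, hmid, hq, tensorAug_tmul]

end CohochNaturality

/-! ### Naturality, inclusions and projections for morphisms in `BiComod`. -/

section BiComodNaturality

variable {R : Type u} [CommRing R] {X X' Y Y' : BiComod.{u, v} R} (F : X.Hom X') (G : Y.Hom Y')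

theorem tensor_hhat_hatEquiv (z : (X.N ⊗[R] Y.N) ⊗[R] Cobar R (X.C ⊗[R] Y.C)) :
    (F.tensor G).hhat.lin (hatEquiv R (X.C ⊗[R] Y.C) (X.N ⊗[R] Y.N) z) =
      hatEquiv R (X'.C ⊗[R] Y'.C) (X'.N ⊗[R] Y'.N)
        (TensorProduct.map (TensorProduct.map F.bicomod.toDGHom.lin G.bicomod.toDGHom.lin)
          (cobarMap (F.tensor G).coalg).lin z) := rfl

theorem hhat_tensor_hatTensorEquiv
    (y : (X.N ⊗[R] Cobar R X.C) ⊗[R] (Y.N ⊗[R] Cobar R Y.C)) :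
    (F.hhat.tensor G.hhat).lin (hatTensorEquiv R X.C Y.C X.N Y.N y) =
      hatTensorEquiv R X'.C Y'.C X'.N Y'.N
        (TensorProduct.map (TensorProduct.map F.bicomod.toDGHom.lin (cobarMap F.coalg).lin)
          (TensorProduct.map G.bicomod.toDGHom.lin (cobarMap G.coalg).lin) y) := by
  induction y with
  | zero => simp only [map_zero]
  | add x y hx hy => simp only [map_add, hx, hy]
  | tmul x y => rfl

theorem hatMilgram_natural (z : CoHochschild R (X.C ⊗[R] Y.C) (X.N ⊗[R] Y.N)) :
    hatMilgram R X'.C Y'.C X'.N Y'.N ((F.tensor G).hhat.lin z) =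
      (F.hhat.tensor G.hhat).lin (hatMilgram R X.C Y.C X.N Y.N z) := by
  obtain ⟨z, rfl⟩ := (hatEquiv R (X.C ⊗[R] Y.C) (X.N ⊗[R] Y.N)).surjective z
  rw [tensor_hhat_hatEquiv, hatMilgram_hatEquiv, hatMilgram_hatEquiv, hhat_tensor_hatTensorEquiv,
    cohochMilgramLin_natural (ψ := (F.tensor G).coalg) rfl]

theorem hatSection_natural (y : CoHochschild R X.C X.N ⊗[R] CoHochschild R Y.C Y.N) :
    hatSection R X'.C Y'.C X'.N Y'.N ((F.hhat.tensor G.hhat).lin y) =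
      (F.tensor G).hhat.lin (hatSection R X.C Y.C X.N Y.N y) := by
  obtain ⟨y, rfl⟩ := (hatTensorEquiv R X.C Y.C X.N Y.N).surjective y
  rw [hhat_tensor_hatTensorEquiv, hatSection_hatTensorEquiv, hatSection_hatTensorEquiv,
    tensor_hhat_hatEquiv, cohochSection_natural (ψ := (F.tensor G).coalg) rfl]

theorem hatHomotopy_natural (z : CoHochschild R (X.C ⊗[R] Y.C) (X.N ⊗[R] Y.N)) :
    hatHomotopy R X'.C Y'.C X'.N Y'.N ((F.tensor G).hhat.lin z) =
      (F.tensor G).hhat.lin (hatHomotopy R X.C Y.C X.N Y.N z) := by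
  obtain ⟨z, rfl⟩ := (hatEquiv R (X.C ⊗[R] Y.C) (X.N ⊗[R] Y.N)).surjective z
  rw [tensor_hhat_hatEquiv, hatHomotopy_hatEquiv, hatHomotopy_hatEquiv, tensor_hhat_hatEquiv,
    cohochHomotopy_natural (ψ := (F.tensor G).coalg) rfl]

theorem hatMilgram_cohochIncl (X Y : BiComod.{u, v} R) (a : Cobar R (X.C ⊗[R] Y.C)) :
    hatMilgram R X.C Y.C X.N Y.N ((cohochIncl R (X.C ⊗[R] Y.C) (X.N ⊗[R] Y.N)).lin a) =
      ((cohochIncl R X.C X.N).tensor (cohochIncl R Y.C Y.N)).lin (milgramLin R X.C Y.C a) := by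
  have h1 : (cohochIncl R (X.C ⊗[R] Y.C) (X.N ⊗[R] Y.N)).lin a =
    hatEquiv R (X.C ⊗[R] Y.C) (X.N ⊗[R] Y.N) (coaug R (X.C ⊗[R] Y.C) (X.N ⊗[R] Y.N) ⊗ₜ a) := rfl
  rw [h1, hatMilgram_hatEquiv, cohochMilgramLin_one_tmul]
  generalize milgramLin R X.C Y.C a = y
  induction y with
  | zero => simp only [map_zero]
  | add x y hx hy => simp only [map_add, hx, hy]
  | tmul w w' => rfl

theorem cohochProj_hatMilgram (X Y : BiComod.{u, v} R)
    (z : CoHochschild R (X.C ⊗[R] Y.C) (X.N ⊗[R] Y.N)) :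
    ((cohochProj R X.C X.N).tensor (cohochProj R Y.C Y.N)).lin (hatMilgram R X.C Y.C X.N Y.N z) =
      (cohochProj R (X.C ⊗[R] Y.C) (X.N ⊗[R] Y.N)).lin z := by
  obtain ⟨z, rfl⟩ := (hatEquiv R (X.C ⊗[R] Y.C) (X.N ⊗[R] Y.N)).surjective z
  have h : ∀ y, ((cohochProj R X.C X.N).tensor (cohochProj R Y.C Y.N)).lin
      (hatTensorEquiv R X.C Y.C X.N Y.N y) =
      TensorProduct.map (tensorAug R X.C X.N) (tensorAug R Y.C Y.N) y := by
    intro y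
    induction y with
    | zero => simp only [map_zero]
    | add x y hx hy => simp only [map_add, hx, hy]
    | tmul w w' => rfl
  rw [hatMilgram_hatEquiv, h, tensorAug_cohochMilgramLin]
  rfl

theorem cohochPreContraction_inv_natural (y : CoHochschild R X.C X.N ⊗[R] CoHochschild R Y.C Y.N) :
    (cohochPreContraction R X'.C Y'.C X'.N Y'.N).inv.lin ((F.hhat.tensor G.hhat).lin y) =
      (F.tensor G).hhat.lin ((cohochPreContraction R X.C Y.C X.N Y.N).inv.lin y) :=
  PreContraction.inv_natural (P := cohochPreContraction R X.C Y.C X.N Y.N)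
    (P' := cohochPreContraction R X'.C Y'.C X'.N Y'.N) (f := (F.tensor G).hhat)
    (g := F.hhat.tensor G.hhat) (hatHomotopy_natural F G) (hatSection_natural F G) y

theorem cohochPreContraction_homotopy_natural
    (z : CoHochschild R (X.C ⊗[R] Y.C) (X.N ⊗[R] Y.N)) :
    (cohochPreContraction R X'.C Y'.C X'.N Y'.N).homotopy ((F.tensor G).hhat.lin z) =
      (F.tensor G).hhat.lin ((cohochPreContraction R X.C Y.C X.N Y.N).homotopy z) :=
  PreContraction.homotopy_natural (P := cohochPreContraction R X.C Y.C X.N Y.N)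
    (P' := cohochPreContraction R X'.C Y'.C X'.N Y'.N) (f := (F.tensor G).hhat)
    (hatHomotopy_natural F G) z

end BiComodNaturality

end CoHoch

end

theorem mainTheorem6 {R : Type u} [CommRing R] :
    ∃ (qhat : ∀ X Y : CoHoch.BiComod.{u, v} R,
        CoHoch.DGHom R (X.tensor Y).Hhat (X.Hhat ⊗[R] Y.Hhat))
      (shat : ∀ X Y : CoHoch.BiComod.{u, v} R,
        CoHoch.DGHom R (X.Hhat ⊗[R] Y.Hhat) (X.tensor Y).Hhat)
      (h : ∀ X Y : CoHoch.BiComod.{u, v} R,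
        CoHoch.DGHomotopy ((shat X Y).comp (qhat X Y)) (CoHoch.DGHom.id R (X.tensor Y).Hhat))
      (k : ∀ X Y : CoHoch.BiComod.{u, v} R,
        CoHoch.DGHomotopy ((qhat X Y).comp (shat X Y)) (CoHoch.DGHom.id R (X.Hhat ⊗[R] Y.Hhat))),
      -- naturality in both bicomodule pairs
      (∀ (X X' Y Y' : CoHoch.BiComod.{u, v} R) (F : X.Hom X') (G : Y.Hom Y'),
        (qhat X' Y').comp (F.tensor G).hhat = (F.hhat.tensor G.hhat).comp (qhat X Y) ∧
        (shat X' Y').comp (F.hhat.tensor G.hhat) = (F.tensor G).hhat.comp (shat X Y) ∧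
        (h X' Y').lin ∘ₗ (F.tensor G).hhat.lin = (F.tensor G).hhat.lin ∘ₗ (h X Y).lin ∧
        (k X' Y').lin ∘ₗ (F.hhat.tensor G.hhat).lin =
          (F.hhat.tensor G.hhat).lin ∘ₗ (k X Y).lin) ∧
      -- the upper square
      (∀ X Y : CoHoch.BiComod.{u, v} R,
        (qhat X Y).comp (CoHoch.cohochIncl R (X.tensor Y).C (X.tensor Y).N) =
          ((CoHoch.cohochIncl R X.C X.N).tensor (CoHoch.cohochIncl R Y.C Y.N)).comp
            (CoHoch.milgram R X.C Y.C)) ∧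
      -- the lower square
      (∀ X Y : CoHoch.BiComod.{u, v} R,
        ((CoHoch.cohochProj R X.C X.N).tensor (CoHoch.cohochProj R Y.C Y.N)).comp (qhat X Y) =
          CoHoch.cohochProj R (X.tensor Y).C (X.tensor Y).N) := by
  refine ⟨fun X Y => CoHoch.cohochMilgram R X.C Y.C X.N Y.N,
    fun X Y => (CoHoch.cohochPreContraction R X.C Y.C X.N Y.N).inv,
    fun X Y => (CoHoch.cohochPreContraction R X.C Y.C X.N Y.N).invCompHomotopy,
    fun X Y => (CoHoch.cohochPreContraction R X.C Y.C X.N Y.N).compInvHomotopy,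
    fun X X' Y Y' F G => ⟨?_, ?_, ?_, ?_⟩, fun X Y => ?_, fun X Y => ?_⟩
  · exact CoHoch.DGHom.ext' (LinearMap.ext (CoHoch.hatMilgram_natural F G))
  · exact CoHoch.DGHom.ext' (LinearMap.ext (CoHoch.cohochPreContraction_inv_natural F G))
  · exact LinearMap.ext (CoHoch.cohochPreContraction_homotopy_natural F G)
  -- Since `q̂ ŝ` is the identity, the second homotopy is zero and its naturality is trivial.
  · exact (LinearMap.zero_comp _).trans (LinearMap.comp_zero _).symm
  · exact CoHoch.DGHom.ext' (LinearMap.ext (CoHoch.hatMilgram_cohochIncl X Y))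
  · exact CoHoch.DGHom.ext' (LinearMap.ext (CoHoch.cohochProj_hatMilgram X Y))
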